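/- **Notation and assumptions.** For a random variable $Z$ write $F_Z$ for its distribution and $\overline F_Z(x)=P(Z>x)$. - $F_Z\in\mathcal S$ means: the law $\mu$ of $Z_+=\max(Z,0)$ is subexponential, i.e. $P(Y_1+\dots+Y_n>x)\sim n\,P(Y_1>x)$ as $x\to\infty$ for every $n\ge2$ and iid $Y_i\sim\mu$, and the tail balance condition $P(Z>x)/P(|Z|>x)\to p_+$, $P(-Z>x)/P(|Z|>x)\to p_-$ ($x\to\infty$) holds for some $p_+>0$, $p_-\ge0$ with $p_++p_-=1$. - $F_Z\in\mathrm{MDA}(\mathrm{Gumbel})$ means: there are $c_n>0$, $d_n\in\mathbb R$ with $F_Z(c_nx+d_n)^n\to e^{-e^{-x}}$ for all $x\in\mathbb R$. - $F_Z\in\mathbf{LN}$ means: $\overline F_Z(x)=e^{-S(x)}$ for large $x$, where $S$ is slowly varying at infinity and $S(x)/\log x\to\infty$. - An auxiliary function for $F_Z$ is an (eventually) positive function $a$ with a Lebesgue density $a'$ such that $a'(x)\to0$ and $\overline F_Z(x+y\,a(x))/\overline F_Z(x)\to e^{-y}$ as $x\to\infty$ for every $y\in\mathbb R$. Let $(Z_t)_{t\in\mathbb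 Z}$ be iid with generic element $Z$, $E|Z|<\infty$, $E[Z]=0$ and $F_Z\in\mathcal S\cap\mathrm{MDA}(\mathrm{Gumbel})$. Let $(\psi_j)_{j\ge0}$ be real numbers with $\max_j|\psi_j|=1$, $\sum_j|\psi_j|<\infty$ and $$\sum_{i\ge1}\Big(\sum_{j\ge i}|\psi_j|\Big)^{\delta}<\infty\quad\text{for some }\delta\in(0,1),$$ and put $m_0=\sum_{j\ge0}\psi_j$, $m_1=\sum_{j\ge1}|\psi_j|$, $m_0'=\sum_{j\ge0}|\psi_j|$. Assume $m_0\ne0$. Let $X_t=\sum_{j\ge0}\psi_jZ_{t-j}$ (an a.s. convergent series), $S_n=X_1+\dots+X_n$ and $S_{n,Z}=Z_1+\dots+Z_n$. Let $a$ be an auxiliary function for $F_Z$ and $g$ a function with $g(x)=o(a(x))$ as $x\to\infty$. Let $(t_n)$ be a real sequence, $\delta_0>0$, and let $\Lambda_n\subset(|m_0|\,t_n(1+\delta_0),\infty)$ be sets. (Suprema over the empty set are $0$.) Assume the following large deviation property of the noise, for every $\delta>0$: - if $m_0>0$: $\displaystyle\sup_{x>(1+\delta)t_n}\Big|\frac{P(S_{n,Z}>x)}{n\,P(Z>x)}-1\Big|\to0$;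 - if $m_0<0$ and $p_->0$: $\displaystyle\sup_{x>(1+\delta)t_n}\Big|\frac{P(-S_{n,Z}>x)}{n\,P(Z\le -x)}-1\Big|\to0$; - if $m_0<0$ and $p_-=0$: $\displaystyle\sup_{x>(1+\delta)t_n}\frac{P(-S_{n,Z}>x)}{n\,P(|Z|>x)}\to0$. **Proposition.** 1. If $\displaystyle\lim_{n\to\infty}\sup_{x\in\Lambda_n}\frac{P(m_1|Z|>g(x))}{n\,P(|m_0||Z|>x)}=0$, then $$\lim_{n\to\infty}\sup_{x\in\Lambda_n}\Big|\frac{P(S_n>x)}{n\,P(|Z|>x/|m_0|)}-p_\pm\mathbf 1_{(0,\infty)}(\pm m_0)\Big|=0,\qquad(\ast)$$ where the constant is $p_+$ if $m_0>0$ and $p_-$ if $m_0<0$. 2. Suppose that $\psi_j=0$ for $j>m$, for some $m\ge1$, and, in case $m_0'\ne|m_0|$ (that is, if the $\psi_j$ do not all have the same sign), that $F_Z\in\mathbf{LN}$. If $$\lim_{n\to\infty}\sup_{x\in\Lambda_n}\Big[\frac{P(m_0'|Z|>x)}{n\,P(|m_0||Z|>x)}+\frac{[P(m_0'|Z|>g(x))]^2}{P(|m_0||Z|>x)}\Big]=0,$$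 then $(\ast)$ holds. -/

import Mathlib

open MeasureTheory ProbabilityTheory Filter Topology Asymptotics

noncomputable section

namespace LargeDev

/-- The right tail `x ↦ ν (x, ∞)` of a law `ν` on the real line. -/
def rightTail (ν : Measure ℝ) (x : ℝ) : ℝ := ν.real (Set.Ioi x)

/-- The tail `x ↦ P(c |Z| > x)` of `c |Z|`, where `Z` has law `ν`. -/
def absTail (ν : Measure ℝ) (c x : ℝ) : ℝ := ν.real {z | x < c * |z|}

/-- The class `S₊` of subexponential laws on `[0, ∞)`: the tail of the `n`-fold convolution is
asymptotically equivalent to `n` times the tail, for all `n ≥ 2`. -/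
def IsSubexpPos (μ : Measure ℝ) : Prop :=
  IsProbabilityMeasure μ ∧ μ (Set.Iio 0) = 0 ∧
    ∀ n : ℕ, 2 ≤ n →
      Tendsto (fun x : ℝ =>
          (Measure.pi (fun _ : Fin n => μ)).real {z | x < ∑ i, z i} / (n * rightTail μ x))
        atTop (𝓝 1)

/-- The two-sided class `S`, with tail balance constants `p` (right) and `q` (left): the law of
`max Z 0` is in `S₊`, and the tail balance condition holds. -/
structure IsSubexp (ν : Measure ℝ) (p q : ℝ) : Prop where
  pos_part : IsSubexpPos (ν.map (fun z => max z 0))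
  p_pos : 0 < p
  q_nonneg : 0 ≤ q
  add_eq_one : p + q = 1
  right_balance : Tendsto (fun x : ℝ => ν.real {z | x < z} / ν.real {z | x < |z|}) atTop (𝓝 p)
  left_balance : Tendsto (fun x : ℝ => ν.real {z | x < -z} / ν.real {z | x < |z|}) atTop (𝓝 q)

/-- Maximum domain of attraction of the Gumbel law. The maximum of `n` iid variables with law `ν`
is at most `u` with probability `(ν (-∞, u])^n`. -/
def IsGumbelMDA (ν : Measure ℝ) : Prop :=
  ∃ c d : ℕ → ℝ, (∀ n, 0 < c n) ∧
    ∀ x : ℝ, Tendsto (fun n : ℕ => (ν.real (Set.Iic (c n * x + d n))) ^ n) atTop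
      (𝓝 (Real.exp (-Real.exp (-x))))

/-- `a` is an auxiliary function for `ν`: on some half-line `[x₀, ∞)` it is positive and has a
Lebesgue density `a'` with `a'(x) → 0`, and the tail ratio at `x + y a(x)` and `x` tends to
`exp (-y)` for all real `y`. -/
def IsAuxiliary (ν : Measure ℝ) (a : ℝ → ℝ) : Prop :=
  (∃ (x₀ : ℝ) (a' : ℝ → ℝ),
    (∀ x, x₀ ≤ x → 0 < a x ∧ IntervalIntegrable a' volume x₀ x ∧
      a x = a x₀ + ∫ u in x₀..x, a' u) ∧
    Tendsto a' atTop (𝓝 0)) ∧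
  ∀ y : ℝ, Tendsto (fun x : ℝ => rightTail ν (x + y * a x) / rightTail ν x) atTop
    (𝓝 (Real.exp (-y)))

/-- The class `LN`: the right tail is `exp (-S)` with `S` slowly varying and `S(x) / log x → ∞`. -/
def IsLN (ν : Measure ℝ) : Prop :=
  ∃ S : ℝ → ℝ, (∀ᶠ x in atTop, rightTail ν x = Real.exp (-S x)) ∧
    (∀ c : ℝ, 0 < c → Tendsto (fun x => S (c * x) / S x) atTop (𝓝 1)) ∧
    Tendsto (fun x => S x / Real.log x) atTop atTop

/-- `sup_{x ∈ A n} |f n x - c| → 0` as `n → ∞` (the supremum over the empty set being `0`). -/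
def UnifTendsto (A : ℕ → Set ℝ) (f : ℕ → ℝ → ℝ) (c : ℝ) : Prop :=
  ∀ ε : ℝ, 0 < ε → ∀ᶠ n in atTop, ∀ x ∈ A n, |f n x - c| ≤ ε

/-- The partial sum `Y₁ + ⋯ + Yₙ`. -/
def partialSum {Ω : Type*} (Y : ℤ → Ω → ℝ) (n : ℕ) (ω : Ω) : ℝ :=
  ∑ i ∈ Finset.range n, Y ((i : ℤ) + 1) ω

/-- Standing assumptions on the coefficients: `max |ψ j| = 1`, `∑ |ψ j| < ∞`, and
`∑_{i ≥ 1} (∑_{j ≥ i} |ψ j|)^δ < ∞` for some `δ ∈ (0, 1)`. -/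
structure IsWeight (ψ : ℕ → ℝ) : Prop where
  abs_le_one : ∀ j, |ψ j| ≤ 1
  exists_abs_eq_one : ∃ j, |ψ j| = 1
  summable_abs : Summable (fun j => |ψ j|)
  summable_tails : ∃ δ : ℝ, 0 < δ ∧ δ < 1 ∧
    Summable (fun i : ℕ => (∑' j : ℕ, |ψ (i + 1 + j)|) ^ δ)

/-- `∑_{j ≥ 0} ψ j`. -/
def m0 (ψ : ℕ → ℝ) : ℝ := ∑' j, ψ j

/-- `∑_{j ≥ 1} |ψ j|`. -/
def m1 (ψ : ℕ → ℝ) : ℝ := ∑' j, |ψ (j + 1)|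

/-- `∑_{j ≥ 0} |ψ j|`. -/
def m0' (ψ : ℕ → ℝ) : ℝ := ∑' j, |ψ j|

/-- The large deviation assumption on the iid noise `Z` with law `ν`, left tail balance constant
`q`, separating sequence `t`, and a sign given by that of `m`. For `m > 0` it concerns the right
tail of the sums `S_{n,Z}`. For `m < 0` it concerns the left tail, and it says that
`P(-S_{n,Z} > x)` is asymptotically `n P(Z ≤ -x)` if `q > 0`, and is negligible with respect to
`n P(|Z| > x)` if `q = 0`. -/
structure NoiseLargeDev {Ω : Type*} [MeasurableSpace Ω] (P : Measure Ω) (Z : ℤ → Ω → ℝ)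
    (ν : Measure ℝ) (q : ℝ) (t : ℕ → ℝ) (m : ℝ) : Prop where
  right : 0 < m → ∀ δ : ℝ, 0 < δ →
    UnifTendsto (fun n => Set.Ioi ((1 + δ) * t n))
      (fun n x => P.real {ω | x < partialSum Z n ω} / (n * ν.real (Set.Ioi x))) 1
  left : m < 0 → 0 < q → ∀ δ : ℝ, 0 < δ →
    UnifTendsto (fun n => Set.Ioi ((1 + δ) * t n))
      (fun n x => P.real {ω | x < -partialSum Z n ω} / (n * ν.real (Set.Iic (-x)))) 1
  left_negligible : m < 0 → q = 0 → ∀ δ : ℝ, 0 < δ →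
    UnifTendsto (fun n => Set.Ioi ((1 + δ) * t n))
      (fun n x => P.real {ω | x < -partialSum Z n ω} / (n * absTail ν 1 x)) 0

end LargeDev

end

noncomputable section

set_option linter.unusedSectionVars false

namespace LargeDev

/-! A heavy-tailed sum exceeds a very high level because a single summand does. The partial sum of
the linear process is `m0 ψ` times the noise walk plus boundary effects: the weight of the `k`-th
noise variable differs from that of the multiple of the walk by at most a coefficient tail `tailSum
ψ i`, where `i` is the distance of `k` from the nearby end of the block on its right
(`abs_totalWeight_sub_le`). The walk itself is controlled by assumption, so the task is to show that
the boundary effects are negligible. Changing the sign of coefficients and noise together reduces to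
`m0 ψ > 0`. With `y = x / |m0 ψ|` and `H` the tail of `|Z|`, everything is measured against `n * H
y` along a filter of pairs `(n, y)` (`LDRegime`).

Three inputs carry the argument. (i) `HeavyTail.le_pow_mul`: moving down from `y` in steps of the
auxiliary function, each of which at least doubles `H`, gives `H y ≤ C (a y / y)^p H (c y)`. Hence
`H` is rapidly varying and decays faster than any power, and if `H (c y)` exceeds `H y` at most by a
power of `y`, then `a y ≥ y^(3/4)`. (ii) Subexponentiality, made uniform over all laws with tails
dominated by multiples of `H`. (iii) The central limit theorem: the walk exceeds `√n` with
probability bounded below, which forces `n ≤ y ^ 2` in the regime.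

General coefficients: since `g x ≤ ε x` eventually, the hypothesis gives `H (c y) = o(n H y)` for
every `c > 0`, so `a y ≥ y^(3/4)`. Perturbations below `θ * a y` change the tail by a factor close
to one. A larger perturbation must contain a term exceeding its share of the threshold.
`perturbation_cases` lists five configurations, each of probability `o(n H y)`; the delicate one,
where the same step makes both walk and perturbation large, uses exchangeability of the steps. The
case `m1 ψ = 0` is separate, because there the sum is an exact multiple of the walk.

Finite moving averages: at most `2 m` boundary variables remain. If all signs agree, their relative
weights lie in `[0, 1]`, so a large boundary variable can be promoted to a full step; that this
particular step is the only large one costs a factor of order `1 / n`, and two large variables cost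
`H (η y) ^ 2 = o(H y)` (`LDRegime.real_add_le`). With mixed signs relative weights may exceed one,
and promotion fails. The slow variation of `-log H` then yields a Chernoff bound: without a jump
above `y` the walk reaches `θ y` with probability at most `H y ^ c` (`LDRegime.trunc_le_exp`), so it
cannot usefully cooperate with a large boundary variable. -/

/-! ### Heavy tails and their auxiliary functions. -/

lemma eventually_le_mul_of_lip {a : ℝ → ℝ}
    (h : ∀ ε : ℝ, 0 < ε → ∃ x₁ : ℝ, ∀ x y, x₁ ≤ x → x₁ ≤ y → |a x - a y| ≤ ε * |x - y|)
    {ε : ℝ} (hε : 0 < ε) : ∀ᶠ x in atTop, a x ≤ ε * x := by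
  obtain ⟨x₁, h1⟩ := h (ε / 2) (by positivity)
  filter_upwards [eventually_ge_atTop (max x₁ 0),
    eventually_ge_atTop (2 * (a (max x₁ 0)) / ε)] with x hx hx2
  have h2 := h1 x (max x₁ 0) ((le_max_left _ _).trans hx) (le_max_left _ _)
  rw [abs_of_nonneg (sub_nonneg.2 hx)] at h2
  have h3 := (abs_le.1 h2).2
  have h4 : 0 ≤ max x₁ 0 := le_max_right _ _
  rw [div_le_iff₀ hε] at hx2
  nlinarith

/-- The tail `H` of a two-sided subexponential law in the Gumbel domain of attraction, together
with an auxiliary function `a`. -/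
structure HeavyTail (H a : ℝ → ℝ) : Prop where
  anti : Antitone H
  pos : ∀ x, 0 < H x
  le_one : ∀ x, H x ≤ 1
  tendsto_zero : Tendsto H atTop (𝓝 0)
  a_pos : ∀ᶠ x in atTop, 0 < a x
  a_lip : ∀ ε : ℝ, 0 < ε → ∃ x₁ : ℝ, ∀ x y, x₁ ≤ x → x₁ ≤ y → |a x - a y| ≤ ε * |x - y|
  ratio : ∀ s : ℝ, Tendsto (fun x => H (x + s * a x) / H x) atTop (𝓝 (Real.exp (-s)))
  long : ∀ K : ℝ, Tendsto (fun x => H (x - K) / H x) atTop (𝓝 1)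
  -- A moderate value of the second variable is of little help to the sum. The constants `K` and
  -- `x₀` do not depend on the laws nor on `A` and `B`, because this is applied to random walks,
  -- where `B` is of order `n` and the tail bound is only known near `x`.
  conv_trunc : ∀ η : ℝ, 0 < η → η < 1 → ∀ ε : ℝ, 0 < ε → ∃ K : ℝ, 0 < K ∧ ∃ x₀ : ℝ, ∀ x, x₀ ≤ x →
    ∀ (ρ₁ ρ₂ : Measure ℝ) [IsProbabilityMeasure ρ₁] [IsProbabilityMeasure ρ₂] (A B : ℝ),
      0 ≤ A → 0 ≤ B → (∀ u, (1 - η) * x ≤ u → ρ₁.real (Set.Ioi u) ≤ B * H u) →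
      (∀ r, ρ₂.real (Set.Ioi r) ≤ A * H r) →
      (ρ₁.prod ρ₂).real {z | x < z.1 + z.2 ∧ K < z.2 ∧ z.2 ≤ η * x} ≤ A * B * ε * H x
  conv : ∃ C : ℝ, 0 < C ∧
    ∀ (ρ₁ ρ₂ : Measure ℝ) [IsProbabilityMeasure ρ₁] [IsProbabilityMeasure ρ₂] (A B : ℝ),
      0 ≤ A → 0 ≤ B → (∀ u, ρ₁.real (Set.Ioi u) ≤ B * H u) →
      (∀ r, ρ₂.real (Set.Ioi r) ≤ A * H r) →
      ∀ x, (ρ₁.prod ρ₂).real {z | x < z.1 + z.2} ≤ C * A * B * H x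

namespace HeavyTail

variable {H a : ℝ → ℝ}

lemma a_small (h : HeavyTail H a) {ε : ℝ} (hε : 0 < ε) : ∀ᶠ x in atTop, a x ≤ ε * x :=
  eventually_le_mul_of_lip h.a_lip hε

lemma ratio_le (h : HeavyTail H a) {s c : ℝ} (hc : Real.exp s < c) :
    ∀ᶠ x in atTop, H (x - s * a x) ≤ c * H x := by
  have := (h.ratio (-s)).eventually_lt_const (u := c) (by simpa using hc)
  filter_upwards [this] with x hx
  have h2 := (div_lt_iff₀ (h.pos x)).1 hx
  rw [neg_mul, ← sub_eq_add_neg] at h2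
  exact h2.le

lemma le_ratio (h : HeavyTail H a) {s c : ℝ} (hc : c < Real.exp s) :
    ∀ᶠ x in atTop, c * H x ≤ H (x - s * a x) := by
  have := (h.ratio (-s)).eventually_const_lt (u := c) (by simpa using hc)
  filter_upwards [this] with x hx
  have h2 := (lt_div_iff₀ (h.pos x)).1 hx
  rw [neg_mul, ← sub_eq_add_neg] at h2
  exact h2.le

/-- If the auxiliary function is small at `y`, then the tail drops a lot between `c * y` and `y`. -/
lemma le_pow_mul (h : HeavyTail H a) {c : ℝ} (hc0 : 0 < c) (hc1 : c < 1) {p : ℕ} (hp : p ≠ 0) :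
    ∃ C : ℝ, 0 < C ∧ ∀ᶠ y in atTop, H y ≤ C * (a y / y) ^ p * H (c * y) := by
  -- Each downward step doubles `H` while the step length grows at most by the factor `b`; with `b ^
  -- p = 2`, a distance of order `b ^ k` yields the gain `2 ^ k = (b ^ k) ^ p`.
  set b : ℝ := (2 : ℝ) ^ ((p : ℝ)⁻¹) with hb
  have hbp : b ^ p = 2 := Real.rpow_inv_natCast_pow (by norm_num) hp
  have hb1 : 1 < b := Real.one_lt_rpow (by norm_num) (by positivity)
  set ε := b - 1 with hε
  have hε0 : 0 < ε := by linarith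
  obtain ⟨x₁, h1⟩ := h.a_lip ε hε0
  obtain ⟨x₂, h2⟩ := eventually_atTop.1 (h.le_ratio (s := 1) (c := 2)
    (by have := Real.exp_one_gt_d9; linarith))
  obtain ⟨x₃, h3⟩ := eventually_atTop.1 h.a_pos
  have hd : 0 < ε * (1 - c) := mul_pos hε0 (by linarith)
  refine ⟨2 / (ε * (1 - c)) ^ p, by positivity, ?_⟩
  filter_upwards [eventually_ge_atTop (max (max x₁ x₂) (max x₃ 1) / c), h.a_pos,
    eventually_ge_atTop x₁, eventually_ge_atTop 1] with y hy hA hyx hy1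
  rw [div_le_iff₀ hc0] at hy
  set A := a y with hAdef
  -- From `y - D` move down by `a (y - D)`, which doubles `H` since `2 < e`. The Lipschitz bound `a
  -- (y - D) ≤ A + ε * D` with `b = 1 + ε` keeps `ε * D ≤ A * (b ^ k - 1)`, and the walk downwards
  -- stays above `c * y` as long as this is at most `ε * (1 - c) * y`.
  have hstep : ∀ k : ℕ, A * (b ^ k - 1) ≤ ε * ((1 - c) * y) →
      ∃ D, 0 ≤ D ∧ ε * D ≤ A * (b ^ k - 1) ∧ 2 ^ k * H y ≤ H (y - D) := by
    intro k
    induction k with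
    | zero => intro _; exact ⟨0, le_rfl, by simp, by simp⟩
    | succ k ih =>
      intro hk
      have hbk : b ^ k ≤ b ^ (k + 1) := pow_le_pow_right₀ hb1.le (Nat.le_succ k)
      obtain ⟨D, hD0, hD1, hD2⟩ := ih (le_trans (by nlinarith) hk)
      have hDle : D ≤ (1 - c) * y := by
        have : ε * D ≤ ε * ((1 - c) * y) := hD1.trans (le_trans (by nlinarith) hk)
        exact le_of_mul_le_mul_left this hε0
      have hge : max (max x₁ x₂) (max x₃ 1) ≤ y - D := by nlinarith
      have g1 : x₁ ≤ y - D := ((le_max_left _ _).trans (le_max_left _ _)).trans hge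
      have g2 : x₂ ≤ y - D := ((le_max_right _ _).trans (le_max_left _ _)).trans hge
      have g3 : x₃ ≤ y - D := ((le_max_left _ _).trans (le_max_right _ _)).trans hge
      have l1 := (abs_le.1 (h1 (y - D) y g1 hyx)).2
      have e1 : |y - D - y| = D := by
        rw [show y - D - y = -D by ring, abs_neg, abs_of_nonneg hD0]
      rw [e1] at l1
      have l2 := h2 _ g2
      rw [one_mul] at l2
      refine ⟨D + a (y - D), by have := h3 _ g3; linarith, ?_, ?_⟩
      · have hb' : b ^ (k + 1) = b ^ k * (1 + ε) := by rw [pow_succ, hε]; ring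
        rw [hb']
        have m1 : (1 + ε) * (ε * D) ≤ (1 + ε) * (A * (b ^ k - 1)) :=
          mul_le_mul_of_nonneg_left hD1 (by linarith)
        have m2 : ε * a (y - D) ≤ ε * (A + ε * D) :=
          mul_le_mul_of_nonneg_left (by linarith) hε0.le
        nlinarith
      · rw [show y - (D + a (y - D)) = y - D - a (y - D) by ring, pow_succ]
        nlinarith
  set ρ := 1 + ε * (1 - c) * y / A with hρ
  have hρ1 : 1 ≤ ρ := by
    have : 0 ≤ ε * (1 - c) * y / A := by positivity
    linarith
  -- The largest admissible number of steps: `b ^ k ≤ ρ < b ^ (k + 1)`. The upper inequality bounds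
  -- the gain from below, up to a factor two.
  obtain ⟨k, hk1, hk2⟩ := exists_nat_pow_near hρ1 hb1
  obtain ⟨D, hD0, hD1, hD2⟩ := hstep k (by
    have : A * (ρ - 1) = ε * ((1 - c) * y) := by rw [hρ]; field_simp; ring
    nlinarith)
  have hDle : D ≤ (1 - c) * y := by
    have : A * (ρ - 1) = ε * ((1 - c) * y) := by rw [hρ]; field_simp; ring
    have : ε * D ≤ ε * ((1 - c) * y) := by nlinarith
    exact le_of_mul_le_mul_left this hε0
  have h5 : H (y - D) ≤ H (c * y) := h.anti (by linarith)
  have h6 : (ε * (1 - c) * y / A) ^ p ≤ 2 ^ k * 2 := by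
    have : (2 : ℝ) ^ k * 2 = (b ^ (k + 1)) ^ p := by
      rw [← pow_mul, mul_comm (k + 1) p, pow_mul, hbp, pow_succ]
    rw [this]
    exact pow_le_pow_left₀ (by positivity) (by linarith) p
  have h7 : (ε * (1 - c) * y / A) ^ p * H y ≤ 2 * H (c * y) := by
    calc _ ≤ (2 ^ k * 2) * H y := mul_le_mul_of_nonneg_right h6 (h.pos y).le
      _ = 2 * (2 ^ k * H y) := by ring
      _ ≤ _ := by linarith
  have h8 : H y = (A / y) ^ p / (ε * (1 - c)) ^ p * ((ε * (1 - c) * y / A) ^ p * H y) := by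
    have : y ≠ 0 := by positivity
    have : 1 - c ≠ 0 := by linarith
    simp only [div_pow, mul_pow]
    field_simp
  rw [h8]
  calc _ ≤ (A / y) ^ p / (ε * (1 - c)) ^ p * (2 * H (c * y)) :=
        mul_le_mul_of_nonneg_left h7 (by positivity)
    _ = _ := by ring

/-- Rapid variation: the power bound with exponent one, combined with `a y = o(y)`. -/
lemma rapid (h : HeavyTail H a) {c ε : ℝ} (hc0 : 0 < c) (hc1 : c < 1) (hε : 0 < ε) :
    ∀ᶠ y in atTop, H y ≤ ε * H (c * y) := by
  obtain ⟨C, hC, h1⟩ := h.le_pow_mul hc0 hc1 one_ne_zero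
  filter_upwards [h1, h.a_small (ε := ε / C) (by positivity), eventually_gt_atTop 0]
    with y hy hy2 hy3
  refine hy.trans (mul_le_mul_of_nonneg_right ?_ (h.pos _).le)
  rw [pow_one]
  have h2 : a y / y ≤ ε / C := by rwa [div_le_iff₀ hy3]
  calc C * (a y / y) ≤ C * (ε / C) := mul_le_mul_of_nonneg_left h2 hC.le
    _ = ε := by field_simp

/-- A Potter bound of every order, from iterating rapid variation along powers of two; the factor `2
^ p` pays for rounding `t` down to such a power. -/
lemma potter (h : HeavyTail H a) (p : ℕ) : ∃ r₀ : ℝ, 1 ≤ r₀ ∧ ∀ r, r₀ ≤ r → ∀ t, 1 ≤ t →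
    t ^ p * H (t * r) ≤ 2 ^ p * H r := by
  obtain ⟨r₀, h0⟩ := eventually_atTop.1
    (h.rapid (c := 1 / 2) (ε := 1 / 2 ^ p) (by norm_num) (by norm_num) (by positivity))
  refine ⟨max 1 r₀, le_max_left _ _, fun r hr t ht => ?_⟩
  have hr1 : 1 ≤ r := (le_max_left _ _).trans hr
  have hr2 : r₀ ≤ r := (le_max_right _ _).trans hr
  have step : ∀ j : ℕ, (2 ^ p) ^ j * H (2 ^ j * r) ≤ H r := by
    intro j
    induction j with
    | zero => simp
    | succ j ih =>
      have hj : (1 : ℝ) ≤ 2 ^ (j + 1) := one_le_pow₀ (by norm_num)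
      have := h0 (2 ^ (j + 1) * r) (by nlinarith)
      rw [show 1 / 2 * (2 ^ (j + 1) * r) = 2 ^ j * r by ring] at this
      refine le_trans ?_ ih
      calc (2 ^ p : ℝ) ^ (j + 1) * H (2 ^ (j + 1) * r)
          ≤ (2 ^ p) ^ (j + 1) * (1 / 2 ^ p * H (2 ^ j * r)) := by gcongr
        _ = _ := by rw [pow_succ]; field_simp
  obtain ⟨j, hj1, hj2⟩ := exists_nat_pow_near ht (by norm_num : (1 : ℝ) < 2)
  calc t ^ p * H (t * r) ≤ (2 ^ (j + 1)) ^ p * H (2 ^ j * r) := by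
        gcongr
        · exact (h.pos _).le
        · exact h.anti (by nlinarith)
    _ = 2 ^ p * ((2 ^ p) ^ j * H (2 ^ j * r)) := by
        rw [pow_succ, mul_pow, ← pow_mul, ← pow_mul, mul_comm j p]; ring
    _ ≤ _ := by gcongr; exact step j

lemma poly (h : HeavyTail H a) (p : ℕ) : ∃ C : ℝ, 0 < C ∧ ∀ r, 0 < r → r ^ p * H r ≤ C := by
  obtain ⟨r₀, hr0, h0⟩ := h.potter p
  refine ⟨2 ^ p * r₀ ^ p, by positivity, fun r hr => ?_⟩
  rcases le_total r r₀ with hle | hle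
  · calc r ^ p * H r ≤ r₀ ^ p * 1 := by
          gcongr
          · exact (h.pos r).le
          · exact h.le_one r
      _ ≤ _ := by
          have : (1 : ℝ) ≤ 2 ^ p := one_le_pow₀ (by norm_num)
          have : 0 ≤ r₀ ^ p := by positivity
          nlinarith
  · have := h0 r₀ le_rfl (r / r₀) ((one_le_div (by linarith)).2 hle)
    rw [div_mul_cancel₀ _ (by linarith : r₀ ≠ 0), div_pow, div_mul_eq_mul_div,
      div_le_iff₀ (by positivity)] at this
    refine this.trans ?_
    have h1 := h.le_one r₀
    have : (0 : ℝ) < 2 ^ p * r₀ ^ p := by positivity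
    nlinarith

lemma poly_tendsto (h : HeavyTail H a) (p : ℕ) :
    Tendsto (fun r => r ^ p * H r) atTop (𝓝 0) := by
  obtain ⟨C, hC, h1⟩ := h.poly (p + 1)
  have h2 : Tendsto (fun r : ℝ => C / r) atTop (𝓝 0) := tendsto_const_nhds.div_atTop tendsto_id
  refine squeeze_zero' ?_ ?_ h2
  · filter_upwards [eventually_gt_atTop 0] with r hr
    exact mul_nonneg (by positivity) (h.pos r).le
  · filter_upwards [eventually_gt_atTop 0] with r hr
    rw [le_div_iff₀ hr]
    have := h1 r hr
    rw [pow_succ] at this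
    linarith

/-- If the tail only drops polynomially between `c * y` and `y`, then the auxiliary function is
at least `y ^ (3/4)`. -/
lemma a_large (h : HeavyTail H a) {c : ℝ} (hc0 : 0 < c) (hc1 : c < 1) (C₀ : ℝ) (M : ℕ) :
    ∀ᶠ y in atTop, H (c * y) ≤ C₀ * y ^ M * H y → y ^ 3 ≤ a y ^ 4 := by
  -- If `a y ^ 4 < y ^ 3`, this exponent gives `(a y / y) ^ (4 * (M + 1)) ≤ y ^ (-(M + 1))`, one
  -- power more than the comparison hypothesis can absorb.
  obtain ⟨C, hC, h1⟩ := h.le_pow_mul hc0 hc1 (p := 4 * (M + 1)) (by positivity)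
  filter_upwards [h1, h.a_pos, eventually_gt_atTop (max 1 (C * |C₀|))] with y hy ha hy1 hle
  by_contra! hcon
  have hy0 : 0 < y := by linarith [le_max_left 1 (C * |C₀|)]
  have hlt : (a y / y) ^ (4 * (M + 1)) ≤ (1 / y) ^ (M + 1) := by
    rw [pow_mul]
    refine pow_le_pow_left₀ (by positivity) ?_ _
    rw [div_pow, div_le_div_iff₀ (by positivity) hy0]
    nlinarith
  have hHc := h.pos (c * y)
  have hHy := h.pos y
  have hC0 : 0 < C₀ := by
    by_contra! hn
    have : C₀ * y ^ M * H y ≤ 0 := by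
      have : 0 ≤ y ^ M * H y := by positivity
      nlinarith
    linarith
  rw [abs_of_pos hC0] at hy1
  have h2 : H y ≤ C * (1 / y) ^ (M + 1) * (C₀ * y ^ M * H y) := by
    refine hy.trans ?_
    gcongr
  have h3 : C * (1 / y) ^ (M + 1) * (C₀ * y ^ M * H y) = C * C₀ / y * H y := by
    rw [one_div, inv_pow, pow_succ]
    field_simp
  rw [h3] at h2
  have h4 : C * C₀ / y < 1 := by
    rw [div_lt_one hy0]; exact (le_max_right _ _).trans_lt hy1
  nlinarith

end HeavyTail

/-! ### Domination of product measures. -/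

section Product

variable {ρ₁ ρ₂ ρ : Measure ℝ} [IsProbabilityMeasure ρ₁] [IsProbabilityMeasure ρ₂]
  [IsProbabilityMeasure ρ]

lemma prod_real_le_right {E : Set (ℝ × ℝ)} (hE : MeasurableSet E) {c : ℝ} (hc : 0 ≤ c)
    (h : ∀ u, ρ₂.real {v | (u, v) ∈ E} ≤ c * ρ.real {v | (u, v) ∈ E}) :
    (ρ₁.prod ρ₂).real E ≤ c * (ρ₁.prod ρ).real E := by
  have key : (ρ₁.prod ρ₂) E ≤ ENNReal.ofReal c * (ρ₁.prod ρ) E := by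
    rw [Measure.prod_apply hE, Measure.prod_apply hE,
      ← lintegral_const_mul _ (measurable_measure_prodMk_left hE)]
    refine lintegral_mono fun u => ?_
    have := h u
    rw [← ENNReal.ofReal_le_ofReal_iff (by positivity), ENNReal.ofReal_mul hc,
      ofReal_measureReal, ofReal_measureReal] at this
    exact this
  have := ENNReal.toReal_mono (by finiteness) key
  rwa [ENNReal.toReal_mul, ENNReal.toReal_ofReal hc] at this

lemma prod_real_le_left {E : Set (ℝ × ℝ)} (hE : MeasurableSet E) {c : ℝ} (hc : 0 ≤ c)
    (h : ∀ v, ρ₁.real {u | (u, v) ∈ E} ≤ c * ρ.real {u | (u, v) ∈ E}) :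
    (ρ₁.prod ρ₂).real E ≤ c * (ρ.prod ρ₂).real E := by
  have key : (ρ₁.prod ρ₂) E ≤ ENNReal.ofReal c * (ρ.prod ρ₂) E := by
    rw [Measure.prod_apply_symm hE, Measure.prod_apply_symm hE,
      ← lintegral_const_mul _ (measurable_measure_prodMk_right hE)]
    refine lintegral_mono fun u => ?_
    have := h u
    rw [← ENNReal.ofReal_le_ofReal_iff (by positivity), ENNReal.ofReal_mul hc,
      ofReal_measureReal, ofReal_measureReal] at this
    exact this
  have := ENNReal.toReal_mono (by finiteness) key
  rwa [ENNReal.toReal_mul, ENNReal.toReal_ofReal hc] at this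

/-- Fubini, replacing one factor at a time. It transfers estimates from a subexponential law to
arbitrary laws with dominated tails, provided the sections of `E` are half-lines or empty. -/
lemma prod_real_le {E : Set (ℝ × ℝ)} (hE : MeasurableSet E) {c d : ℝ} (hc : 0 ≤ c) (hd : 0 ≤ d)
    (h₁ : ∀ v, ρ₁.real {u | (u, v) ∈ E} ≤ c * ρ.real {u | (u, v) ∈ E})
    (h₂ : ∀ u, ρ₂.real {v | (u, v) ∈ E} ≤ d * ρ.real {v | (u, v) ∈ E}) :
    (ρ₁.prod ρ₂).real E ≤ c * d * (ρ.prod ρ).real E := by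
  calc _ ≤ c * (ρ.prod ρ₂).real E := prod_real_le_left hE hc h₁
    _ ≤ c * (d * (ρ.prod ρ).real E) :=
        mul_le_mul_of_nonneg_left (prod_real_le_right hE hd h₂) hc
    _ = _ := by ring

end Product

/-! ### One-sided subexponential laws. -/

section Subexp

variable {ρ : Measure ℝ}

/-- A vanishing tail would make the quotient in the definition zero, by the convention for division
by zero, and contradict the limit one. -/
lemma IsSubexpPos.rightTail_pos (h : IsSubexpPos ρ) (x : ℝ) : 0 < rightTail ρ x := by
  have := h.1
  have h1 := (h.2.2 2 le_rfl).eventually_const_lt (u := 1 / 2) (by norm_num)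
  obtain ⟨y, hy, hxy⟩ := (h1.and (eventually_ge_atTop x)).exists
  have h2 : 0 < rightTail ρ y := by
    rcases (measureReal_nonneg : 0 ≤ ρ.real (Set.Ioi y)).eq_or_lt with h0 | h0
    · simp only [rightTail, ← h0] at hy
      norm_num at hy
    · exact h0
  exact h2.trans_le (measureReal_mono (Set.Ioi_subset_Ioi hxy))

lemma tendsto_rightTail_zero [IsProbabilityMeasure ρ] : Tendsto (rightTail ρ) atTop (𝓝 0) := by
  have h1 : Tendsto (fun x => 1 - cdf ρ x) atTop (𝓝 (1 - 1)) :=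
    (tendsto_cdf_atTop ρ).const_sub 1
  rw [sub_self] at h1
  refine h1.congr fun x => ?_
  rw [cdf_eq_real, rightTail, ← Set.compl_Iic, probReal_compl_eq_one_sub measurableSet_Iic]

lemma IsSubexpPos.real_Ici_zero (h : IsSubexpPos ρ) : ρ.real (Set.Ici 0) = 1 := by
  have := h.1
  rw [← Set.compl_Iio, probReal_compl_eq_one_sub measurableSet_Iio, measureReal_def, h.2.1]
  simp

lemma pi_two_real (ρ : Measure ℝ) [IsProbabilityMeasure ρ] (x : ℝ) :
    (Measure.pi (fun _ : Fin 2 => ρ)).real {z | x < ∑ i, z i} =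
      (ρ.prod ρ).real {z | x < z.1 + z.2} := by
  have h := (measurePreserving_piFinTwo (fun _ : Fin 2 => ρ)).measure_preimage_equiv
    {z : ℝ × ℝ | x < z.1 + z.2}
  rw [measureReal_def, measureReal_def, ← h]
  congr 2
  ext z
  simp [Fin.sum_univ_two]

/-- The event that the sum of two variables exceeds `x`, but none of them does. -/
def noBigJump (x : ℝ) : Set (ℝ × ℝ) := {z | z.1 ≤ x ∧ z.2 ≤ x ∧ x < z.1 + z.2}

/-- For nonnegative variables the sum exceeds `x` as soon as one of them does, which has probability
`2 F - F ^ 2` for the tail `F`; the event without a big jump is disjoint from this. -/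
lemma IsSubexpPos.noBigJump_le (h : IsSubexpPos ρ) {x : ℝ} (hx : 0 ≤ x) :
    (ρ.prod ρ).real (noBigJump x) + 2 * rightTail ρ x - rightTail ρ x ^ 2 ≤
      (ρ.prod ρ).real {z | x < z.1 + z.2} := by
  have := h.1
  have hA : (ρ.prod ρ).real (Set.Ioi x ×ˢ Set.Ici 0) = rightTail ρ x := by
    rw [measureReal_prod_prod, h.real_Ici_zero, mul_one, rightTail]
  have hIcc : ρ.real (Set.Icc 0 x) = 1 - rightTail ρ x := by
    have h1 : Set.Icc 0 x = Set.Ici 0 \ Set.Ioi x := by ext; simp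
    have h2 : Set.Ioi x ⊆ Set.Ici 0 := fun z hz => hx.trans (le_of_lt hz)
    rw [h1, measureReal_sdiff h2 measurableSet_Ioi,
      h.real_Ici_zero, rightTail]
  have hB : (ρ.prod ρ).real (Set.Icc 0 x ×ˢ Set.Ioi x) = (1 - rightTail ρ x) * rightTail ρ x := by
    rw [measureReal_prod_prod, hIcc, rightTail]
  have hd1 : Disjoint (Set.Ioi x ×ˢ Set.Ici (0 : ℝ)) (Set.Icc 0 x ×ˢ Set.Ioi x) := by
    rw [Set.disjoint_left]
    rintro z ⟨h1, -⟩ ⟨h2, -⟩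
    exact absurd h2.2 (not_le.2 h1)
  have hd2 : Disjoint (noBigJump x)
      ((Set.Ioi x ×ˢ Set.Ici (0 : ℝ)) ∪ (Set.Icc 0 x ×ˢ Set.Ioi x)) := by
    rw [Set.disjoint_left]
    rintro z ⟨h1, h2, -⟩ (⟨h3, -⟩ | ⟨-, h3⟩)
    · exact absurd h1 (not_le.2 h3)
    · exact absurd h2 (not_le.2 h3)
  have hm : MeasurableSet (Set.Icc (0 : ℝ) x ×ˢ Set.Ioi x) := measurableSet_Icc.prod measurableSet_Ioi
  have hm2 : MeasurableSet (Set.Ioi x ×ˢ Set.Ici (0 : ℝ)) := measurableSet_Ioi.prod measurableSet_Ici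
  have e : (ρ.prod ρ).real (noBigJump x) + 2 * rightTail ρ x - rightTail ρ x ^ 2 =
      (ρ.prod ρ).real (noBigJump x ∪ ((Set.Ioi x ×ˢ Set.Ici (0 : ℝ)) ∪ (Set.Icc 0 x ×ˢ Set.Ioi x))) := by
    rw [measureReal_union hd2 (hm2.union hm), measureReal_union hd1 hm, hA, hB]
    ring
  rw [e]
  refine measureReal_mono ?_
  rintro z (⟨-, -, h3⟩ | ⟨h1, h2⟩ | ⟨h1, h2⟩)
  · exact h3
  · simp only [Set.mem_Ioi, Set.mem_Ici, Set.mem_ofPred_eq] at *; linarith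
  · simp only [Set.mem_Ioi, Set.mem_Icc, Set.mem_ofPred_eq] at *; linarith

/-- The tail of the sum is asymptotically twice the tail, and the two big-jump events already
account for this. -/
lemma IsSubexpPos.noBigJump_isLittleO (h : IsSubexpPos ρ) {ε : ℝ} (hε : 0 < ε) :
    ∀ᶠ x in atTop, (ρ.prod ρ).real (noBigJump x) ≤ ε * rightTail ρ x := by
  have := h.1
  have h1 := (h.2.2 2 le_rfl).eventually_lt_const (u := 1 + ε / 4) (by linarith)
  have h2 := (tendsto_rightTail_zero (ρ := ρ)).eventually_lt_const (u := ε / 2) (by linarith)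
  filter_upwards [h1, h2, eventually_ge_atTop 0] with x h1 h2 h3
  have h4 := h.noBigJump_le h3
  have h5 := h.rightTail_pos x
  rw [pi_two_real, div_lt_iff₀ (by push_cast; linarith)] at h1
  push_cast at h1
  nlinarith

lemma IsSubexpPos.prod_le (h : IsSubexpPos ρ) :
    ∃ C : ℝ, 0 < C ∧ ∀ x, (ρ.prod ρ).real {z | x < z.1 + z.2} ≤ C * rightTail ρ x := by
  have := h.1
  obtain ⟨x₀, h0⟩ := eventually_atTop.1
    ((h.2.2 2 le_rfl).eventually_lt_const (u := 2) (by norm_num))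
  have hp := h.rightTail_pos x₀
  refine ⟨max 4 (1 / rightTail ρ x₀), by positivity, fun x => ?_⟩
  have hpx := h.rightTail_pos x
  rcases le_total x₀ x with hx | hx
  · have h1 := h0 x hx
    rw [pi_two_real, div_lt_iff₀ (by push_cast; linarith)] at h1
    push_cast at h1
    have : 4 * rightTail ρ x ≤ max 4 (1 / rightTail ρ x₀) * rightTail ρ x := by
      gcongr
      exact le_max_left _ _
    linarith
  · calc (ρ.prod ρ).real {z | x < z.1 + z.2} ≤ 1 := measureReal_le_one
      _ = 1 / rightTail ρ x₀ * rightTail ρ x₀ := by field_simp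
      _ ≤ _ := by
        gcongr
        · exact le_max_right _ _
        · exact measureReal_mono (Set.Ioi_subset_Ioi hx)

/-- If one variable lies in `(x - K, x]` and the other in `(K, x]`, the sum exceeds `x` without a
big jump. By independence the increment of the tail over `(x - K, x]`, times a positive constant, is
therefore negligible with respect to the tail. -/
lemma IsSubexpPos.long_aux (h : IsSubexpPos ρ) {K : ℝ} (hK : 0 ≤ K) :
    Tendsto (fun x => rightTail ρ (x - K) / rightTail ρ x) atTop (𝓝 1) := by
  have := h.1
  have hc := h.rightTail_pos K
  refine tendsto_order.2 ⟨fun b hb => ?_, fun b hb => ?_⟩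
  · refine Eventually.of_forall fun x => hb.trans_le ?_
    rw [one_le_div (h.rightTail_pos x)]
    exact measureReal_mono (Set.Ioi_subset_Ioi (by linarith))
  · have h1 := h.noBigJump_isLittleO (ε := (b - 1) * rightTail ρ K / 4)
      (by have : 0 < b - 1 := by linarith
          positivity)
    have h2 := (tendsto_rightTail_zero (ρ := ρ)).eventually_lt_const
      (u := rightTail ρ K / 2) (by linarith)
    filter_upwards [h1, h2, eventually_ge_atTop K] with x h1 h2 h3
    have hpx := h.rightTail_pos x
    rw [div_lt_iff₀ hpx]
    have e : ∀ u v : ℝ, u ≤ v → ρ.real (Set.Ioc u v) = rightTail ρ u - rightTail ρ v := by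
      intro u v huv
      rw [show Set.Ioc u v = Set.Ioi u \ Set.Ioi v by ext; simp,
        measureReal_sdiff (Set.Ioi_subset_Ioi huv) measurableSet_Ioi, rightTail, rightTail]
    have h4 : (ρ.prod ρ).real (Set.Ioc (x - K) x ×ˢ Set.Ioc K x) ≤ (ρ.prod ρ).real (noBigJump x) := by
      refine measureReal_mono ?_
      rintro z ⟨⟨h5, h6⟩, h7, h8⟩
      exact ⟨h6, h8, by linarith⟩
    rw [measureReal_prod_prod, e _ _ (by linarith), e _ _ h3] at h4
    have h5 : rightTail ρ x ≤ rightTail ρ (x - K) :=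
      measureReal_mono (Set.Ioi_subset_Ioi (by linarith))
    have h6 : (rightTail ρ (x - K) - rightTail ρ x) * (rightTail ρ K / 2) ≤
        (b - 1) * rightTail ρ K / 4 * rightTail ρ x := by
      refine le_trans ?_ (h4.trans h1)
      exact mul_le_mul_of_nonneg_left (by linarith) (by linarith)
    have h7 : (rightTail ρ (x - K) - rightTail ρ x) ≤ (b - 1) / 2 * rightTail ρ x := by
      refine le_of_mul_le_mul_right (h6.trans_eq ?_) (by positivity : 0 < rightTail ρ K / 2)
      ring
    nlinarith

lemma IsSubexpPos.long (h : IsSubexpPos ρ) (K : ℝ) :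
    Tendsto (fun x => rightTail ρ (x - K) / rightTail ρ x) atTop (𝓝 1) := by
  rcases le_total 0 K with hK | hK
  · exact h.long_aux hK
  · have h1 := ((h.long_aux (K := -K) (by linarith)).comp
      (tendsto_atTop_add_const_right atTop (-K) tendsto_id)).inv₀ one_ne_zero
    rw [inv_one] at h1
    refine h1.congr fun x => ?_
    simp [sub_eq_add_neg]

end Subexp

/-! ### From a two-sided law to the tail of its absolute value. -/

section TwoSided

variable {ν : Measure ℝ} {p q : ℝ}

lemma rightTail_map_max {x : ℝ} (hx : 0 ≤ x) :
    rightTail (ν.map (fun z => max z 0)) x = rightTail ν x := by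
  rw [rightTail, rightTail, map_measureReal_apply (by fun_prop) measurableSet_Ioi]
  congr 1
  ext z
  simp [hx.not_gt]

lemma absTail_one (x : ℝ) : absTail ν 1 x = ν.real {z | x < |z|} := by
  simp [absTail]

lemma IsAuxiliary.lip {a : ℝ → ℝ} (h : IsAuxiliary ν a) (ε : ℝ) (hε : 0 < ε) :
    ∃ x₁ : ℝ, ∀ x y, x₁ ≤ x → x₁ ≤ y → |a x - a y| ≤ ε * |x - y| := by
  obtain ⟨⟨x₀, a', h1, h2⟩, -⟩ := h
  obtain ⟨x₂, h3⟩ := eventually_atTop.1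
    ((tendsto_order.1 (h2.abs)).2 ε (by simpa using hε))
  refine ⟨max x₀ x₂, fun x y hx hy => ?_⟩
  obtain ⟨-, ix, ex⟩ := h1 x ((le_max_left _ _).trans hx)
  obtain ⟨-, iy, ey⟩ := h1 y ((le_max_left _ _).trans hy)
  have e : a x - a y = ∫ u in y..x, a' u := by
    rw [ex, ey, ← intervalIntegral.integral_interval_sub_left ix iy]
    ring
  rw [e, ← Real.norm_eq_abs]
  refine intervalIntegral.norm_integral_le_of_norm_le_const fun u hu => ?_
  have : x₂ ≤ u := by
    have h5 : min y x < u := hu.1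
    exact (le_max_right _ _).trans ((le_min hy hx).trans h5.le)
  exact (h3 u this).le

lemma IsSubexp.tendsto_right (h : IsSubexp ν p q) :
    Tendsto (fun x => rightTail ν x / absTail ν 1 x) atTop (𝓝 p) := by
  refine h.right_balance.congr fun x => ?_
  rw [absTail_one]
  rfl

variable [IsProbabilityMeasure ν]

lemma absTail_anti : Antitone (absTail ν 1) := fun x y hxy =>
  measureReal_mono fun z (hz : y < _) => hxy.trans_lt hz

lemma rightTail_le_absTail (x : ℝ) : rightTail ν x ≤ absTail ν 1 x := by
  rw [absTail_one]
  exact measureReal_mono fun z (hz : x < z) => hz.trans_le (le_abs_self z)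

lemma IsSubexp.absTail_pos (h : IsSubexp ν p q) (x : ℝ) : 0 < absTail ν 1 x := by
  have h1 := h.pos_part.rightTail_pos (max x 0)
  rw [rightTail_map_max (le_max_right _ _)] at h1
  exact (h1.trans_le (rightTail_le_absTail _)).trans_le (absTail_anti (le_max_left _ _))

lemma tendsto_absTail_zero : Tendsto (absTail ν 1) atTop (𝓝 0) := by
  have hm : Measurable fun z : ℝ => |z| := by fun_prop
  have := Measure.isProbabilityMeasure_map (μ := ν) hm.aemeasurable
  have h1 := tendsto_rightTail_zero (ρ := ν.map (fun z => |z|))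
  refine h1.congr fun x => ?_
  rw [absTail_one, rightTail, map_measureReal_apply hm measurableSet_Ioi]
  rfl

lemma IsSubexp.absTail_le (h : IsSubexp ν p q) : ∃ C : ℝ, 0 < C ∧
    ∀ x, absTail ν 1 x ≤ C * rightTail (ν.map (fun z => max z 0)) x := by
  have := h.p_pos
  obtain ⟨x₀, h0⟩ := eventually_atTop.1
    ((h.tendsto_right).eventually_const_lt (u := p / 2) (by linarith))
  set y := max x₀ 0
  have hy := h.pos_part.rightTail_pos y
  have := h.pos_part.1
  refine ⟨max (2 / p) (1 / rightTail (ν.map (fun z => max z 0)) y), by positivity, fun x => ?_⟩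
  have hpx := h.pos_part.rightTail_pos x
  rcases le_total y x with hx | hx
  · have h1 := h0 x ((le_max_left _ _).trans hx)
    rw [lt_div_iff₀ (h.absTail_pos x)] at h1
    rw [rightTail_map_max ((le_max_right _ _).trans hx)] at hpx ⊢
    calc absTail ν 1 x = 2 / p * (p / 2 * absTail ν 1 x) := by field_simp
      _ ≤ 2 / p * rightTail ν x := by gcongr
      _ ≤ _ := by gcongr; exact le_max_left _ _
  · calc absTail ν 1 x ≤ 1 := measureReal_le_one
      _ = 1 / rightTail (ν.map (fun z => max z 0)) y * rightTail (ν.map (fun z => max z 0)) y := by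
        field_simp
      _ ≤ _ := by
        gcongr
        · exact le_max_right _ _
        · exact measureReal_mono (Set.Ioi_subset_Ioi hx)

/-- Limits of ratios of the right tail carry over to the tail of the absolute value. -/
lemma IsSubexp.tendsto_absTail_ratio (h : IsSubexp ν p q) {f : ℝ → ℝ} (hf : Tendsto f atTop atTop)
    {c : ℝ} (hc : Tendsto (fun x => rightTail ν (f x) / rightTail ν x) atTop (𝓝 c)) :
    Tendsto (fun x => absTail ν 1 (f x) / absTail ν 1 x) atTop (𝓝 c) := by
  have hp := h.p_pos.ne'
  have h1 := ((h.tendsto_right.comp hf).inv₀ hp).mul (hc.mul h.tendsto_right)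
  rw [show p⁻¹ * (c * p) = c by field_simp] at h1
  refine h1.congr' ?_
  have hpos : ∀ᶠ x in atTop, rightTail ν x ≠ 0 := by
    filter_upwards [eventually_ge_atTop 0] with x hx
    rw [← rightTail_map_max hx]
    exact (h.pos_part.rightTail_pos x).ne'
  filter_upwards [hpos, hf.eventually hpos] with x h2 h3
  have h4 := (h.absTail_pos x).ne'
  have h5 := (h.absTail_pos (f x)).ne'
  simp only [Function.comp]
  field_simp

/-- The tail of the absolute value of a law in `S ∩ MDA(Gumbel)`. -/
theorem IsSubexp.heavyTail (h : IsSubexp ν p q) {a : ℝ → ℝ} (ha : IsAuxiliary ν a) :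
    HeavyTail (absTail ν 1) a := by
  have hρ := h.pos_part.1
  obtain ⟨C₀, hC0, hC⟩ := h.absTail_le
  set ρ := ν.map (fun z => max z 0) with hρdef
  have hpos := h.pos_part.rightTail_pos
  have apos : ∀ᶠ x in atTop, 0 < a x := by
    obtain ⟨⟨x₀, a', h1, h2⟩, -⟩ := ha
    filter_upwards [eventually_ge_atTop x₀] with x hx using (h1 x hx).1
  refine ⟨absTail_anti, h.absTail_pos, fun x => measureReal_le_one, tendsto_absTail_zero, apos,
    ha.lip, fun s => ?_, fun K => ?_, ?_, ?_⟩
  · refine h.tendsto_absTail_ratio ?_ (ha.2 s)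
    refine tendsto_atTop_mono' atTop ?_ (tendsto_id.atTop_div_const (by norm_num : (0 : ℝ) < 2))
    filter_upwards [eventually_le_mul_of_lip ha.lip (ε := 1 / (2 * (|s| + 1))) (by positivity),
      apos, eventually_gt_atTop 0] with x hx hx2 hx3
    have h1 : |s * a x| ≤ x / 2 := by
      rw [abs_mul, abs_of_pos hx2]
      calc |s| * a x ≤ (|s| + 1) * (1 / (2 * (|s| + 1)) * x) := by
            gcongr
            linarith
        _ = x / 2 := by field_simp
    have := (abs_le.1 h1).1
    simp only [id]
    linarith
  · refine h.tendsto_absTail_ratio (tendsto_atTop_add_const_right _ (-K) tendsto_id) ?_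
    refine (h.pos_part.long K).congr' ?_
    filter_upwards [eventually_ge_atTop 0, eventually_ge_atTop K] with x hx hxK
    rw [rightTail_map_max hx, rightTail_map_max (by linarith)]
    rfl
  · intro η hη hη1 ε hε
    have hη2 : 0 < 1 - η := by linarith
    set ε' := ε / (C₀ * C₀) / 3 with hε'
    have hε'0 : 0 < ε' := by positivity
    have t0 := tendsto_rightTail_zero (ρ := ρ)
    -- The three parts of the event estimated below each contribute `ε'`, and each of the two tail
    -- comparisons costs `C₀`; this fixes `ε'`.
    obtain ⟨K, hK1, hK0⟩ := ((t0.eventually_lt_const hε'0).and (eventually_gt_atTop 0)).exists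
    obtain ⟨x₀, hx0⟩ := eventually_atTop.1 ((h.pos_part.noBigJump_isLittleO hε'0).and
      (((t0.comp (tendsto_id.const_mul_atTop hη2)).eventually_lt_const hε'0).and
        (eventually_ge_atTop 0)))
    refine ⟨K, hK0, x₀, fun x hx ρ₁ ρ₂ _ _ A B hA hB h1 h2 => ?_⟩
    obtain ⟨hD, hF, hxp⟩ := hx0 x hx
    simp only [Function.comp, id] at hF
    -- Capping the second variable at `η * x`, rather than restricting to `z.2 ≤ η * x`, makes all
    -- sections half-lines or empty, so that tail domination applies. The first variable is still
    -- only needed above `(1 - η) * x`.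
    set E : Set (ℝ × ℝ) := {z | x < z.1 + min z.2 (η * x) ∧ K < z.2} with hEdef
    have hmeas : Measurable fun z : ℝ × ℝ => z.1 + min z.2 (η * x) := by fun_prop
    have hE : MeasurableSet E :=
      (measurableSet_lt measurable_const hmeas).inter
        (measurableSet_lt measurable_const measurable_snd)
    have s1 : (ρ₁.prod ρ₂).real {z | x < z.1 + z.2 ∧ K < z.2 ∧ z.2 ≤ η * x} ≤
        (ρ₁.prod ρ₂).real E := by
      refine measureReal_mono ?_
      rintro z ⟨h3, h4, h5⟩
      exact ⟨by rwa [min_eq_left h5], h4⟩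
    have s2 : (ρ₁.prod ρ₂).real E ≤ (B * C₀) * (A * C₀) * (ρ.prod ρ).real E := by
      refine prod_real_le hE (by positivity) (by positivity) (fun v => ?_) (fun u => ?_)
      · by_cases hv : K < v
        · have : {u | (u, v) ∈ E} = Set.Ioi (x - min v (η * x)) := by
            ext u
            simp [hEdef, hv, sub_lt_iff_lt_add]
          rw [this]
          refine (h1 _ ?_).trans ?_
          · have := min_le_right v (η * x)
            linarith
          · rw [mul_assoc]
            exact mul_le_mul_of_nonneg_left (hC _) hB
        · have : {u | (u, v) ∈ E} = ∅ := by
            ext u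
            simp [hEdef, hv]
          simp [this]
      · by_cases hu : x - u < η * x
        · have : {v | (u, v) ∈ E} = Set.Ioi (max (x - u) K) := by
            ext v
            have : x < u + η * x := by linarith
            simp [hEdef, ← sub_lt_iff_lt_add', hu]
          rw [this]
          refine (h2 _).trans ?_
          rw [mul_assoc]
          exact mul_le_mul_of_nonneg_left (hC _) hA
        · have : {v | (u, v) ∈ E} = ∅ := by
            ext v
            simp [hEdef, ← sub_lt_iff_lt_add', hu]
          simp [this]
    have s3 : (ρ.prod ρ).real E ≤ 3 * ε' * rightTail ρ x := by
      -- Either the first variable exceeds `x` and the second exceeds `K`, or neither exceeds `x`,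
      -- or the second exceeds `x` while the cap forces the first above `(1 - η) * x`.
      have hsub : E ⊆ (Set.Ioi x ×ˢ Set.Ioi K) ∪ (noBigJump x ∪
          (Set.Ioi ((1 - η) * x) ×ˢ Set.Ioi x)) := by
        rintro z ⟨h3, h4⟩
        by_cases h5 : x < z.1
        · exact Or.inl ⟨h5, h4⟩
        · by_cases h6 : x < z.2
          · refine Or.inr (Or.inr ⟨?_, h6⟩)
            have := min_le_right z.2 (η * x)
            simp only [Set.mem_Ioi]
            linarith
          · refine Or.inr (Or.inl ⟨not_lt.1 h5, not_lt.1 h6, ?_⟩)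
            have := min_le_left z.2 (η * x)
            linarith
      calc (ρ.prod ρ).real E ≤ _ := measureReal_mono hsub
        _ ≤ _ := (measureReal_union_le _ _).trans (add_le_add_right (measureReal_union_le _ _) _)
        _ ≤ rightTail ρ x * ε' + (ε' * rightTail ρ x + ε' * rightTail ρ x) := by
          rw [measureReal_prod_prod, measureReal_prod_prod]
          have hp := (hpos x).le
          refine add_le_add (mul_le_mul le_rfl hK1.le measureReal_nonneg hp)
            (add_le_add hD (mul_le_mul hF.le le_rfl measureReal_nonneg hε'0.le))
        _ = _ := by ring
    calc _ ≤ (B * C₀) * (A * C₀) * (3 * ε' * rightTail ρ x) :=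
          s1.trans (s2.trans (mul_le_mul_of_nonneg_left s3 (by positivity)))
      _ = A * B * ε * rightTail ρ x := by rw [hε']; field_simp
      _ ≤ _ := by
          refine mul_le_mul_of_nonneg_left ?_ (by positivity)
          rw [rightTail_map_max hxp]
          exact rightTail_le_absTail x
  · obtain ⟨C, hCp, hC2⟩ := h.pos_part.prod_le
    have hle : ∀ x, rightTail ρ x ≤ absTail ν 1 x := by
      intro x
      rcases le_or_gt 0 x with hx | hx
      · rw [rightTail_map_max hx]; exact rightTail_le_absTail x
      · have : absTail ν 1 x = 1 := by
          rw [absTail_one, show {z : ℝ | x < |z|} = Set.univ by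
            ext z; simpa using hx.trans_le (abs_nonneg z)]
          simp
        rw [this]
        exact measureReal_le_one
    refine ⟨C * (C₀ * C₀), by positivity, fun ρ₁ ρ₂ _ _ A B hA hB h1 h2 x => ?_⟩
    set E : Set (ℝ × ℝ) := {z | x < z.1 + z.2} with hEdef
    have hE : MeasurableSet E := measurableSet_lt measurable_const (by fun_prop)
    have s2 : (ρ₁.prod ρ₂).real E ≤ (B * C₀) * (A * C₀) * (ρ.prod ρ).real E := by
      refine prod_real_le hE (by positivity) (by positivity) (fun v => ?_) (fun u => ?_)
      · have : {u | (u, v) ∈ E} = Set.Ioi (x - v) := by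
          ext u
          simp [hEdef, sub_lt_iff_lt_add]
        rw [this, mul_assoc]
        exact (h1 _).trans (mul_le_mul_of_nonneg_left (hC _) hB)
      · have : {v | (u, v) ∈ E} = Set.Ioi (x - u) := by
          ext v
          simp [hEdef, sub_lt_iff_lt_add']
        rw [this, mul_assoc]
        exact (h2 _).trans (mul_le_mul_of_nonneg_left (hC _) hA)
    calc _ ≤ (B * C₀) * (A * C₀) * (C * rightTail ρ x) :=
          s2.trans (mul_le_mul_of_nonneg_left (hC2 x) (by positivity))
      _ = C * (C₀ * C₀) * A * B * rightTail ρ x := by ring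
      _ ≤ _ := mul_le_mul_of_nonneg_left (hle x) (by positivity)

end TwoSided

/-! ### Independent noise, exchangeability and the central limit theorem. -/

/-- An iid sequence of real random variables whose absolute values have tail `H`. -/
structure Noise {Ω : Type*} [MeasurableSpace Ω] (P : Measure Ω) (W : ℤ → Ω → ℝ) (H : ℝ → ℝ) :
    Prop where
  meas : ∀ k, Measurable (W k)
  indep : iIndepFun W P
  ident : ∀ i j, P.map (W i) = P.map (W j)
  tail : ∀ k x, P.real {ω | x < |W k ω|} = H x

/-- The σ-algebra generated by the variables `W i`, `i ∈ S`. -/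
abbrev sigmaOf {Ω : Type*} (W : ℤ → Ω → ℝ) (S : Set ℤ) : MeasurableSpace Ω :=
  ⨆ i ∈ S, MeasurableSpace.comap (W i) inferInstance

lemma measurable_sigmaOf {Ω : Type*} {W : ℤ → Ω → ℝ} {S : Set ℤ} {i : ℤ} (hi : i ∈ S) :
    Measurable[sigmaOf W S] (W i) := by
  have h1 : MeasurableSpace.comap (W i) inferInstance ≤ sigmaOf W S :=
    le_iSup₂_of_le (f := fun i (_ : i ∈ S) => MeasurableSpace.comap (W i) inferInstance) i hi le_rfl
  exact (comap_measurable (W i)).mono h1 le_rfl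

lemma measurable_sigmaOf_sum {Ω : Type*} {W : ℤ → Ω → ℝ} {S : Set ℤ} {s : Finset ℤ}
    (hs : ∀ i ∈ s, i ∈ S) {f : ℤ → ℝ → ℝ} (hf : ∀ i, Measurable (f i)) :
    Measurable[sigmaOf W S] (fun ω => ∑ i ∈ s, f i (W i ω)) :=
  Finset.measurable_fun_sum s fun i hi => (hf i).comp (measurable_sigmaOf (hs i hi))

section IndepPair

variable {Ω : Type*} [MeasurableSpace Ω] {P : Measure Ω} [IsProbabilityMeasure P]

lemma IndepFun.real_pair_eq {U V : Ω → ℝ} (hU : Measurable U) (hV : Measurable V)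
    (h : IndepFun U V P) {E : Set (ℝ × ℝ)} (hE : MeasurableSet E) :
    P.real {ω | (U ω, V ω) ∈ E} = ((P.map U).prod (P.map V)).real E := by
  rw [← (indepFun_iff_map_prod_eq_prod_map_map hU.aemeasurable hV.aemeasurable).1 h,
    map_measureReal_apply (hU.prodMk hV) hE]
  rfl

lemma IndepFun.real_inter {U V : Ω → ℝ} (h : IndepFun U V P) {s t : Set ℝ}
    (hs : MeasurableSet s) (ht : MeasurableSet t) :
    P.real {ω | U ω ∈ s ∧ V ω ∈ t} = P.real {ω | U ω ∈ s} * P.real {ω | V ω ∈ t} := by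
  rw [measureReal_def, measureReal_def, measureReal_def, ← ENNReal.toReal_mul]
  congr 1
  exact h.measure_inter_preimage_eq_mul s t hs ht

/-- The source of lower bounds: adding an independent variable that is rarely below `-K` costs a
shift by `K` and a factor close to one. -/
lemma IndepFun.mul_le_add {U V : Ω → ℝ} (h : IndepFun U V P) (u K : ℝ) :
    P.real {ω | u < U ω} * P.real {ω | -K ≤ V ω} ≤ P.real {ω | u - K < U ω + V ω} := by
  have e := IndepFun.real_inter h (s := Set.Ioi u) (t := Set.Ici (-K)) measurableSet_Ioi
    measurableSet_Ici
  simp only [Set.mem_Ioi, Set.mem_Ici] at e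
  rw [← e]
  refine measureReal_mono ?_
  rintro ω ⟨h1, h2⟩
  have h1' : u < U ω := h1
  have h2' : -K ≤ V ω := h2
  show u - K < U ω + V ω
  linarith

lemma HeavyTail.conv_rv {H a : ℝ → ℝ} (hT : HeavyTail H a) : ∃ C : ℝ, 0 < C ∧
    ∀ (U V : Ω → ℝ) (A B : ℝ), Measurable U → Measurable V → IndepFun U V P → 0 ≤ A → 0 ≤ B →
      (∀ u, P.real {ω | u < U ω} ≤ B * H u) → (∀ r, P.real {ω | r < V ω} ≤ A * H r) →
      ∀ x, P.real {ω | x < U ω + V ω} ≤ C * A * B * H x := by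
  obtain ⟨C, hC, h⟩ := hT.conv
  refine ⟨C, hC, fun U V A B hU hV hI hA hB h1 h2 x => ?_⟩
  have := Measure.isProbabilityMeasure_map (μ := P) hU.aemeasurable
  have := Measure.isProbabilityMeasure_map (μ := P) hV.aemeasurable
  have hm : Measurable fun z : ℝ × ℝ => z.1 + z.2 := by fun_prop
  have key := h (P.map U) (P.map V) A B hA hB
    (fun u => by rw [map_measureReal_apply hU measurableSet_Ioi]; exact h1 u)
    (fun u => by rw [map_measureReal_apply hV measurableSet_Ioi]; exact h2 u) x
  rw [← IndepFun.real_pair_eq hU hV hI (measurableSet_lt measurable_const hm)] at key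
  exact key

lemma HeavyTail.conv_trunc_rv {H a : ℝ → ℝ} (hT : HeavyTail H a) {η : ℝ} (hη : 0 < η)
    (hη1 : η < 1) {ε : ℝ} (hε : 0 < ε) : ∃ K : ℝ, 0 < K ∧ ∃ x₀ : ℝ, ∀ x, x₀ ≤ x →
    ∀ (U V : Ω → ℝ) (A B : ℝ), Measurable U → Measurable V → IndepFun U V P → 0 ≤ A → 0 ≤ B →
      (∀ u, (1 - η) * x ≤ u → P.real {ω | u < U ω} ≤ B * H u) →
      (∀ r, P.real {ω | r < V ω} ≤ A * H r) →
      P.real {ω | x < U ω + V ω ∧ K < V ω ∧ V ω ≤ η * x} ≤ A * B * ε * H x := by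
  obtain ⟨K, hK, x₀, h⟩ := hT.conv_trunc η hη hη1 ε hε
  refine ⟨K, hK, x₀, fun x hx U V A B hU hV hI hA hB h1 h2 => ?_⟩
  have := Measure.isProbabilityMeasure_map (μ := P) hU.aemeasurable
  have := Measure.isProbabilityMeasure_map (μ := P) hV.aemeasurable
  have hm : Measurable fun z : ℝ × ℝ => z.1 + z.2 := by fun_prop
  have key := h x hx (P.map U) (P.map V) A B hA hB
    (fun u hu => by rw [map_measureReal_apply hU measurableSet_Ioi]; exact h1 u hu)
    (fun u => by rw [map_measureReal_apply hV measurableSet_Ioi]; exact h2 u)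
  have hE : MeasurableSet {z : ℝ × ℝ | x < z.1 + z.2 ∧ K < z.2 ∧ z.2 ≤ η * x} :=
    (measurableSet_lt measurable_const hm).inter
      ((measurableSet_lt measurable_const measurable_snd).inter
        (measurableSet_le measurable_snd measurable_const))
  rw [← IndepFun.real_pair_eq hU hV hI hE] at key
  exact key

end IndepPair

namespace Noise

variable {Ω : Type*} [MeasurableSpace Ω] {P : Measure Ω} [IsProbabilityMeasure P]
  {W : ℤ → Ω → ℝ} {H : ℝ → ℝ}

lemma indep_sigmaOf (hW : Noise P W H) {S T : Set ℤ} (hST : Disjoint S T) :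
    Indep (sigmaOf W S) (sigmaOf W T) P :=
  indep_iSup_of_disjoint (fun i => (hW.meas i).comap_le) hW.indep.iIndep hST

lemma indepFun (hW : Noise P W H) {S T : Set ℤ} (hST : Disjoint S T) {U V : Ω → ℝ}
    (hU : Measurable[sigmaOf W S] U) (hV : Measurable[sigmaOf W T] V) : IndepFun U V P := by
  rw [IndepFun_iff_Indep]
  exact indep_of_indep_of_le_left (indep_of_indep_of_le_right (hW.indep_sigmaOf hST) hV.comap_le)
    hU.comap_le

lemma real_inter (hW : Noise P W H) {S T : Set ℤ} (hST : Disjoint S T) {E F : Set Ω}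
    (hE : MeasurableSet[sigmaOf W S] E) (hF : MeasurableSet[sigmaOf W T] F) :
    P.real (E ∩ F) = P.real E * P.real F := by
  rw [measureReal_def, measureReal_def, measureReal_def, ← ENNReal.toReal_mul,
    (Indep_iff _ _ _).1 (hW.indep_sigmaOf hST) E F hE hF]

/-- The sums over disjoint index sets of functions of the noise are independent. -/
lemma indepFun_sum (hW : Noise P W H) {s t : Finset ℤ} (hst : Disjoint s t)
    {f g : ℤ → ℝ → ℝ} (hf : ∀ i, Measurable (f i)) (hg : ∀ i, Measurable (g i)) :
    IndepFun (fun ω => ∑ i ∈ s, f i (W i ω)) (fun ω => ∑ i ∈ t, g i (W i ω)) P :=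
  hW.indepFun (S := s) (T := t) (by exact_mod_cast hst)
    (measurable_sigmaOf_sum (fun _ h => h) hf) (measurable_sigmaOf_sum (fun _ h => h) hg)

/-- Injective reindexing does not change the law of the noise. -/
lemma map_comp_eq (hW : Noise P W H) {κ : Type*} {f g : κ → ℤ} (hf : f.Injective)
    (hg : g.Injective) : P.map (fun ω i => W (f i) ω) = P.map (fun ω i => W (g i) ω) := by
  rw [(hW.indep.precomp hf).map_fun_eq_infinitePi_map (fun i => hW.meas _),
    (hW.indep.precomp hg).map_fun_eq_infinitePi_map (fun i => hW.meas _)]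
  congr 1
  funext i
  exact hW.ident _ _

lemma real_comp_eq (hW : Noise P W H) {κ : Type*} {f g : κ → ℤ} (hf : f.Injective)
    (hg : g.Injective) {A : Set (κ → ℝ)} (hA : MeasurableSet A) :
    P.real {ω | (fun i => W (f i) ω) ∈ A} = P.real {ω | (fun i => W (g i) ω) ∈ A} := by
  have h1 : ∀ h : κ → ℤ, Measurable fun ω i => W (h i) ω := fun h =>
    measurable_pi_lambda _ fun i => hW.meas _
  have := congrArg (fun μ => Measure.real μ A) (hW.map_comp_eq hf hg)
  rw [map_measureReal_apply (h1 _) hA, map_measureReal_apply (h1 _) hA] at this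
  exact this

lemma sum_law (hW : Noise P W H) {s : Finset ℤ} {n : ℕ} (hs : s.card = n) (u : ℝ) :
    P.real {ω | u < ∑ i ∈ s, W i ω} = P.real {ω | u < partialSum W n ω} := by
  let e := (s.equivFinOfCardEq hs).symm
  have hA : MeasurableSet {z : Fin n → ℝ | u < ∑ i, z i} :=
    measurableSet_lt measurable_const (Finset.measurable_sum _ fun i _ => measurable_pi_apply i)
  have h1 := hW.real_comp_eq (f := fun i : Fin n => ((e i : s) : ℤ))
    (g := fun i : Fin n => ((i : ℕ) : ℤ) + 1)
    (fun i j h => e.injective (Subtype.ext h))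
    (fun i j h => by simpa [Fin.ext_iff] using h) hA
  have e1 : ∀ ω, ∑ i ∈ s, W i ω = ∑ i, W (e i) ω := fun ω => by
    rw [← Finset.sum_coe_sort s, ← e.sum_comp]
  have e2 : ∀ ω, partialSum W n ω = ∑ i : Fin n, W (((i : ℕ) : ℤ) + 1) ω := fun ω => by
    rw [partialSum, Finset.sum_range]
  simp_rw [e1, e2]
  exact h1

/-- Induction on the number of summands through the uniform convolution bound; the constant depends
on the index set only through its cardinality. -/
lemma real_abs_sum_le (hW : Noise P W H) {a : ℝ → ℝ} (hT : HeavyTail H a) (M : ℕ) :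
    ∃ C : ℝ, 0 < C ∧ ∀ s : Finset ℤ, s.card ≤ M → ∀ x,
      P.real {ω | x < ∑ i ∈ s, |W i ω|} ≤ C * H x := by
  obtain ⟨C, hC, h⟩ := hT.conv_rv (P := P)
  induction M with
  | zero =>
    refine ⟨1, one_pos, fun s hs x => ?_⟩
    have : s = ∅ := by simpa using hs
    rw [this, one_mul, ← hW.tail 0 x]
    refine measureReal_mono fun ω hω => ?_
    have : x < 0 := by simpa using hω
    exact this.trans_le (abs_nonneg _)
  | succ M ih =>
    obtain ⟨C', hC', h'⟩ := ih
    refine ⟨max C' (C * 1 * C'), by positivity, fun s hs x => ?_⟩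
    have hx := hT.pos x
    rcases s.eq_empty_or_nonempty with rfl | ⟨k, hk⟩
    · refine (h' ∅ (by simp) x).trans ?_
      gcongr
      exact le_max_left _ _
    · have e : ∀ ω, ∑ i ∈ s, |W i ω| = ∑ i ∈ s.erase k, |W i ω| + |W k ω| := fun ω =>
        (Finset.sum_erase_add _ _ hk).symm
      simp_rw [e]
      have hI : IndepFun (fun ω => ∑ i ∈ s.erase k, |W i ω|) (fun ω => |W k ω|) P := by
        have := hW.indepFun_sum (s := s.erase k) (t := {k}) (by simp)
          (f := fun _ z => |z|) (g := fun _ z => |z|) (fun _ => by fun_prop) (fun _ => by fun_prop)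
        simpa using this
      have hm := hW.meas
      refine (h _ _ 1 C' (by fun_prop) (by fun_prop) hI zero_le_one hC'.le (fun u => ?_)
        (fun r => ?_) x).trans ?_
      · refine h' _ ?_ u
        rw [Finset.card_erase_of_mem hk]
        omega
      · rw [one_mul, hW.tail]
      · gcongr
        exact le_max_right _ _

lemma tight_sum (hW : Noise P W H) {a : ℝ → ℝ} (hT : HeavyTail H a) (M : ℕ) {ε : ℝ} (hε : 0 < ε) :
    ∃ K₀ : ℝ, ∀ K, K₀ ≤ K → ∀ s : Finset ℤ, s.card ≤ M →
      P.real {ω | K < ∑ i ∈ s, |W i ω|} ≤ ε := by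
  obtain ⟨C, hC, h⟩ := hW.real_abs_sum_le hT M
  obtain ⟨K₀, hK⟩ := eventually_atTop.1 ((hT.tendsto_zero.const_mul C).eventually_le_const
    (u := ε) (by simpa using hε))
  exact ⟨K₀, fun K hKK s hs => (h s hs K).trans (hK K hKK)⟩

/-- Dropping boundedly many summands. -/
lemma sum_le_of_card (hW : Noise P W H) {a : ℝ → ℝ} (hT : HeavyTail H a) (M : ℕ) {ε : ℝ}
    (hε : 0 < ε) : ∃ K₀ : ℝ, 0 < K₀ ∧ ∀ K, K₀ ≤ K → ∀ (s : Finset ℤ) (n : ℕ), s.card ≤ n →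
      n ≤ s.card + M → ∀ u, (1 - ε) * P.real {ω | u < ∑ i ∈ s, W i ω} ≤
        P.real {ω | u - K < partialSum W n ω} := by
  obtain ⟨K₀, h⟩ := hW.tight_sum hT M hε
  refine ⟨max K₀ 1, by positivity, fun K hK s n h1 h2 u => ?_⟩
  -- Since the law of a sum depends only on the number of terms, `s` may be replaced by an initial
  -- block; the at most `M` missing terms then form an independent tight block.
  set s₁ := Finset.Icc (1 : ℤ) s.card
  set s₂ := Finset.Ioc (s.card : ℤ) n
  have hd : Disjoint s₁ s₂ := by
    rw [Finset.disjoint_left]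
    intro i hi hj
    simp only [s₁, s₂, Finset.mem_Icc, Finset.mem_Ioc] at hi hj
    omega
  have hc1 : s₁.card = s.card := by simp [s₁]
  have hc2 : (s₁ ∪ s₂).card = n := by
    rw [Finset.card_union_of_disjoint hd]
    simp only [s₁, s₂, Int.card_Icc, Int.card_Ioc]
    omega
  have hI := hW.indepFun_sum hd (f := fun _ z => z) (g := fun _ z => z)
    (fun _ => measurable_id) (fun _ => measurable_id)
  have h3 := IndepFun.mul_le_add hI u K
  have h4 : 1 - ε ≤ P.real {ω | -K ≤ ∑ i ∈ s₂, W i ω} := by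
    have h5 := h K ((le_max_left _ _).trans hK) s₂ (by simp only [s₂, Int.card_Ioc]; omega)
    have hm := hW.meas
    have hms : MeasurableSet {ω | -K ≤ ∑ i ∈ s₂, W i ω} :=
      measurableSet_le measurable_const (Finset.measurable_fun_sum _ fun _ _ => hm _)
    have h6 := probReal_compl_eq_one_sub (μ := P) hms
    have h7 : P.real {ω | -K ≤ ∑ i ∈ s₂, W i ω}ᶜ ≤ ε := by
      refine le_trans (measureReal_mono fun ω hω => ?_) h5
      simp only [Set.mem_compl_iff, Set.mem_ofPred_eq, not_le] at hω ⊢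
      have := Finset.abs_sum_le_sum_abs (fun i => W i ω) s₂
      have := neg_le_abs (∑ i ∈ s₂, W i ω)
      linarith
    linarith
  simp_rw [← Finset.sum_union hd] at h3
  rw [hW.sum_law hc2, hW.sum_law hc1] at h3
  rw [hW.sum_law rfl, mul_comm]
  exact (mul_le_mul_of_nonneg_left h4 measureReal_nonneg).trans h3

/-- By exchangeability, each summand is equally likely to be the only large one. -/
lemma card_mul_real_le (hW : Noise P W H) {s J : Finset ℤ} (hsJ : Disjoint s J) (d : ℤ → ℝ)
    (x b v : ℝ) {k : ℤ} (hk : k ∈ s) :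
    s.card * P.real {ω | x < ∑ i ∈ s, W i ω + ∑ j ∈ J, d j * W j ω ∧
        ∑ j ∈ J, d j * W j ω ≤ b ∧ v < W k ω ∧ ∀ j ∈ s, j ≠ k → W j ω ≤ v} ≤
      P.real {ω | x < ∑ i ∈ s, W i ω + ∑ j ∈ J, d j * W j ω ∧ ∑ j ∈ J, d j * W j ω ≤ b} := by
  let A : ℤ → Set (ℤ → ℝ) := fun k => {z | x < ∑ i ∈ s, z i + ∑ j ∈ J, d j * z j ∧
        ∑ j ∈ J, d j * z j ≤ b ∧ v < z k ∧ ∀ j ∈ s, j ≠ k → z j ≤ v}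
  have hAm : ∀ k, MeasurableSet (A k) := by
    intro k
    have m1 : Measurable fun z : ℤ → ℝ => ∑ i ∈ s, z i + ∑ j ∈ J, d j * z j := by fun_prop
    have m2 : Measurable fun z : ℤ → ℝ => ∑ j ∈ J, d j * z j := by fun_prop
    suffices h : MeasurableSet {z : ℤ → ℝ | ∀ j ∈ s, j ≠ k → z j ≤ v} from
      (measurableSet_lt measurable_const m1).inter ((measurableSet_le m2 measurable_const).inter
        ((measurableSet_lt measurable_const (measurable_pi_apply k)).inter h))
    have : {z : ℤ → ℝ | ∀ j ∈ s, j ≠ k → z j ≤ v} = ⋂ j ∈ s, {z | j ≠ k → z j ≤ v} := by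
      ext; simp
    rw [this]
    refine Finset.measurableSet_biInter _ fun j _ => ?_
    by_cases hj : j = k
    · simp [hj]
    · simp only [ne_eq, hj, not_false_eq_true, forall_const]
      exact measurableSet_le (measurable_pi_apply j) measurable_const
  have hWm : Measurable fun ω (i : ℤ) => W i ω := measurable_pi_lambda _ hW.meas
  -- The transposition of `j` and `k` preserves the law of the noise and the sum over `s`, and it
  -- does not touch `J`.
  have hswap : ∀ j ∈ s, P.real {ω | (fun i => W i ω) ∈ A j} = P.real {ω | (fun i => W i ω) ∈ A k} := by
    intro j hj
    rw [← hW.real_comp_eq (f := Equiv.swap j k) (g := fun i => i) (Equiv.injective _)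
      (fun _ _ h => h) (hAm k)]
    congr 1
    ext ω
    have e1 : ∑ i ∈ s, W (Equiv.swap j k i) ω = ∑ i ∈ s, W i ω := by
      refine Finset.sum_equiv (Equiv.swap j k) (fun i => ?_) (fun i _ => rfl)
      by_cases h1 : i = j
      · simp [h1, hj, hk]
      by_cases h2 : i = k
      · simp [h2, hj, hk]
      rw [Equiv.swap_apply_of_ne_of_ne h1 h2]
    have e2 : ∑ i ∈ J, d i * W (Equiv.swap j k i) ω = ∑ i ∈ J, d i * W i ω := by
      refine Finset.sum_congr rfl fun i hi => ?_
      have hns := Finset.disjoint_right.1 hsJ hi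
      rw [Equiv.swap_apply_of_ne_of_ne (fun h : i = j => hns (h ▸ hj))
        (fun h : i = k => hns (h ▸ hk))]
    have e3 : (∀ i ∈ s, i ≠ k → W (Equiv.swap j k i) ω ≤ v) ↔ ∀ i ∈ s, i ≠ j → W i ω ≤ v := by
      constructor
      · intro h i hi hij
        by_cases h2 : i = k
        · have := h j hj (fun h3 => hij (h2.trans h3.symm))
          rwa [Equiv.swap_apply_left, ← h2] at this
        · have := h i hi h2
          rwa [Equiv.swap_apply_of_ne_of_ne hij h2] at this
      · intro h i hi hik
        by_cases h1 : i = j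
        · rw [h1, Equiv.swap_apply_left]
          exact h k hk (fun h3 => hik (h1.trans h3.symm))
        · rw [Equiv.swap_apply_of_ne_of_ne h1 hik]
          exact h i hi h1
    simp only [A, Set.mem_ofPred_eq, e1, e2, e3, Equiv.swap_apply_right]
  have hsum : ∑ j ∈ s, P.real {ω | (fun i => W i ω) ∈ A j} =
      s.card * P.real {ω | (fun i => W i ω) ∈ A k} := by
    rw [Finset.sum_congr rfl hswap, Finset.sum_const, nsmul_eq_mul]
  refine hsum.symm.trans_le ?_
  rw [← measureReal_biUnion_finset]
  · refine measureReal_mono ?_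
    intro ω hω
    simp only [Set.mem_iUnion] at hω
    obtain ⟨j, -, h1, h2, -⟩ := hω
    exact ⟨h1, h2⟩
  -- The events are disjoint because on each of them exactly one index of `s` carries a value above
  -- `v`.
  · intro i hi j hj hij
    refine Set.disjoint_left.2 ?_
    rintro ω ⟨-, -, h1, -⟩ ⟨-, -, -, h2⟩
    exact absurd (h2 i hi hij) (not_le.2 h1)
  · exact fun j _ => hWm (hAm j)

end Noise

namespace Noise

variable {Ω : Type*} [MeasurableSpace Ω] {P : Measure Ω} [IsProbabilityMeasure P]
  {W : ℤ → Ω → ℝ} {H a : ℝ → ℝ}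

/-- Layer-cake formula: boundedness of `r ^ 4 * H r` gives the square a tail of order `t ^ (-2)`,
which is integrable at infinity. -/
lemma memLp_two (hW : Noise P W H) (hT : HeavyTail H a) (k : ℤ) : MemLp (W k) 2 P := by
  obtain ⟨C, hC, h⟩ := hT.poly 4
  have hm := hW.meas k
  rw [memLp_two_iff_integrable_sq hm.aestronglyMeasurable]
  refine ⟨(hm.pow_const 2).aestronglyMeasurable, ?_⟩
  rw [hasFiniteIntegral_iff_ofReal (ae_of_all _ fun ω => sq_nonneg _)]
  rw [lintegral_eq_lintegral_meas_lt P (ae_of_all _ fun ω => sq_nonneg _)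
    (hm.pow_const 2).aemeasurable]
  have hsplit : Set.Ioi (0 : ℝ) = Set.Ioc 0 1 ∪ Set.Ioi 1 := by
    rw [Set.Ioc_union_Ioi_eq_Ioi zero_le_one]
  rw [hsplit]
  refine (lintegral_union_le _ _ _).trans_lt ?_
  refine ENNReal.add_lt_top.2 ⟨?_, ?_⟩
  · refine (lintegral_mono fun t => prob_le_one).trans_lt ?_
    simp
  · have hint : IntegrableOn (fun t : ℝ => C * t ^ (-2 : ℝ)) (Set.Ioi 1) :=
      (integrableOn_Ioi_rpow_of_lt (by norm_num) one_pos).const_mul C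
    refine lt_of_le_of_lt ?_ hint.lintegral_lt_top
    refine setLIntegral_mono' measurableSet_Ioi fun t ht => ?_
    have ht1 : (1 : ℝ) < t := ht
    have hs : 0 < √t := Real.sqrt_pos.2 (by linarith)
    have e : {ω | t < W k ω ^ 2} ⊆ {ω | √t < |W k ω|} := fun ω (hω : t < W k ω ^ 2) => by
      have := Real.sqrt_lt_sqrt (by linarith) hω
      rwa [Real.sqrt_sq_eq_abs] at this
    refine (measure_mono e).trans ?_
    rw [← ofReal_measureReal, hW.tail]
    refine ENNReal.ofReal_le_ofReal ?_
    have h1 := h (√t) hs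
    have h2 : √t ^ 4 = t ^ 2 := by
      rw [show (4 : ℕ) = 2 * 2 by norm_num, pow_mul, Real.sq_sqrt (by linarith)]
    rw [h2] at h1
    have h3 : t ^ (-2 : ℝ) = (t ^ 2)⁻¹ := by
      rw [Real.rpow_neg (by linarith)]
      norm_cast
    rw [h3, ← div_eq_mul_inv, le_div_iff₀ (by positivity)]
    linarith

lemma identDistrib (hW : Noise P W H) (i j : ℤ) : IdentDistrib (W i) (W j) P P :=
  ⟨(hW.meas i).aemeasurable, (hW.meas j).aemeasurable, hW.ident i j⟩

/-- By the central limit theorem, a centred random walk exceeds `√n` with probability bounded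
away from zero. -/
lemma exists_le_sqrt (hW : Noise P W H) (hT : HeavyTail H a) (hmean : ∫ ω, W 1 ω ∂P = 0) :
    ∃ c₀ : ℝ, 0 < c₀ ∧ ∀ᶠ n : ℕ in atTop, c₀ ≤ P.real {ω | √n < partialSum W n ω} := by
  set X : ℕ → Ω → ℝ := fun i => W ((i : ℤ) + 1) with hX
  have hX0 : X 0 = W 1 := by simp [hX]
  have hL : MemLp (X 0) 2 P := hW.memLp_two hT _
  -- Zero variance would make the noise vanish almost surely, against `H 0 > 0`. Nondegeneracy
  -- ensures that the limiting Gaussian law charges `(1, ∞)` and has no atom at `1`.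
  have hv : Var[X 0; P].toNNReal ≠ 0 := by
    intro h0
    have h1 : Var[X 0; P] = 0 :=
      le_antisymm (Real.toNNReal_eq_zero.1 h0) (variance_nonneg _ _)
    have h2 := ae_eq_integral_of_variance_eq_zero hL h1
    rw [hX0, hmean] at h2
    have h3 := hW.tail 1 0
    have h4 : P.real {ω | 0 < |W 1 ω|} = 0 := by
      rw [measureReal_eq_zero_iff]
      refine measure_mono_null (fun ω hω => ?_) h2
      simpa using hω
    exact (hT.pos 0).ne' (h3.symm.trans h4)
  have hindep : iIndepFun X P :=
    hW.indep.precomp (g := fun i : ℕ => (i : ℤ) + 1) fun i j h => by simpa using h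
  have hclt := tendstoInDistribution_inv_sqrt_mul_sum_sub (P' := gaussianReal 0 Var[X 0; P].toNNReal)
    (Y := id) ⟨aemeasurable_id, Measure.map_id⟩ hL hindep (fun i => hW.identDistrib _ _)
  rw [hX0, hmean] at hclt
  have hnull : (gaussianReal 0 Var[X 0; P].toNNReal) (frontier (Set.Ioi (1 : ℝ))) = 0 := by
    have := nullSingletonClass_gaussianReal (μ := 0) hv
    simp
  have hlim := ProbabilityMeasure.tendsto_measure_of_null_frontier_of_tendsto' hclt.tendsto
    (E := Set.Ioi 1) (by simpa [hX0] using hnull)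
  have hpos : 0 < (gaussianReal 0 Var[X 0; P].toNNReal) (Set.Ioi (1 : ℝ)) := by
    rw [pos_iff_ne_zero]
    intro h0
    have := gaussianReal_absolutelyContinuous' 0 hv h0
    simp at this
  have h1 : 0 < (gaussianReal 0 Var[X 0; P].toNNReal).real (Set.Ioi (1 : ℝ)) :=
    ENNReal.toReal_pos hpos.ne' (by finiteness)
  set v := (gaussianReal 0 Var[X 0; P].toNNReal).real (Set.Ioi (1 : ℝ)) with hvdef
  refine ⟨v / 2, by positivity, ?_⟩
  simp only [ProbabilityMeasure.coe_mk, Measure.map_id] at hlim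
  have hlim2 := (ENNReal.tendsto_toReal (measure_ne_top _ _)).comp hlim
  have := hlim2.eventually_const_lt (u := v / 2) (by
    have : v / 2 < v := by linarith
    simpa [hX0, hvdef, measureReal_def] using this)
  filter_upwards [this, eventually_gt_atTop 0] with n hn hn0
  refine hn.le.trans ?_
  have hm : Measurable fun ω => (√(n : ℝ))⁻¹ * (∑ k ∈ Finset.range n, X k ω - n * 0) := by
    have : ∀ k, Measurable (X k) := fun k => hW.meas _
    fun_prop
  simp only [Function.comp]
  rw [Measure.map_apply hm measurableSet_Ioi, ← measureReal_def]
  refine measureReal_mono fun ω hω => ?_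
  have hω' : 1 < (√(n : ℝ))⁻¹ * (∑ k ∈ Finset.range n, X k ω - n * 0) := hω
  have hs : 0 < √(n : ℝ) := Real.sqrt_pos.2 (by exact_mod_cast hn0)
  rw [mul_zero, sub_zero, inv_mul_eq_div, one_lt_div hs] at hω'
  exact hω'

end Noise

/-! ### The large deviation regime of the random walk. -/

/-- The filter of uniform convergence over the sets `A n`, `n → ∞`. -/
def unifFilter (A : ℕ → Set ℝ) : Filter (ℕ × ℝ) :=
  comap Prod.fst atTop ⊓ 𝓟 {z | z.2 ∈ A z.1}

lemma eventually_unifFilter {A : ℕ → Set ℝ} {p : ℕ × ℝ → Prop} :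
    (∀ᶠ z in unifFilter A, p z) ↔ ∀ᶠ n in atTop, ∀ x ∈ A n, p (n, x) := by
  rw [unifFilter, eventually_inf_principal, eventually_comap]
  refine eventually_congr (Eventually.of_forall fun n => ⟨fun h x hx => h (n, x) rfl hx, ?_⟩)
  rintro h ⟨m, x⟩ rfl hx
  exact h x hx

lemma unifTendsto_iff {A : ℕ → Set ℝ} {f : ℕ → ℝ → ℝ} {c : ℝ} :
    UnifTendsto A f c ↔ Tendsto (fun z : ℕ × ℝ => f z.1 z.2) (unifFilter A) (𝓝 c) := by
  rw [Metric.tendsto_nhds]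
  constructor
  · intro h ε hε
    rw [eventually_unifFilter]
    filter_upwards [h (ε / 2) (by positivity)] with n hn x hx
    rw [Real.dist_eq]
    linarith [hn x hx]
  · intro h ε hε
    have := h ε hε
    rw [eventually_unifFilter] at this
    filter_upwards [this] with n hn x hx
    exact (hn x hx).le

/-- The tail of the random walk. -/
def walkTail {Ω : Type*} [MeasurableSpace Ω] (P : Measure Ω) (W : ℤ → Ω → ℝ) (n : ℕ) (u : ℝ) : ℝ :=
  P.real {ω | u < partialSum W n ω}

/-- Along the filter `l` on pairs `(n, y)`, the tail of the random walk at `y` (and slightly below)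
is asymptotically `κ * n * H`. -/
structure LDRegime {Ω : Type*} [MeasurableSpace Ω] (P : Measure Ω) (W : ℤ → Ω → ℝ) (H : ℝ → ℝ)
    (l : Filter (ℕ × ℝ)) (κ : ℝ) : Prop where
  tendsto_n : Tendsto (fun z => z.1) l atTop
  tendsto_y : Tendsto (fun z => z.2) l atTop
  n_le : ∀ᶠ z in l, (z.1 : ℝ) ≤ z.2 ^ 2
  nonneg : 0 ≤ κ
  -- The room below `y` allows levels reduced by bounded shifts, by multiples of `a y`, or by a
  -- small fraction of `y`.
  ld : ∃ η : ℝ, 0 < η ∧ η < 1 ∧ ∀ ε : ℝ, 0 < ε → ∀ᶠ z in l, ∀ u, (1 - η) * z.2 ≤ u →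
    |walkTail P W z.1 u / (z.1 * H u) - κ| ≤ ε

/-- By the central limit theorem the walk exceeds `√n` with probability bounded below, while a tail
bound valid at `√n` would give `C * n * H (√n - 1)`, which tends to zero. Hence `√n` lies below the
range of the bound. -/
lemma sqrt_lt_of_walkTail_le {Ω : Type*} [MeasurableSpace Ω] {P : Measure Ω}
    [IsProbabilityMeasure P] {W : ℤ → Ω → ℝ} {H a : ℝ → ℝ} (hW : Noise P W H)
    (hT : HeavyTail H a) (hmean : ∫ ω, W 1 ω ∂P = 0) {l : Filter (ℕ × ℝ)}
    (hn : Tendsto (fun z => z.1) l atTop) {η C : ℝ} (hC : 0 ≤ C)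
    (hle : ∀ᶠ z in l, ∀ u, (1 - η) * z.2 ≤ u → walkTail P W z.1 u ≤ C * (z.1 * H (u - 1))) :
    ∀ᶠ z in l, √(z.1 : ℝ) < (1 - η) * z.2 := by
  obtain ⟨c₀, hc0, h1⟩ := hW.exists_le_sqrt hT hmean
  have hlim : Tendsto (fun n : ℕ => C * ((n : ℝ) * H (√n - 1))) atTop (𝓝 0) := by
    obtain ⟨D, hD, hp⟩ := hT.poly 4
    have h2 : Tendsto (fun n : ℕ => C * (D * 16 / (n : ℝ))) atTop (𝓝 0) := by
      simpa using ((tendsto_const_nhds (x := D * 16)).div_atTop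
        tendsto_natCast_atTop_atTop).const_mul C
    refine squeeze_zero' (Eventually.of_forall fun n => mul_nonneg hC
      (mul_nonneg (Nat.cast_nonneg _) (hT.pos _).le)) ?_ h2
    filter_upwards [eventually_gt_atTop 4] with n hn
    have hn' : (4 : ℝ) < n := by exact_mod_cast hn
    have hs : 2 < √(n : ℝ) := Real.lt_sqrt_of_sq_lt (by norm_num; exact hn)
    have hs2 : √(n : ℝ) ^ 2 = n := Real.sq_sqrt (by linarith)
    refine mul_le_mul_of_nonneg_left ?_ hC
    rw [le_div_iff₀ (by linarith)]
    have h3 := hp (√n - 1) (by linarith)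
    have h4 : (n : ℝ) * n ≤ 16 * (√n - 1) ^ 4 := by
      have : (n : ℝ) ≤ 4 * (√n - 1) ^ 2 := by nlinarith
      nlinarith
    have := (hT.pos (√n - 1)).le
    nlinarith
  have h2 := hlim.eventually_lt_const hc0
  filter_upwards [hle, hn.eventually h1, hn.eventually h2] with z h3 h4 h5
  by_contra! hcon
  exact absurd (h4.trans (h3 _ hcon)) (not_le.2 h5)

/-- `G` is the tail by which the assumption on the noise is normalised and `c` its limit there, so
that `κ` is `c` times the limit of `G / H`. The bound by `H (u - 1)` accommodates a left tail
defined by a non-strict inequality. That `y` tends to infinity and that `n ≤ y ^ 2` both follow from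
the comparison with `√n`. -/
lemma LDRegime.of_tendsto {Ω : Type*} [MeasurableSpace Ω] {P : Measure Ω}
    [IsProbabilityMeasure P] {W : ℤ → Ω → ℝ} {H a : ℝ → ℝ} (hW : Noise P W H)
    (hT : HeavyTail H a) (hmean : ∫ ω, W 1 ω ∂P = 0) {l : Filter (ℕ × ℝ)}
    (hn : Tendsto (fun z => z.1) l atTop) {η : ℝ} (hη : 0 < η) (hη1 : η < 1) {G : ℝ → ℝ}
    {c κ : ℝ} (hκ : 0 ≤ κ) (hc : c ≤ 1) (hG0 : ∀ u, 0 < G u) (hG : ∀ u, G u ≤ H (u - 1))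
    (hlim : Tendsto (fun u => c * (G u / H u)) atTop (𝓝 κ))
    (hld : ∀ ε : ℝ, 0 < ε → ∀ᶠ z in l, ∀ u, (1 - η) * z.2 ≤ u →
      |walkTail P W z.1 u / (z.1 * G u) - c| ≤ ε) : LDRegime P W H l κ := by
  have hn0 := hn.eventually (eventually_gt_atTop 0)
  have hη2 : 0 < 1 - η := by linarith
  have hsq : ∀ᶠ z in l, √(z.1 : ℝ) < (1 - η) * z.2 := by
    refine sqrt_lt_of_walkTail_le hW hT hmean hn (C := 2) (by norm_num) ?_
    filter_upwards [hld 1 one_pos, hn0] with z h1 h2 u hu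
    have h3 := (abs_le.1 (h1 u hu)).2
    have h4 : (0 : ℝ) < z.1 := by exact_mod_cast h2
    have h5 := hG0 u
    have h6 : walkTail P W z.1 u / (z.1 * G u) ≤ 2 := by linarith
    rw [div_le_iff₀ (by positivity)] at h6
    refine h6.trans ?_
    gcongr
    exact hG u
  have hsq' : ∀ᶠ z in l, √(z.1 : ℝ) ≤ z.2 := by
    filter_upwards [hsq] with z hz
    have := Real.sqrt_nonneg (z.1 : ℝ)
    nlinarith
  have hsqt : Tendsto (fun z : ℕ × ℝ => √(z.1 : ℝ)) l atTop :=
    Real.tendsto_sqrt_atTop.comp (tendsto_natCast_atTop_atTop.comp hn)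
  have hy : Tendsto (fun z => z.2) l atTop := tendsto_atTop_mono' l hsq' hsqt
  refine ⟨hn, hy, ?_, hκ, η, hη, hη1, fun ε hε => ?_⟩
  · filter_upwards [hsq'] with z hz
    rw [← Real.sq_sqrt (Nat.cast_nonneg z.1)]
    exact pow_le_pow_left₀ (Real.sqrt_nonneg _) hz 2
  · obtain ⟨u₀, hu0⟩ := eventually_atTop.1
      (((Metric.tendsto_nhds.1 hlim) (ε / 2) (by positivity)).and
        ((hT.long 1).eventually_lt_const (u := 2) (by norm_num)))
    filter_upwards [hld (ε / 4) (by positivity), hn0,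
      (hy.const_mul_atTop hη2).eventually_ge_atTop u₀] with z h1 h2 h3 u hu
    have h4 : (0 : ℝ) < z.1 := by exact_mod_cast h2
    obtain ⟨h5, h6⟩ := hu0 u (h3.trans hu)
    have hHu := hT.pos u
    have hGu := hG0 u
    rw [Real.dist_eq] at h5
    have h7 : G u / H u ≤ 2 := by
      refine le_trans ?_ h6.le
      gcongr
      exact hG u
    have h8 : 0 ≤ G u / H u := by positivity
    have e : walkTail P W z.1 u / (z.1 * H u) - κ =
        (walkTail P W z.1 u / (z.1 * G u) - c) * (G u / H u) + (c * (G u / H u) - κ) := by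
      field_simp
      ring
    rw [e]
    refine (abs_add_le _ _).trans ?_
    rw [abs_mul, abs_of_nonneg h8]
    have h9 := mul_le_mul (h1 u hu) h7 h8 (by positivity)
    linarith

namespace LDRegime

variable {Ω : Type*} [MeasurableSpace Ω] {P : Measure Ω} [IsProbabilityMeasure P]
  {W : ℤ → Ω → ℝ} {H a : ℝ → ℝ} {l : Filter (ℕ × ℝ)} {κ : ℝ}

/-- The two-sided bounds on the random walk tail. -/
lemma bounds (h : LDRegime P W H l κ) (hT : HeavyTail H a) : ∃ η : ℝ, 0 < η ∧ η < 1 ∧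
    ∀ ε : ℝ, 0 < ε → ∀ᶠ z in l, ∀ u, (1 - η) * z.2 ≤ u →
      walkTail P W z.1 u ≤ (κ + ε) * (z.1 * H u) ∧ (κ - ε) * (z.1 * H u) ≤ walkTail P W z.1 u := by
  obtain ⟨η, h0, h1, h2⟩ := h.ld
  refine ⟨η, h0, h1, fun ε hε => ?_⟩
  filter_upwards [h2 ε hε, h.tendsto_n.eventually (eventually_gt_atTop 0)] with z h3 h4 u hu
  have h5 : (0 : ℝ) < z.1 := by exact_mod_cast h4
  have h6 := hT.pos u
  have h7 := abs_le.1 (h3 u hu)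
  constructor
  · rw [← div_le_iff₀ (by positivity)]
    linarith [h7.2]
  · rw [← le_div_iff₀ (by positivity)]
    linarith [h7.1]

/-- A bound for sums with boundedly many summands removed. -/
lemma sum_le (h : LDRegime P W H l κ) (hW : Noise P W H) (hT : HeavyTail H a) (M : ℕ) :
    ∃ η : ℝ, 0 < η ∧ η < 1 ∧ ∃ B : ℝ, 0 < B ∧ ∀ᶠ z in l, ∀ u, (1 - η) * z.2 ≤ u →
      ∀ s : Finset ℤ, s.card ≤ z.1 → z.1 ≤ s.card + M →
        P.real {ω | u < ∑ i ∈ s, W i ω} ≤ B * (z.1 * H u) := by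
  obtain ⟨η, h0, h1, h2⟩ := h.bounds hT
  obtain ⟨K, hK0, hK⟩ := hW.sum_le_of_card hT M (ε := 1 / 2) (by norm_num)
  obtain ⟨u₀, hu0⟩ := eventually_atTop.1 ((hT.long K).eventually_lt_const (u := 2) (by norm_num))
  have hη : 0 < 1 - η / 2 := by linarith
  have hκ := h.nonneg
  -- Half of `η` is kept to absorb the shift by `K`. The factor four combines the factor `1 / 2`
  -- lost to the dropped summands with `H (u - K) ≤ 2 * H u`.
  refine ⟨η / 2, by linarith, by linarith, 4 * (κ + 1), by positivity, ?_⟩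
  filter_upwards [h2 1 one_pos, (h.tendsto_y.const_mul_atTop hη).eventually_ge_atTop u₀,
    h.tendsto_y.eventually_ge_atTop (2 * K / η)] with z h3 h4 h5 u hu s hs1 hs2
  rw [div_le_iff₀ h0] at h5
  have h6 := hK K le_rfl s z.1 hs1 hs2 u
  have h7 := (h3 (u - K) (by nlinarith)).1
  have h8 := hu0 u (h4.trans hu)
  rw [div_lt_iff₀ (hT.pos u)] at h8
  rw [walkTail] at h7
  have h9 : (κ + 1) * (z.1 * H (u - K)) ≤ (κ + 1) * (z.1 * (2 * H u)) := by gcongr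
  linarith

end LDRegime

/-! ### Additional summands with weights of one sign. -/

section UnionBounds

variable {Ω : Type*} [MeasurableSpace Ω] {P : Measure Ω} [IsProbabilityMeasure P]

lemma real_le_add {s t u : Set Ω} (h : ∀ ω ∈ s, ω ∈ t ∨ ω ∈ u) :
    P.real s ≤ P.real t + P.real u :=
  (measureReal_mono (fun ω hω => h ω hω)).trans (measureReal_union_le t u)

lemma real_le_add₃ {s t u v : Set Ω} (h : ∀ ω ∈ s, ω ∈ t ∨ ω ∈ u ∨ ω ∈ v) :
    P.real s ≤ P.real t + (P.real u + P.real v) :=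
  (real_le_add (u := u ∪ v) h).trans (add_le_add_right (measureReal_union_le u v) _)

lemma real_le_sum {ι : Type*} (J : Finset ι) {s : Set Ω} {t : ι → Set Ω}
    (h : ∀ ω ∈ s, ∃ k ∈ J, ω ∈ t k) : P.real s ≤ ∑ k ∈ J, P.real (t k) :=
  (measureReal_mono (fun ω hω => by simpa using h ω hω) (measure_ne_top _ _)).trans
    (measureReal_biUnion_finset_le J t)

end UnionBounds

namespace Noise

variable {Ω : Type*} [MeasurableSpace Ω] {P : Measure Ω} [IsProbabilityMeasure P]
  {W : ℤ → Ω → ℝ} {H : ℝ → ℝ}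

lemma real_abs_inter (hW : Noise P W H) {j k : ℤ} (hjk : j ≠ k) (v w : ℝ) :
    P.real {ω | v < |W j ω| ∧ w < |W k ω|} = H v * H w := by
  have hI := (hW.indep.indepFun hjk).comp (φ := fun z : ℝ => |z|) (ψ := fun z : ℝ => |z|)
    (by fun_prop) (by fun_prop)
  have := IndepFun.real_inter hI (s := Set.Ioi v) (t := Set.Ioi w) measurableSet_Ioi
    measurableSet_Ioi
  simp only [Set.mem_Ioi, Function.comp] at this
  rw [this, hW.tail, hW.tail]

lemma real_lt_inter_le (hW : Noise P W H) {j k : ℤ} (hjk : j ≠ k) (v w : ℝ) :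
    P.real {ω | v < W j ω ∧ w < W k ω} ≤ H v * H w := by
  rw [← hW.real_abs_inter hjk]
  exact measureReal_mono fun ω hω => ⟨hω.1.trans_le (le_abs_self _), hω.2.trans_le (le_abs_self _)⟩

end Noise

lemma sum_le_sum_abs_of_weight {J : Finset ℤ} {d w : ℤ → ℝ} (hd : ∀ j, |d j| ≤ 1) :
    ∑ j ∈ J, d j * w j ≤ ∑ j ∈ J, |w j| := by
  refine Finset.sum_le_sum fun j _ => (le_abs_self _).trans ?_
  rw [abs_mul]
  exact mul_le_of_le_one_left (abs_nonneg _) (hd j)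

namespace LDRegime

variable {Ω : Type*} [MeasurableSpace Ω] {P : Measure Ω} [IsProbabilityMeasure P]
  {W : ℤ → Ω → ℝ} {H a : ℝ → ℝ} {l : Filter (ℕ × ℝ)} {κ : ℝ}

set_option maxHeartbeats 1000000 in
/-- Boundedly many additional summands with weights in `[0, 1]` that contribute a large value can
be neglected. -/
lemma real_add_le (h : LDRegime P W H l κ) (hW : Noise P W H) (hT : HeavyTail H a)
    (hH : ∀ η : ℝ, 0 < η → ∀ ε : ℝ, 0 < ε → ∀ᶠ z in l, H (η * z.2) ^ 2 ≤ ε * H z.2) (M : ℕ)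
    {ε : ℝ} (hε : 0 < ε) : ∃ K₀ : ℝ, ∀ K, K₀ ≤ K → ∀ᶠ z in l, ∀ (I J : Finset ℤ) (d : ℤ → ℝ),
      Disjoint I J → I.card + 1 ≤ z.1 → z.1 ≤ I.card + M → J.card ≤ M →
      (∀ j, 0 ≤ d j) → (∀ j, d j ≤ 1) →
      P.real {ω | z.2 < ∑ i ∈ I, W i ω + ∑ j ∈ J, d j * W j ω ∧ K < ∑ j ∈ J, d j * W j ω} ≤
        ε * (z.1 * H z.2) := by
  obtain ⟨η₁, h0, h1, B, hB, hsum⟩ := h.sum_le hW hT M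
  obtain ⟨C, hC, hCs⟩ := hW.real_abs_sum_le hT M
  set ε₁ := ε / (3 * C * B) with hε1
  have hε10 : 0 < ε₁ := by positivity
  obtain ⟨K, hK, x₀, hconv⟩ := hT.conv_trunc_rv (P := P) h0 h1 hε10
  have hM : (0 : ℝ) < M + 1 := by positivity
  -- With threshold `v = v₁ * y`, up to `M` weighted values not exceeding `v` add up to at most `η₁
  -- * y`.
  set v₁ := η₁ / (M + 1) with hv1
  have hv10 : 0 < v₁ := by positivity
  set D : ℝ := 2 * B + C * B * ε₁ with hD
  have hD0 : 0 < D := by positivity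
  refine ⟨K, fun K' hK' => ?_⟩
  filter_upwards [hsum, h.tendsto_y.eventually_ge_atTop x₀, h.tendsto_y.eventually_gt_atTop 0,
    h.tendsto_y.eventually_ge_atTop (K / η₁),
    hH v₁ hv10 (ε / (6 * (M + 1))) (by positivity),
    h.tendsto_y.eventually ((hT.long K).eventually_lt_const (u := 2) (by norm_num)),
    (tendsto_natCast_atTop_atTop.comp h.tendsto_n).eventually_ge_atTop
      (max (2 * (M : ℝ)) (6 * (M + 1) * D / ε))] with z hs hx0 hy0 hyK hH2 hlong hn I J d hIJ hI1 hI2 hJ hd0 hd1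
  simp only [Function.comp] at hn
  have hn1 : 2 * (M : ℝ) ≤ z.1 := (le_max_left _ _).trans hn
  have hn2 : 6 * (M + 1) * D / ε ≤ z.1 := (le_max_right _ _).trans hn
  rw [div_le_iff₀ hε] at hn2
  rw [div_le_iff₀ h0] at hyK
  have hHy := hT.pos z.2
  rw [div_lt_iff₀ hHy] at hlong
  have hdabs : ∀ j, |d j| ≤ 1 := fun j => by rw [abs_of_nonneg (hd0 j)]; exact hd1 j
  have hI1' : (I.card : ℝ) + 1 ≤ z.1 := by exact_mod_cast hI1
  have hI2' : (z.1 : ℝ) ≤ I.card + M := by exact_mod_cast hI2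
  have hJ' : (J.card : ℝ) ≤ M := by exact_mod_cast hJ
  have hm := hW.meas
  -- moderate contributions
  have htrunc : ∀ I' J' : Finset ℤ, Disjoint I' J' → I'.card ≤ z.1 → z.1 ≤ I'.card + M →
      J'.card ≤ M → P.real {ω | z.2 < ∑ i ∈ I', W i ω + ∑ j ∈ J', d j * W j ω ∧
        K < ∑ j ∈ J', d j * W j ω ∧ ∑ j ∈ J', d j * W j ω ≤ η₁ * z.2} ≤
        C * B * ε₁ * (z.1 * H z.2) := by
    intro I' J' hd' hc1 hc2 hc3
    have hI := hW.indepFun_sum hd' (f := fun _ z => z) (g := fun j z => d j * z)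
      (fun _ => measurable_id) (fun _ => by fun_prop)
    refine (hconv z.2 hx0 _ _ C (B * z.1) (by fun_prop) (by fun_prop) hI hC.le (by positivity)
      (fun u hu => ?_) (fun r => ?_)).trans_eq (by ring)
    · rw [mul_assoc]
      exact hs u hu I' hc1 hc2
    · refine le_trans (measureReal_mono fun ω hω => ?_) (hCs J' hc3 r)
      exact lt_of_lt_of_le (show r < _ from hω) (sum_le_sum_abs_of_weight hdabs)
  set v := v₁ * z.2 with hv
  have hv0 : 0 < v := by positivity
  have hMv : M * v ≤ η₁ * z.2 := by
    have : (M + 1) * v = η₁ * z.2 := by rw [hv, hv1]; field_simp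
    linarith
  -- The variable `W k` is promoted from weight `d k` to weight one, which only raises the sum
  -- because `W k > 0` and `d k ≤ 1`; it then becomes the only large step of a walk over `insert k
  -- I`.
  set G : ℤ → Set Ω := fun k => {ω | z.2 < ∑ i ∈ insert k I, W i ω +
    ∑ j ∈ J.erase k, d j * W j ω ∧ ∑ j ∈ J.erase k, d j * W j ω ≤ η₁ * z.2 ∧ v < W k ω ∧
      ∀ j ∈ insert k I, j ≠ k → W j ω ≤ v} with hG
  have hGle : ∀ k ∈ J, P.real (G k) ≤ 2 * D * H z.2 := by
    intro k hk
    have hkI : k ∉ I := Finset.disjoint_right.1 hIJ hk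
    have hdisj : Disjoint (insert k I) (J.erase k) := by
      rw [Finset.disjoint_insert_left]
      exact ⟨by simp, hIJ.mono_right (Finset.erase_subset _ _)⟩
    have hcard : (insert k I).card = I.card + 1 := Finset.card_insert_of_notMem hkI
    -- Exchangeability divides a probability of order `n * H y` by the number of steps, so that `G
    -- k` has probability of order `H y` only.
    have e1 := hW.card_mul_real_le hdisj d z.2 (η₁ * z.2) v (Finset.mem_insert_self k I)
    have e2 := htrunc _ _ hdisj (by omega) (by omega) ((Finset.card_le_card
      (Finset.erase_subset k J)).trans hJ)
    have e3 := hs (z.2 - K) (by linarith) (insert k I) (by omega) (by omega)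
    have e4 : P.real {ω | z.2 < ∑ i ∈ insert k I, W i ω + ∑ j ∈ J.erase k, d j * W j ω ∧
        ∑ j ∈ J.erase k, d j * W j ω ≤ η₁ * z.2} ≤ D * (z.1 * H z.2) := by
      calc _ ≤ _ := real_le_add fun ω hω => by
            obtain ⟨q1, q2⟩ := hω
            by_cases q3 : K < ∑ j ∈ J.erase k, d j * W j ω
            · exact Or.inr ⟨q1, q3, q2⟩
            · refine Or.inl (show z.2 - K < ∑ i ∈ insert k I, W i ω from ?_)
              linarith
        _ ≤ B * (z.1 * H (z.2 - K)) + C * B * ε₁ * (z.1 * H z.2) := add_le_add e3 e2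
        _ ≤ B * (z.1 * (2 * H z.2)) + C * B * ε₁ * (z.1 * H z.2) := by gcongr
        _ = _ := by rw [hD]; ring
    rw [hcard] at e1
    push_cast at e1
    have e5 : ((I.card : ℝ) + 1) * P.real (G k) ≤ ((I.card : ℝ) + 1) * (2 * D * H z.2) := by
      refine (e1.trans e4).trans ?_
      have : (z.1 : ℝ) ≤ 2 * (I.card + 1) := by linarith
      calc D * (z.1 * H z.2) ≤ D * (2 * (I.card + 1) * H z.2) := by gcongr
        _ = _ := by ring
    exact le_of_mul_le_mul_left e5 (by positivity)
  -- The contribution of `J` is moderate, or some `k ∈ J` is large together with a second large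
  -- variable, or it is the only large variable.
  have hsub : {ω | z.2 < ∑ i ∈ I, W i ω + ∑ j ∈ J, d j * W j ω ∧ K' < ∑ j ∈ J, d j * W j ω} ⊆
      {ω | z.2 < ∑ i ∈ I, W i ω + ∑ j ∈ J, d j * W j ω ∧
        K < ∑ j ∈ J, d j * W j ω ∧ ∑ j ∈ J, d j * W j ω ≤ η₁ * z.2} ∪
      ((⋃ k ∈ J, ⋃ j ∈ (I ∪ J).erase k, {ω | v < W j ω ∧ v < W k ω}) ∪ ⋃ k ∈ J, G k) := by
    rintro ω ⟨q1, q2⟩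
    by_cases q3 : ∑ j ∈ J, d j * W j ω ≤ η₁ * z.2
    · exact Or.inl ⟨q1, hK'.trans_lt q2, q3⟩
    refine Or.inr ?_
    rw [not_le] at q3
    have hex : ∃ k ∈ J, v < W k ω := by
      by_contra! hcon
      have : ∑ j ∈ J, d j * W j ω ≤ ∑ j ∈ J, v := by
        refine Finset.sum_le_sum fun j hj => ?_
        have := hcon j hj
        have := hd0 j
        have := hd1 j
        nlinarith
      rw [Finset.sum_const, nsmul_eq_mul] at this
      nlinarith
    obtain ⟨k, hk, hkv⟩ := hex
    by_cases q4 : ∃ j ∈ (I ∪ J).erase k, v < W j ω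
    · obtain ⟨j, hj, hjv⟩ := q4
      exact Or.inl (Set.mem_biUnion hk (Set.mem_biUnion hj ⟨hjv, hkv⟩))
    · push Not at q4
      refine Or.inr (Set.mem_biUnion hk ⟨?_, ?_, hkv, ?_⟩)
      · have hkI : k ∉ I := Finset.disjoint_right.1 hIJ hk
        rw [Finset.sum_insert hkI]
        rw [← Finset.add_sum_erase _ _ hk] at q1
        have := hd1 k
        nlinarith
      · calc ∑ j ∈ J.erase k, d j * W j ω ≤ ∑ j ∈ J.erase k, v := by
              refine Finset.sum_le_sum fun j hj => ?_
              have := q4 j (by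
                rw [Finset.mem_erase] at hj ⊢
                exact ⟨hj.1, Finset.mem_union_right _ hj.2⟩)
              have := hd0 j
              have := hd1 j
              nlinarith
          _ = (J.erase k).card * v := by rw [Finset.sum_const, nsmul_eq_mul]
          _ ≤ M * v := by
              gcongr
              exact (Finset.card_le_card (Finset.erase_subset k J)).trans hJ
          _ ≤ _ := hMv
      · intro j hj hjk
        refine q4 j (Finset.mem_erase.2 ⟨hjk, Finset.mem_union_left _ ?_⟩)
        exact (Finset.mem_insert.1 hj).resolve_left hjk
  have hpairs : P.real (⋃ k ∈ J, ⋃ j ∈ (I ∪ J).erase k, {ω | v < W j ω ∧ v < W k ω}) ≤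
      ε / 3 * (z.1 * H z.2) := by
    calc _ ≤ ∑ k ∈ J, P.real (⋃ j ∈ (I ∪ J).erase k, {ω | v < W j ω ∧ v < W k ω}) :=
          measureReal_biUnion_finset_le _ _
      _ ≤ ∑ k ∈ J, ∑ j ∈ (I ∪ J).erase k, P.real {ω | v < W j ω ∧ v < W k ω} :=
          Finset.sum_le_sum fun k _ => measureReal_biUnion_finset_le _ _
      _ ≤ ∑ k ∈ J, ∑ j ∈ (I ∪ J).erase k, H v * H v :=
          Finset.sum_le_sum fun k _ => Finset.sum_le_sum fun j hj =>
            hW.real_lt_inter_le (Finset.mem_erase.1 hj).1 v v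
      _ ≤ ∑ k ∈ J, (2 * z.1) * (H v * H v) := by
          refine Finset.sum_le_sum fun k _ => ?_
          rw [Finset.sum_const, nsmul_eq_mul]
          refine mul_le_mul_of_nonneg_right ?_ (by have := hT.pos v; positivity)
          have : (((I ∪ J).erase k).card : ℝ) ≤ I.card + J.card := by
            exact_mod_cast (Finset.card_le_card (Finset.erase_subset _ _)).trans
              (Finset.card_union_le _ _)
          linarith
      _ = J.card * (2 * z.1 * H v ^ 2) := by rw [Finset.sum_const, nsmul_eq_mul]; ring
      _ ≤ (M + 1) * (2 * z.1 * (ε / (6 * (M + 1)) * H z.2)) := by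
          gcongr
          linarith
      _ = _ := by field_simp; ring
  have hone : P.real (⋃ k ∈ J, G k) ≤ ε / 3 * (z.1 * H z.2) := by
    calc _ ≤ ∑ k ∈ J, P.real (G k) := measureReal_biUnion_finset_le _ _
      _ ≤ ∑ k ∈ J, 2 * D * H z.2 := Finset.sum_le_sum hGle
      _ = J.card * (2 * D * H z.2) := by rw [Finset.sum_const, nsmul_eq_mul]
      _ ≤ (M + 1) * (2 * D * H z.2) := by
          gcongr
          linarith
      _ = 1 / 3 * (6 * (M + 1) * D) * H z.2 := by ring
      _ ≤ 1 / 3 * (z.1 * ε) * H z.2 := by gcongr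
      _ = _ := by ring
  have hmod := htrunc I J hIJ (by omega) hI2 hJ
  have hCB : C * B * ε₁ = ε / 3 := by rw [hε1]; field_simp
  rw [hCB] at hmod
  calc _ ≤ _ := measureReal_mono hsub
    _ ≤ _ := (measureReal_union_le _ _).trans (add_le_add_right (measureReal_union_le _ _) _)
    _ ≤ ε / 3 * (z.1 * H z.2) + (ε / 3 * (z.1 * H z.2) + ε / 3 * (z.1 * H z.2)) :=
        add_le_add hmod (add_le_add hpairs hone)
    _ = _ := by ring

end LDRegime

namespace LDRegime

variable {Ω : Type*} [MeasurableSpace Ω] {P : Measure Ω} [IsProbabilityMeasure P]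
  {W : ℤ → Ω → ℝ} {H a : ℝ → ℝ} {l : Filter (ℕ × ℝ)} {κ : ℝ}

/-- The sharp upper bound for sums with boundedly many summands removed. -/
lemma sum_le_sharp (h : LDRegime P W H l κ) (hW : Noise P W H) (hT : HeavyTail H a) (M : ℕ)
    {ε : ℝ} (hε : 0 < ε) :
    ∃ η : ℝ, 0 < η ∧ ∀ᶠ z in l, ∀ u, (1 - η) * z.2 ≤ u →
      ∀ s : Finset ℤ, s.card ≤ z.1 → z.1 ≤ s.card + M →
        P.real {ω | u < ∑ i ∈ s, W i ω} ≤ (κ + ε) * (z.1 * H u) := by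
  obtain ⟨η, h0, h1, h2⟩ := h.bounds hT
  have hκ := h.nonneg
  -- Three errors are combined: `κ + δ` from the regime, `1 + δ` from the shift by `K`, and the
  -- factor `1 - δ` lost when summands are dropped.
  obtain ⟨δ, hδ0, hδ1, hδ⟩ : ∃ δ : ℝ, 0 < δ ∧ δ < 1 ∧ (κ + δ) * (1 + δ) ≤ (κ + ε) * (1 - δ) := by
    refine ⟨ε / (2 * (κ + ε + 2 + ε)), by positivity, ?_, ?_⟩
    · rw [div_lt_one (by positivity)]; linarith
    · set δ := ε / (2 * (κ + ε + 2 + ε)) with hδ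
      have e : δ * (2 * (κ + ε + 2 + ε)) = ε := by rw [hδ]; field_simp
      have h0 : 0 < δ := by positivity
      have h1 : δ < 1 := by rw [hδ, div_lt_one (by positivity)]; linarith
      nlinarith
  obtain ⟨K, hK0, hK⟩ := hW.sum_le_of_card hT M hδ0
  obtain ⟨u₀, hu0⟩ := eventually_atTop.1
    ((hT.long K).eventually_lt_const (u := 1 + δ) (by linarith))
  have hη : 0 < 1 - η / 2 := by linarith
  refine ⟨η / 2, by linarith, ?_⟩
  filter_upwards [h2 δ hδ0, (h.tendsto_y.const_mul_atTop hη).eventually_ge_atTop u₀,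
    h.tendsto_y.eventually_ge_atTop (2 * K / η)] with z h3 h4 h5 u hu s hs1 hs2
  rw [div_le_iff₀ h0] at h5
  have h6 := hK K le_rfl s z.1 hs1 hs2 u
  have h7 := (h3 (u - K) (by nlinarith)).1
  have h8 := hu0 u (h4.trans hu)
  have hHu := hT.pos u
  rw [div_lt_iff₀ hHu] at h8
  rw [walkTail] at h7
  have h9 : (κ + δ) * (z.1 * H (u - K)) ≤ (κ + δ) * (z.1 * ((1 + δ) * H u)) := by gcongr
  have h10 : (1 - δ) * P.real {ω | u < ∑ i ∈ s, W i ω} ≤ (1 - δ) * ((κ + ε) * (z.1 * H u)) := by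
    calc _ ≤ (κ + δ) * (z.1 * ((1 + δ) * H u)) := h6.trans (h7.trans h9)
      _ = ((κ + δ) * (1 + δ)) * (z.1 * H u) := by ring
      _ ≤ ((κ + ε) * (1 - δ)) * (z.1 * H u) := by gcongr
      _ = _ := by ring
  exact le_of_mul_le_mul_left h10 (by linarith)

/-- The lower bound for sums with the last `m` summands removed. -/
lemma le_sum_Icc (h : LDRegime P W H l κ) (hW : Noise P W H) (hT : HeavyTail H a)
    (hH : ∀ η : ℝ, 0 < η → ∀ ε : ℝ, 0 < ε → ∀ᶠ z in l, H (η * z.2) ^ 2 ≤ ε * H z.2)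
    {m : ℕ} (hm : 1 ≤ m) {ε : ℝ} (hε : 0 < ε) (K : ℝ) :
    ∀ᶠ z in l, (κ - ε) * (z.1 * H z.2) ≤
      P.real {ω | z.2 + K < ∑ i ∈ Finset.Icc (1 : ℤ) (z.1 - m), W i ω} := by
  rcases le_or_gt (κ - ε) 0 with hκε | hκε
  · refine Eventually.of_forall fun z => le_trans ?_ measureReal_nonneg
    exact mul_nonpos_of_nonpos_of_nonneg hκε (mul_nonneg (Nat.cast_nonneg _) (hT.pos _).le)
  obtain ⟨η, h0, h1, h2⟩ := h.bounds hT
  obtain ⟨K₀, hK₀⟩ := h.real_add_le hW hT hH m (ε := ε / 4) (by positivity)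
  set L := max K₀ 0 with hL
  set K' := max K 0 with hK'
  have hκ : 0 < κ := by linarith
  filter_upwards [h2 (ε / 4) (by positivity), hK₀ L (le_max_left _ _),
    h.tendsto_y.eventually ((hT.long (-(K' + L))).eventually_const_lt
      (u := 1 - ε / (4 * κ)) (by have : 0 < ε / (4 * κ) := by positivity
                                 linarith)),
    h.tendsto_n.eventually_ge_atTop (m + 1), h.tendsto_y.eventually_ge_atTop 0]
    with z h3 h4 h5 h6 hy0
  set I := Finset.Icc (1 : ℤ) (z.1 - m)
  set J := Finset.Ioc ((z.1 : ℤ) - m) z.1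
  have hd : Disjoint I J := by
    rw [Finset.disjoint_left]
    intro i hi hj
    simp only [I, J, Finset.mem_Icc, Finset.mem_Ioc] at hi hj
    omega
  have hIJ : I ∪ J = Finset.Icc 1 (z.1 : ℤ) := by
    ext i
    simp only [I, J, Finset.mem_union, Finset.mem_Icc, Finset.mem_Ioc]
    omega
  have hHy := hT.pos z.2
  rw [lt_div_iff₀ hHy, sub_neg_eq_add] at h5
  have hK0 : 0 ≤ K' := le_max_right _ _
  have hL0 : 0 ≤ L := le_max_right _ _
  have h7 := (h3 (z.2 + (K' + L)) (by nlinarith)).2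
  have h8 := h4 I J (fun _ => 1) hd (by simp only [I, Int.card_Icc]; omega)
    (by simp only [I, Int.card_Icc]; omega) (by simp only [J, Int.card_Ioc]; omega)
    (fun _ => zero_le_one) (fun _ => le_rfl)
  -- If the full walk exceeds `y + K' + L`, either its first `n - m` steps exceed `y + K`, or the
  -- last `m` steps contribute more than `L`, which is negligible by the estimate with unit weights.
  have h9 : walkTail P W z.1 (z.2 + (K' + L)) ≤ P.real {ω | z.2 + K < ∑ i ∈ I, W i ω} +
      P.real {ω | z.2 < ∑ i ∈ I, W i ω + ∑ j ∈ J, 1 * W j ω ∧ L < ∑ j ∈ J, 1 * W j ω} := by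
    rw [walkTail, ← hW.sum_law (s := Finset.Icc 1 (z.1 : ℤ)) (by simp)]
    refine real_le_add fun ω hω => ?_
    simp only [Set.mem_ofPred_eq] at hω ⊢
    rw [← hIJ, Finset.sum_union hd] at hω
    simp only [one_mul]
    by_cases q : L < ∑ j ∈ J, W j ω
    · exact Or.inr ⟨by linarith, q⟩
    · refine Or.inl ?_
      have : K ≤ K' := le_max_left _ _
      linarith
  have h10 : (κ - ε / 2) * (z.1 * H z.2) ≤ (κ - ε / 4) * (z.1 * H (z.2 + (K' + L))) := by
    calc (κ - ε / 2) * (z.1 * H z.2)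
        ≤ ((κ - ε / 4) * (1 - ε / (4 * κ))) * (z.1 * H z.2) := by
          refine mul_le_mul_of_nonneg_right ?_ (by positivity)
          have : (κ - ε / 4) * (1 - ε / (4 * κ)) = κ - ε / 2 + ε ^ 2 / (16 * κ) := by
            field_simp
            ring
          rw [this]
          have : 0 ≤ ε ^ 2 / (16 * κ) := by positivity
          linarith
      _ = (κ - ε / 4) * (z.1 * ((1 - ε / (4 * κ)) * H z.2)) := by ring
      _ ≤ _ := by
          have : 0 ≤ κ - ε / 4 := by linarith
          gcongr
  have h11 : 0 ≤ z.1 * H z.2 := by positivity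
  nlinarith

/-- Adding boundedly many weighted summands to the random walk does not change the tail, provided
that large contributions of these summands can be neglected. -/
lemma tendsto_add (h : LDRegime P W H l κ) (hW : Noise P W H) (hT : HeavyTail H a)
    (hH : ∀ η : ℝ, 0 < η → ∀ ε : ℝ, 0 < ε → ∀ᶠ z in l, H (η * z.2) ^ 2 ≤ ε * H z.2)
    {m : ℕ} (hm : 1 ≤ m) (J : ℕ → Finset ℤ) (d : ℕ → ℤ → ℝ) {M : ℕ} {D : ℝ}
    (hJ : ∀ n : ℕ, Disjoint (Finset.Icc (1 : ℤ) (n - m)) (J n)) (hJM : ∀ n, (J n).card ≤ M)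
    (hd : ∀ n j, |d n j| ≤ D)
    (hbig : ∀ ε : ℝ, 0 < ε → ∃ r : ℝ → ℝ,
      (∀ᶠ z in l, H (z.2 - r z.2) ≤ (1 + ε) * H z.2) ∧
      (∀ η : ℝ, 0 < η → ∀ᶠ z in l, r z.2 ≤ η * z.2) ∧
      ∀ᶠ z in l, P.real {ω | z.2 < ∑ i ∈ Finset.Icc (1 : ℤ) (z.1 - m), W i ω +
        ∑ j ∈ J z.1, d z.1 j * W j ω ∧ r z.2 < ∑ j ∈ J z.1, d z.1 j * W j ω} ≤
          ε * (z.1 * H z.2)) :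
    Tendsto (fun z => P.real {ω | z.2 < ∑ i ∈ Finset.Icc (1 : ℤ) (z.1 - m), W i ω +
        ∑ j ∈ J z.1, d z.1 j * W j ω} / (z.1 * H z.2)) l (𝓝 κ) := by
  have hκ := h.nonneg
  have hD0 : 0 ≤ D := (abs_nonneg _).trans (hd 0 0)
  have hcard : ∀ n : ℕ, m + 1 ≤ n → (Finset.Icc (1 : ℤ) (n - m)).card ≤ n ∧
      n ≤ (Finset.Icc (1 : ℤ) (n - m)).card + m := by
    intro n hn
    simp only [Int.card_Icc]
    omega
  refine Metric.tendsto_nhds.2 fun ε₀ hε₀ => ?_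
  obtain ⟨ε, hε, hε1, hεε⟩ : ∃ ε : ℝ, 0 < ε ∧ ε ≤ 1 ∧ (κ + 4) * ε < ε₀ := by
    refine ⟨min 1 (ε₀ / (2 * (κ + 4))), by positivity, min_le_left _ _, ?_⟩
    calc (κ + 4) * min 1 (ε₀ / (2 * (κ + 4))) ≤ (κ + 4) * (ε₀ / (2 * (κ + 4))) := by
          gcongr
          exact min_le_right _ _
      _ = ε₀ / 2 := by field_simp
      _ < ε₀ := by linarith
  -- Below `r y` the extra summands cost a shift to which `H` is insensitive; above `r y` they are
  -- negligible by hypothesis.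
  obtain ⟨r, hr1, hr2, hr3⟩ := hbig ε hε
  obtain ⟨η, hη, hup⟩ := h.sum_le_sharp hW hT m hε
  obtain ⟨K₀, hK₀⟩ := hW.tight_sum hT M hε
  set K := max K₀ 0 with hK
  have hmeas := hW.meas
  filter_upwards [hr3, hr1, hr2 η hη, hup,
    h.le_sum_Icc hW hT hH hm hε ((D + 1) * K), h.tendsto_n.eventually_ge_atTop (m + 1)]
    with z h1 h2 h3 h4 h5 h6
  set I := Finset.Icc (1 : ℤ) (z.1 - m)
  have hHy := hT.pos z.2
  have hn0 : (0 : ℝ) < z.1 := by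
    have : 0 < z.1 := by omega
    exact_mod_cast this
  have hnH : 0 < z.1 * H z.2 := by positivity
  obtain ⟨hc1, hc2⟩ := hcard z.1 h6
  have hupper : P.real {ω | z.2 < ∑ i ∈ I, W i ω + ∑ j ∈ J z.1, d z.1 j * W j ω} ≤
      ((κ + ε) * (1 + ε) + ε) * (z.1 * H z.2) := by
    have h7 := h4 (z.2 - r z.2) (by linarith) I hc1 hc2
    calc _ ≤ P.real {ω | z.2 - r z.2 < ∑ i ∈ I, W i ω} + P.real {ω | z.2 < ∑ i ∈ I, W i ω +
        ∑ j ∈ J z.1, d z.1 j * W j ω ∧ r z.2 < ∑ j ∈ J z.1, d z.1 j * W j ω} := by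
          refine real_le_add fun ω hω => ?_
          simp only [Set.mem_ofPred_eq] at hω ⊢
          by_cases q : r z.2 < ∑ j ∈ J z.1, d z.1 j * W j ω
          · exact Or.inr ⟨hω, q⟩
          · exact Or.inl (by linarith)
      _ ≤ (κ + ε) * (z.1 * ((1 + ε) * H z.2)) + ε * (z.1 * H z.2) := by
          refine add_le_add (h7.trans ?_) h1
          gcongr
      _ = _ := by ring
  -- For the lower bound only tightness and independence of the extra summands matter. The factor `D
  -- + 1` instead of `D` keeps the strict inequality usable when `D = 0`.
  have hlower : (1 - ε) * ((κ - ε) * (z.1 * H z.2)) ≤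
      P.real {ω | z.2 < ∑ i ∈ I, W i ω + ∑ j ∈ J z.1, d z.1 j * W j ω} := by
    have hI := hW.indepFun_sum (hJ z.1) (f := fun _ z => z) (g := fun j x => d z.1 j * x)
      (fun _ => measurable_id) (fun _ => by fun_prop)
    have h7 := IndepFun.mul_le_add hI (z.2 + (D + 1) * K) ((D + 1) * K)
    rw [add_sub_cancel_right] at h7
    have h8 : 1 - ε ≤ P.real {ω | -((D + 1) * K) ≤ ∑ j ∈ J z.1, d z.1 j * W j ω} := by
      have hms : MeasurableSet {ω | -((D + 1) * K) ≤ ∑ j ∈ J z.1, d z.1 j * W j ω} := by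
        refine measurableSet_le measurable_const ?_
        fun_prop
      have h9 := probReal_compl_eq_one_sub (μ := P) hms
      have h10 : P.real {ω | -((D + 1) * K) ≤ ∑ j ∈ J z.1, d z.1 j * W j ω}ᶜ ≤ ε := by
        refine le_trans (measureReal_mono fun ω hω => ?_)
          (hK₀ K (le_max_left _ _) (J z.1) (hJM z.1))
        simp only [Set.mem_compl_iff, Set.mem_ofPred_eq, not_le] at hω ⊢
        have h11 : |∑ j ∈ J z.1, d z.1 j * W j ω| ≤ D * ∑ j ∈ J z.1, |W j ω| := by
          rw [Finset.mul_sum]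
          refine (Finset.abs_sum_le_sum_abs _ _).trans (Finset.sum_le_sum fun j _ => ?_)
          rw [abs_mul]
          gcongr
          exact hd _ _
        have h12 := neg_le_abs (∑ j ∈ J z.1, d z.1 j * W j ω)
        have h13 : (D + 1) * K < (D + 1) * ∑ j ∈ J z.1, |W j ω| := by
          have : 0 ≤ ∑ j ∈ J z.1, |W j ω| := Finset.sum_nonneg fun _ _ => abs_nonneg _
          linarith
        exact lt_of_mul_lt_mul_left h13 (by linarith)
      linarith
    rcases le_or_gt (κ - ε) 0 with hκε | hκε
    · refine le_trans ?_ measureReal_nonneg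
      exact mul_nonpos_of_nonneg_of_nonpos (by linarith)
        (mul_nonpos_of_nonpos_of_nonneg hκε hnH.le)
    · calc (1 - ε) * ((κ - ε) * (z.1 * H z.2)) ≤ _ :=
            mul_le_mul h8 h5 (by positivity) measureReal_nonneg
        _ ≤ _ := by rw [mul_comm]; exact h7
  rw [Real.dist_eq, abs_lt]
  constructor
  · have : κ - ε₀ < P.real {ω | z.2 < ∑ i ∈ I, W i ω + ∑ j ∈ J z.1, d z.1 j * W j ω} /
        (z.1 * H z.2) := by
      rw [lt_div_iff₀ hnH]
      refine lt_of_lt_of_le ?_ hlower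
      have : κ - ε₀ < (1 - ε) * (κ - ε) := by nlinarith
      calc (κ - ε₀) * (z.1 * H z.2) < ((1 - ε) * (κ - ε)) * (z.1 * H z.2) :=
            mul_lt_mul_of_pos_right this hnH
        _ = _ := by ring
    linarith
  · have : P.real {ω | z.2 < ∑ i ∈ I, W i ω + ∑ j ∈ J z.1, d z.1 j * W j ω} /
        (z.1 * H z.2) < κ + ε₀ := by
      rw [div_lt_iff₀ hnH]
      refine lt_of_le_of_lt hupper ?_
      refine mul_lt_mul_of_pos_right ?_ hnH
      nlinarith
    linarith

/-- Finite moving averages with weights of the same sign. -/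
lemma tendsto_add_of_nonneg (h : LDRegime P W H l κ) (hW : Noise P W H) (hT : HeavyTail H a)
    (hH : ∀ η : ℝ, 0 < η → ∀ ε : ℝ, 0 < ε → ∀ᶠ z in l, H (η * z.2) ^ 2 ≤ ε * H z.2)
    {m : ℕ} (hm : 1 ≤ m) (J : ℕ → Finset ℤ) (d : ℕ → ℤ → ℝ) {M : ℕ}
    (hJ : ∀ n : ℕ, Disjoint (Finset.Icc (1 : ℤ) (n - m)) (J n)) (hJM : ∀ n, (J n).card ≤ M)
    (hd0 : ∀ n j, 0 ≤ d n j) (hd1 : ∀ n j, d n j ≤ 1) :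
    Tendsto (fun z => P.real {ω | z.2 < ∑ i ∈ Finset.Icc (1 : ℤ) (z.1 - m), W i ω +
        ∑ j ∈ J z.1, d z.1 j * W j ω} / (z.1 * H z.2)) l (𝓝 κ) := by
  refine h.tendsto_add hW hT hH hm J d (D := 1) hJ hJM
    (fun n j => by rw [abs_of_nonneg (hd0 n j)]; exact hd1 n j) fun ε hε => ?_
  obtain ⟨K, hK⟩ := h.real_add_le hW hT hH (max m M) hε
  refine ⟨fun _ => K, ?_, fun η hη => ?_, ?_⟩
  · filter_upwards [h.tendsto_y.eventually
      ((hT.long K).eventually_lt_const (u := 1 + ε) (by linarith))] with z hy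
    rw [div_lt_iff₀ (hT.pos _)] at hy
    exact hy.le
  · filter_upwards [h.tendsto_y.eventually_ge_atTop (K / η)] with z hy
    rw [div_le_iff₀ hη] at hy
    linarith
  · filter_upwards [hK K le_rfl, h.tendsto_n.eventually_ge_atTop (m + 1)] with z h1 h2
    refine h1 _ _ _ (hJ _) ?_ ?_ ((hJM _).trans (le_max_right _ _)) (hd0 _) (hd1 _)
    · simp only [Int.card_Icc]; omega
    · have := le_max_left m M
      simp only [Int.card_Icc]; omega

end LDRegime

/-! ### Slowly varying `-log H`: exponential bounds for the truncated walk. -/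

namespace HeavyTail

variable {H a : ℝ → ℝ}

lemma neg_log_nonneg (hT : HeavyTail H a) (x : ℝ) : 0 ≤ -Real.log (H x) :=
  neg_nonneg.2 (Real.log_nonpos (hT.pos x).le (hT.le_one x))

lemma neg_log_mono (hT : HeavyTail H a) : Monotone fun x => -Real.log (H x) := fun _ y hxy =>
  neg_le_neg (Real.log_le_log (hT.pos y) (hT.anti hxy))

lemma tendsto_neg_log (hT : HeavyTail H a) : Tendsto (fun x => -Real.log (H x)) atTop atTop := by
  refine tendsto_neg_atBot_atTop.comp (Real.tendsto_log_nhdsGT_zero.comp ?_)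
  exact tendsto_nhdsWithin_iff.2 ⟨hT.tendsto_zero, Eventually.of_forall hT.pos⟩

/-- If `-log H` is slowly varying, it grows sublinearly, in a uniform sense. -/
lemma mul_neg_log_le (hT : HeavyTail H a)
    (hLN : ∀ c : ℝ, 0 < c → Tendsto (fun x => Real.log (H (c * x)) / Real.log (H x)) atTop (𝓝 1)) :
    ∃ z₀ : ℝ, 1 ≤ z₀ ∧ (∀ z, z₀ ≤ z → -Real.log (H (2 * z)) ≤ 3 / 2 * -Real.log (H z)) ∧
      ∀ z, z₀ ≤ z → ∀ y, z ≤ y → z * -Real.log (H y) ≤ 3 / 2 * (y * -Real.log (H z)) := by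
  obtain ⟨z₀, h0⟩ := eventually_atTop.1 (((hLN 2 two_pos).eventually_lt_const
    (u := 3 / 2) (by norm_num)).and (hT.tendsto_neg_log.eventually_gt_atTop 0))
  have hstep : ∀ z, max z₀ 1 ≤ z → -Real.log (H (2 * z)) ≤ 3 / 2 * -Real.log (H z) := by
    intro z hz
    obtain ⟨h1, h2⟩ := h0 z ((le_max_left _ _).trans hz)
    rw [← neg_div_neg_eq, div_lt_iff₀ h2] at h1
    exact h1.le
  refine ⟨max z₀ 1, le_max_right _ _, hstep, fun z hz y hzy => ?_⟩
  have hz1 : 1 ≤ z := (le_max_right _ _).trans hz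
  have hz0 : 0 < z := by linarith
  -- Doubling the argument multiplies `-log H` by at most `3 / 2 < 2`, so it grows more slowly than
  -- linearly.
  have hpow : ∀ j : ℕ, -Real.log (H (2 ^ j * z)) ≤ (3 / 2) ^ j * -Real.log (H z) := by
    intro j
    induction j with
    | zero => simp
    | succ j ih =>
      have h1 : (1 : ℝ) ≤ 2 ^ j := one_le_pow₀ (by norm_num)
      have := hstep (2 ^ j * z) (hz.trans (le_mul_of_one_le_left hz0.le h1))
      rw [show 2 * (2 ^ j * z) = 2 ^ (j + 1) * z by ring] at this
      rw [pow_succ (3 / 2 : ℝ)]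
      linarith
  obtain ⟨j, hj1, hj2⟩ := exists_nat_pow_near ((one_le_div hz0).2 hzy) (by norm_num : (1 : ℝ) < 2)
  rw [le_div_iff₀ hz0] at hj1
  rw [div_lt_iff₀ hz0] at hj2
  have hQ := hT.neg_log_nonneg z
  have h1 : -Real.log (H y) ≤ (3 / 2) ^ (j + 1) * -Real.log (H z) :=
    (hT.neg_log_mono hj2.le).trans (hpow _)
  have h2 : (3 / 2 : ℝ) ^ j ≤ 2 ^ j := pow_le_pow_left₀ (by norm_num) (by norm_num) j
  calc z * -Real.log (H y) ≤ z * ((3 / 2) ^ (j + 1) * -Real.log (H z)) := by gcongr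
    _ = 3 / 2 * ((3 / 2) ^ j * z * -Real.log (H z)) := by ring
    _ ≤ 3 / 2 * (y * -Real.log (H z)) := by
        have : (3 / 2 : ℝ) ^ j * z ≤ y := le_trans (by gcongr) hj1
        gcongr

end HeavyTail

namespace Noise

variable {Ω : Type*} [MeasurableSpace Ω] {P : Measure Ω} [IsProbabilityMeasure P]
  {W : ℤ → Ω → ℝ} {H a : ℝ → ℝ}

/-- Uniform exponential moments of the truncated noise. -/
lemma exp_moment_le (hW : Noise P W H) (hT : HeavyTail H a)
    (hLN : ∀ c : ℝ, 0 < c → Tendsto (fun x => Real.log (H (c * x)) / Real.log (H x)) atTop (𝓝 1)) :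
    ∃ M : ℝ, 0 < M ∧ ∀ᶠ y in atTop, ∀ s : ℝ, 0 ≤ s → s * (9 * y) ≤ -Real.log (H y) → ∀ k,
      ∫⁻ ω, ENNReal.ofReal ({ω | W k ω ≤ y}.indicator
        (fun ω => W k ω ^ 2 * Real.exp (s * max (W k ω) 0)) ω) ∂P ≤ ENNReal.ofReal M := by
  obtain ⟨z₀, hz1, hz2, hz3⟩ := hT.mul_neg_log_le hLN
  obtain ⟨C, hC, hpoly⟩ := hT.poly 6
  obtain ⟨j₀, hj0⟩ := pow_unbounded_of_one_lt z₀ (by norm_num : (1 : ℝ) < 2)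
  set Q : ℝ → ℝ := fun x => -Real.log (H x) with hQ
  have hQ0 : ∀ x, 0 ≤ Q x := hT.neg_log_nonneg
  have hQm : Monotone Q := hT.neg_log_mono
  set D₀ : ℝ := (2 ^ j₀) ^ 2 * Real.exp (Q (2 ^ j₀)) with hD0
  have hD0pos : 0 < D₀ := by positivity
  set c : ℕ → ℝ := fun j => (2 ^ (j + 1)) ^ 2 * Real.exp (Q (2 ^ j) / 2) with hc
  refine ⟨D₀ + 8 * √C, by positivity, ?_⟩
  filter_upwards [eventually_ge_atTop (2 ^ j₀ : ℝ)] with y hy s hs0 hs k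
  -- The nine in the condition on `s` is `6 * (3 / 2)`. On the shell between `2 ^ j` and `2 ^ (j +
  -- 1)` one more factor `3 / 2` from doubling gives an exponent of at most `Q (2 ^ j) / 4`, below
  -- the `Q (2 ^ j) / 2` used in `c j`.
  have hexp : ∀ z, z₀ ≤ z → z ≤ y → s * z ≤ Q z / 6 := by
    intro z hz hzy
    have h1 := hz3 z hz y hzy
    have h2 : z * (s * (9 * y)) ≤ z * Q y := by
      have : 0 ≤ z := by linarith
      gcongr
    have hy0 : 0 < y := by linarith
    have h3 : y * (9 * (s * z)) ≤ y * (3 / 2 * Q z) := by linarith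
    have := le_of_mul_le_mul_left h3 hy0
    linarith
  have hpt : ∀ ω, ENNReal.ofReal ({ω | W k ω ≤ y}.indicator
      (fun ω => W k ω ^ 2 * Real.exp (s * max (W k ω) 0)) ω) ≤
      ENNReal.ofReal D₀ + ∑' j : ℕ, {ω | (2 : ℝ) ^ j < |W k ω|}.indicator
        (fun _ => ENNReal.ofReal (c j)) ω := by
    intro ω
    by_cases hWy : W k ω ≤ y
    swap
    · rw [Set.indicator_of_notMem (by exact hWy)]
      simp
    rw [Set.indicator_of_mem (by exact hWy)]
    rcases le_or_gt |W k ω| (2 ^ j₀) with h1 | h1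
    · refine le_trans (ENNReal.ofReal_le_ofReal ?_) le_self_add
      rw [← sq_abs, hD0]
      gcongr
      have h2 : max (W k ω) 0 ≤ 2 ^ j₀ := max_le ((le_abs_self _).trans h1) (by positivity)
      have h3 := hexp (2 ^ j₀) hj0.le hy
      have h4 := hQ0 (2 ^ j₀)
      have h5 : s * max (W k ω) 0 ≤ s * 2 ^ j₀ := by gcongr
      linarith
    · have hW1 : 1 ≤ |W k ω| := (one_le_pow₀ (by norm_num : (1 : ℝ) ≤ 2)).trans h1.le
      obtain ⟨j, hj1, hj2⟩ : ∃ j : ℕ, (2 : ℝ) ^ j < |W k ω| ∧ |W k ω| ≤ 2 ^ (j + 1) := by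
        obtain ⟨j, hja, hjb⟩ := exists_nat_pow_near hW1 (by norm_num : (1 : ℝ) < 2)
        rcases hja.lt_or_eq with hlt | heq
        · exact ⟨j, hlt, hjb.le⟩
        · obtain _ | j := j
          · rw [← heq] at h1
            exact absurd h1 (not_lt.2 (one_le_pow₀ (by norm_num)))
          · refine ⟨j, ?_, heq.symm.le⟩
            rw [← heq]
            exact pow_lt_pow_right₀ (by norm_num) (Nat.lt_succ_self j)
      refine le_trans ?_ le_add_self
      refine le_trans ?_ (ENNReal.le_tsum j)
      rw [Set.indicator_of_mem (by exact hj1)]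
      refine ENNReal.ofReal_le_ofReal ?_
      rw [← sq_abs, hc]
      have hjj : j₀ ≤ j := by
        by_contra! hlt
        have : (2 : ℝ) ^ (j + 1) ≤ 2 ^ j₀ := pow_le_pow_right₀ (by norm_num) hlt
        linarith
      have hzj : z₀ ≤ 2 ^ j := hj0.le.trans (pow_le_pow_right₀ (by norm_num) hjj)
      show |W k ω| ^ 2 * _ ≤ (2 ^ (j + 1)) ^ 2 * Real.exp (Q (2 ^ j) / 2)
      gcongr
      rcases le_total (W k ω) 0 with hneg | hpos
      · rw [max_eq_right hneg, mul_zero]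
        have := hQ0 (2 ^ j)
        positivity
      · rw [max_eq_left hpos]
        rw [abs_of_nonneg hpos] at hj1 hj2
        have h2 := hexp (W k ω) (hzj.trans hj1.le) hWy
        have h3 : Q (W k ω) ≤ Q (2 ^ (j + 1)) := hQm hj2
        have h4 := hz2 (2 ^ j) hzj
        rw [← pow_succ'] at h4
        have h5 := hQ0 (2 ^ j)
        simp only [hQ] at *
        linarith
  refine (lintegral_mono hpt).trans ?_
  have hmW := hW.meas k
  have hms : ∀ j : ℕ, MeasurableSet {ω | (2 : ℝ) ^ j < |W k ω|} := fun j =>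
    measurableSet_lt measurable_const (by fun_prop)
  rw [lintegral_add_left measurable_const, lintegral_tsum fun j =>
    (measurable_const.indicator (hms j)).aemeasurable, ENNReal.ofReal_add hD0pos.le (by positivity)]
  refine add_le_add (by simp) ?_
  -- The shell weight contains `H ^ (-1/2)`, so a factor `H ^ (1/2)` survives; boundedness of `r ^ 6
  -- * H r` makes it at most `√C * 2 ^ (-3 j)`, against `2 ^ (2 j)` from the square.
  have hterm : ∀ j : ℕ, ∫⁻ ω, {ω | (2 : ℝ) ^ j < |W k ω|}.indicator
      (fun _ => ENNReal.ofReal (c j)) ω ∂P ≤ ENNReal.ofReal (4 * √C * (1 / 2) ^ j) := by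
    intro j
    rw [lintegral_indicator_const (hms j), ← ofReal_measureReal, hW.tail,
      ← ENNReal.ofReal_mul (by positivity)]
    refine ENNReal.ofReal_le_ofReal ?_
    have h2j : (0 : ℝ) < 2 ^ j := by positivity
    have hp := hpoly (2 ^ j) h2j
    have hHe : H (2 ^ j) = Real.exp (-(Q (2 ^ j) / 2)) ^ 2 := by
      rw [← Real.exp_nat_mul]
      simp only [hQ]
      rw [show ((2 : ℕ) : ℝ) * -(-Real.log (H (2 ^ j)) / 2) = Real.log (H (2 ^ j)) by
        push_cast; ring, Real.exp_log (hT.pos _)]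
    have hsq : Real.exp (-(Q (2 ^ j) / 2)) * (2 ^ j) ^ 3 ≤ √C := by
      refine Real.le_sqrt_of_sq_le ?_
      rw [mul_pow, ← hHe]
      linarith
    have e1 : Real.exp (Q (2 ^ j) / 2) * Real.exp (-(Q (2 ^ j) / 2)) = 1 := by
      rw [← Real.exp_add, add_neg_cancel, Real.exp_zero]
    calc c j * H (2 ^ j) = 4 * (2 ^ j) ^ 2 * (Real.exp (Q (2 ^ j) / 2) *
          Real.exp (-(Q (2 ^ j) / 2))) * Real.exp (-(Q (2 ^ j) / 2)) := by
          rw [hHe]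
          simp only [hc]
          ring
      _ = 4 * ((1 / 2) ^ j * (Real.exp (-(Q (2 ^ j) / 2)) * (2 ^ j) ^ 3)) := by
          rw [e1, one_div, inv_pow]
          field_simp
      _ ≤ 4 * ((1 / 2) ^ j * √C) := by gcongr
      _ = _ := by ring
  refine (ENNReal.tsum_le_tsum hterm).trans ?_
  rw [← ENNReal.ofReal_tsum_of_nonneg (fun j => by positivity)
    (summable_geometric_two.mul_left _), tsum_mul_left, tsum_geometric_two]
  exact (congrArg _ (by ring)).le

/-- The exponential bound for the truncated noise. -/
lemma mgf_trunc_le (hW : Noise P W H) (hint : ∀ k, Integrable (W k) P)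
    (hmean : ∀ k, ∫ ω, W k ω ∂P = 0) {M y s : ℝ} (hM : 0 ≤ M) (hy : 0 ≤ y) (hs : 0 ≤ s) (k : ℤ)
    (h : ∫⁻ ω, ENNReal.ofReal ({ω | W k ω ≤ y}.indicator
        (fun ω => W k ω ^ 2 * Real.exp (s * max (W k ω) 0)) ω) ∂P ≤ ENNReal.ofReal M) :
    Integrable (fun ω => Real.exp (s * {ω | W k ω ≤ y}.indicator (W k) ω)) P ∧
    mgf ({ω | W k ω ≤ y}.indicator (W k)) P s ≤ Real.exp (s ^ 2 * M) := by
  have hmW := hW.meas k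
  have hms : MeasurableSet {ω | W k ω ≤ y} := measurableSet_le hmW measurable_const
  set V := {ω | W k ω ≤ y}.indicator (W k) with hV
  have hVm : Measurable V := hmW.indicator hms
  have hVy : ∀ ω, V ω ≤ y := fun ω => by
    by_cases hω : W k ω ≤ y
    · rw [hV, Set.indicator_of_mem (by exact hω)]; exact hω
    · rw [hV, Set.indicator_of_notMem (by exact hω)]; exact hy
  have hI1 : Integrable (fun ω => Real.exp (s * V ω)) P := by
    refine Integrable.of_bound (by fun_prop) (Real.exp (s * y)) (ae_of_all _ fun ω => ?_)
    rw [Real.norm_eq_abs, abs_of_pos (Real.exp_pos _)]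
    gcongr
    exact hVy ω
  refine ⟨hI1, ?_⟩
  set R := {ω | W k ω ≤ y}.indicator (fun ω => W k ω ^ 2 * Real.exp (s * max (W k ω) 0)) with hR
  have hR0 : ∀ ω, 0 ≤ R ω := fun ω => Set.indicator_nonneg (fun _ _ => by positivity) ω
  have hRm : Measurable R := by
    refine Measurable.indicator ?_ hms
    fun_prop
  have hRI : Integrable R P := by
    refine ⟨hRm.aestronglyMeasurable, ?_⟩
    rw [hasFiniteIntegral_iff_ofReal (ae_of_all _ hR0)]
    exact h.trans_lt ENNReal.ofReal_lt_top
  have hRle : ∫ ω, R ω ∂P ≤ M := by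
    rw [integral_eq_lintegral_of_nonneg_ae (ae_of_all _ hR0) hRm.aestronglyMeasurable]
    exact ENNReal.toReal_le_of_le_ofReal hM h
  have hVI : Integrable V P := (hint k).indicator hms
  -- Truncation removes positive values only, so the mean can only decrease.
  have hVle : ∫ ω, V ω ∂P ≤ 0 := by
    rw [← hmean k]
    have h1 : ∫ ω, W k ω ∂P = ∫ ω, V ω ∂P + ∫ ω, {ω | W k ω ≤ y}ᶜ.indicator (W k) ω ∂P := by
      rw [← integral_add hVI ((hint k).indicator hms.compl)]
      exact integral_congr_ae (ae_of_all _ fun ω =>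
        (congrFun (Set.indicator_self_add_compl _ (W k)) ω).symm)
    have h2 : 0 ≤ ∫ ω, {ω | W k ω ≤ y}ᶜ.indicator (W k) ω ∂P :=
      integral_nonneg fun ω => Set.indicator_nonneg (fun ω hω => by
        have : ¬ W k ω ≤ y := hω
        linarith) ω
    linarith
  -- A second-order bound in which the exponential is charged only for positive `u`, matching the
  -- moment controlled by the hypothesis.
  have hpt : ∀ u : ℝ, Real.exp u ≤ 1 + u + u ^ 2 * Real.exp (max u 0) := by
    intro u
    rcases le_total u 0 with hu | hu
    · rw [max_eq_right hu, Real.exp_zero]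
      rcases le_or_gt (-1) u with h1 | h1
      · have := Real.abs_exp_sub_one_sub_id_le (x := u) (abs_le.2 ⟨h1, hu.trans zero_le_one⟩)
        have := (abs_le.1 this).2
        linarith
      · have := Real.exp_le_one_iff.2 hu
        nlinarith
    · rw [max_eq_left hu]
      have h1 := Real.add_one_le_exp (-u)
      have h2 : Real.exp (-u) * Real.exp u = 1 := by
        rw [← Real.exp_add, neg_add_cancel, Real.exp_zero]
      have h3 := Real.exp_pos u
      have h4 : Real.exp u * (1 - u) ≤ 1 := by nlinarith
      nlinarith
  have hkey : ∀ ω, Real.exp (s * V ω) ≤ 1 + s * V ω + s ^ 2 * R ω := by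
    intro ω
    refine (hpt (s * V ω)).trans_eq ?_
    by_cases hω : W k ω ≤ y
    · rw [hR, hV, Set.indicator_of_mem (by exact hω), Set.indicator_of_mem (by exact hω)]
      rw [show max (s * W k ω) 0 = s * max (W k ω) 0 by
        rw [mul_max_of_nonneg _ _ hs, mul_zero]]
      ring
    · rw [hR, hV, Set.indicator_of_notMem (by exact hω), Set.indicator_of_notMem (by exact hω)]
      simp
  have hI2 : Integrable (fun ω => 1 + s * V ω) P := (integrable_const 1).add (hVI.const_mul s)
  calc mgf V P s ≤ ∫ ω, (1 + s * V ω + s ^ 2 * R ω) ∂P :=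
        integral_mono hI1 (hI2.add (hRI.const_mul _)) hkey
    _ = 1 + s * ∫ ω, V ω ∂P + s ^ 2 * ∫ ω, R ω ∂P := by
        rw [integral_add hI2 (hRI.const_mul _), integral_add (integrable_const 1) (hVI.const_mul s),
          integral_const_mul, integral_const_mul]
        simp
    _ ≤ 1 + s ^ 2 * M := by
        have : s * ∫ ω, V ω ∂P ≤ 0 := mul_nonpos_of_nonneg_of_nonpos hs hVle
        have : s ^ 2 * ∫ ω, R ω ∂P ≤ s ^ 2 * M := by gcongr
        linarith
    _ ≤ _ := by linarith [Real.add_one_le_exp (s ^ 2 * M)]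

/-- A Chernoff bound for the random walk with truncated increments. -/
lemma chernoff (hW : Noise P W H) (hint : ∀ k, Integrable (W k) P)
    (hmean : ∀ k, ∫ ω, W k ω ∂P = 0) {M y s : ℝ} (hM : 0 ≤ M) (hy : 0 ≤ y) (hs : 0 ≤ s)
    (h : ∀ k, ∫⁻ ω, ENNReal.ofReal ({ω | W k ω ≤ y}.indicator
        (fun ω => W k ω ^ 2 * Real.exp (s * max (W k ω) 0)) ω) ∂P ≤ ENNReal.ofReal M)
    (I : Finset ℤ) (x : ℝ) :
    P.real {ω | x < ∑ i ∈ I, W i ω ∧ ∀ i ∈ I, W i ω ≤ y} ≤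
      Real.exp (-s * x + I.card * (s ^ 2 * M)) := by
  set V : ℤ → Ω → ℝ := fun k => {ω | W k ω ≤ y}.indicator (W k) with hV
  have hmV : ∀ k, Measurable (V k) := fun k =>
    (hW.meas k).indicator (measurableSet_le (hW.meas k) measurable_const)
  have hind : iIndepFun V P := by
    have := hW.indep.comp (fun _ z => if z ≤ y then z else 0)
      (fun _ => Measurable.ite measurableSet_Iic measurable_id measurable_const)
    convert this using 2 with k
    ext ω
    by_cases hω : W k ω ≤ y
    · simp only [hV, Set.indicator_of_mem (show ω ∈ {ω | W k ω ≤ y} from hω), Function.comp, if_pos hω]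
    · simp only [hV, Set.indicator_of_notMem (show ω ∉ {ω | W k ω ≤ y} from hω), Function.comp, if_neg hω]
  have h1 : P.real {ω | x < ∑ i ∈ I, W i ω ∧ ∀ i ∈ I, W i ω ≤ y} ≤
      P.real {ω | x ≤ (∑ i ∈ I, V i) ω} := by
    refine measureReal_mono fun ω hω => ?_
    have e : (∑ i ∈ I, V i) ω = ∑ i ∈ I, W i ω := by
      rw [Finset.sum_apply]
      exact Finset.sum_congr rfl fun i hi => Set.indicator_of_mem (by exact hω.2 i hi) _
    show x ≤ _
    rw [e]
    exact hω.1.le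
  have hsumI : Integrable (fun ω => Real.exp (s * (∑ i ∈ I, V i) ω)) P :=
    hind.integrable_exp_mul_sum hmV fun i _ => (hW.mgf_trunc_le hint hmean hM hy hs i (h i)).1
  refine (h1.trans (measure_ge_le_exp_mul_mgf x hs hsumI)).trans ?_
  rw [hind.mgf_sum hmV, Real.exp_add]
  refine mul_le_mul_of_nonneg_left ?_ (Real.exp_pos _).le
  calc ∏ i ∈ I, mgf (V i) P s ≤ ∏ i ∈ I, Real.exp (s ^ 2 * M) :=
        Finset.prod_le_prod (fun _ _ => mgf_nonneg)
          fun i _ => (hW.mgf_trunc_le hint hmean hM hy hs i (h i)).2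
    _ = _ := by rw [Finset.prod_const, ← Real.exp_nat_mul]

end Noise

namespace Noise

variable {Ω : Type*} [MeasurableSpace Ω] {P : Measure Ω} [IsProbabilityMeasure P]
  {W : ℤ → Ω → ℝ} {H a : ℝ → ℝ}

/-- Supermultiplicativity of the tails of the random walk. -/
lemma real_mul_le_partialSum (hW : Noise P W H) (m n : ℕ) (u v : ℝ) :
    P.real {ω | u ≤ partialSum W m ω} * P.real {ω | v ≤ partialSum W n ω} ≤
      P.real {ω | u + v ≤ partialSum W (m + n) ω} := by
  set T := Finset.Ioc (m : ℤ) (m + n)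
  set S := Finset.Icc (1 : ℤ) m
  have hd : Disjoint S T := by
    rw [Finset.disjoint_left]
    intro i hi hj
    simp only [S, T, Finset.mem_Icc, Finset.mem_Ioc] at hi hj
    omega
  have hm := hW.meas
  have hlaw : ∀ (s : Finset ℤ) (k : ℕ), s.card = k → ∀ w : ℝ,
      P.real {ω | w ≤ ∑ i ∈ s, W i ω} = P.real {ω | w ≤ partialSum W k ω} := by
    intro s k hs w
    let e := (s.equivFinOfCardEq hs).symm
    have hA : MeasurableSet {z : Fin k → ℝ | w ≤ ∑ i, z i} :=
      measurableSet_le measurable_const (Finset.measurable_sum _ fun i _ => measurable_pi_apply i)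
    have h1 := hW.real_comp_eq (f := fun i : Fin k => ((e i : s) : ℤ))
      (g := fun i : Fin k => ((i : ℕ) : ℤ) + 1)
      (fun i j h => e.injective (Subtype.ext h))
      (fun i j h => by simpa [Fin.ext_iff] using h) hA
    have e1 : ∀ ω, ∑ i ∈ s, W i ω = ∑ i, W (e i) ω := fun ω => by
      rw [← Finset.sum_coe_sort s, ← e.sum_comp]
    have e2 : ∀ ω, partialSum W k ω = ∑ i : Fin k, W (((i : ℕ) : ℤ) + 1) ω := fun ω => by
      rw [partialSum, Finset.sum_range]
    simp_rw [e1, e2]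
    exact h1
  have hI := hW.indepFun_sum hd (f := fun _ z => z) (g := fun _ z => z)
    (fun _ => measurable_id) (fun _ => measurable_id)
  have e := IndepFun.real_inter hI (s := Set.Ici u) (t := Set.Ici v) measurableSet_Ici
    measurableSet_Ici
  simp only [Set.mem_Ici] at e
  rw [← hlaw S m (by simp [S]), ← hlaw T n (by simp [T]), ← e,
    ← hlaw (S ∪ T) (m + n) (by rw [Finset.card_union_of_disjoint hd]; simp [S, T])]
  refine measureReal_mono ?_
  rintro ω ⟨h1, h2⟩
  have h1' : u ≤ ∑ i ∈ S, W i ω := h1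
  have h2' : v ≤ ∑ i ∈ T, W i ω := h2
  show u + v ≤ _
  rw [Finset.sum_union hd]
  linarith

/-- Independent blocks of length `b`: if each of the `k` block sums is at least `u`, the walk
reaches `k * u`. -/
lemma pow_le_partialSum (hW : Noise P W H) (b k : ℕ) (u : ℝ) :
    P.real {ω | u ≤ partialSum W b ω} ^ k ≤ P.real {ω | k * u ≤ partialSum W (b * k) ω} := by
  induction k with
  | zero => simp [partialSum]
  | succ k ih =>
    rw [pow_succ, mul_add b k 1, mul_one]
    push_cast
    rw [add_mul, one_mul]
    exact (mul_le_mul_of_nonneg_right ih measureReal_nonneg).trans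
      (hW.real_mul_le_partialSum _ _ _ _)

/-- The random walk is nonnegative with probability bounded away from zero. -/
lemma exists_le_nonneg (hW : Noise P W H) (hT : HeavyTail H a) (hint : Integrable (W 1) P)
    (hmean : ∫ ω, W 1 ω ∂P = 0) :
    ∃ c : ℝ, 0 < c ∧ ∀ n : ℕ, c ≤ P.real {ω | 0 ≤ partialSum W n ω} := by
  obtain ⟨c₀, hc0, h⟩ := hW.exists_le_sqrt hT hmean
  obtain ⟨n₀, hn0⟩ := eventually_atTop.1 h
  have h1 : partialSum W 1 = W 1 := by
    ext ω
    simp [partialSum]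
  -- An almost surely negative variable cannot have mean zero. For small `n` it suffices that all
  -- steps are nonnegative; for large `n` the central limit bound applies.
  have hp : 0 < P.real {ω | 0 ≤ partialSum W 1 ω} := by
    rw [h1]
    refine lt_of_le_of_ne measureReal_nonneg fun h0 => ?_
    have h2 : P {ω | 0 ≤ W 1 ω} = 0 := (measureReal_eq_zero_iff).1 h0.symm
    have h3 : ∀ᵐ ω ∂P, W 1 ω < 0 := by
      rw [ae_iff]
      simpa using h2
    have h4 : 0 < ∫ ω, -W 1 ω ∂P := by
      refine (integral_pos_iff_support_of_nonneg_ae (h3.mono fun ω hω => by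
        show (0 : ℝ) ≤ -W 1 ω
        linarith) hint.neg).2 ?_
      rw [pos_iff_ne_zero]
      intro h5
      have h6 : P Set.univ = 0 := by
        refine measure_mono_null (t := Function.support (fun ω => -W 1 ω) ∪ {ω | 0 ≤ W 1 ω})
          (fun ω _ => ?_) (measure_union_null h5 h2)
        by_cases q : W 1 ω = 0
        · exact Or.inr q.ge
        · exact Or.inl (by simpa using q)
      simp at h6
    rw [integral_neg, hmean] at h4
    linarith
  set c₁ := P.real {ω | 0 ≤ partialSum W 1 ω}
  refine ⟨min c₀ (c₁ ^ n₀), by positivity, fun n => ?_⟩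
  rcases le_or_gt n₀ n with hn | hn
  · refine (min_le_left _ _).trans ((hn0 n hn).trans (measureReal_mono fun ω hω => ?_))
    have hω' : √(n : ℝ) < partialSum W n ω := hω
    exact (Real.sqrt_nonneg _).trans hω'.le
  · refine (min_le_right _ _).trans ?_
    have := hW.pow_le_partialSum 1 n 0
    rw [mul_zero, one_mul] at this
    exact (pow_le_pow_of_le_one hp.le measureReal_le_one hn.le).trans this

end Noise

namespace LDRegime

variable {Ω : Type*} [MeasurableSpace Ω] {P : Measure Ω} [IsProbabilityMeasure P]
  {W : ℤ → Ω → ℝ} {H a : ℝ → ℝ} {l : Filter (ℕ × ℝ)} {κ : ℝ}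

/-- In the large deviation regime `y` is far beyond the Gaussian range. -/
lemma mul_neg_log_le (h : LDRegime P W H l κ) (hW : Noise P W H) (hT : HeavyTail H a)
    (hint : Integrable (W 1) P) (hmean : ∫ ω, W 1 ω ∂P = 0)
    (hLN : ∀ c : ℝ, 0 < c → Tendsto (fun x => Real.log (H (c * x)) / Real.log (H x)) atTop (𝓝 1)) :
    ∃ C : ℝ, 0 < C ∧ ∀ᶠ z in l, z.1 * -Real.log (H z.2) ≤ C * z.2 ^ 2 := by
  obtain ⟨c₀, hc0, hs⟩ := hW.exists_le_sqrt hT hmean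
  obtain ⟨n₀, hn0⟩ := eventually_atTop.1 hs
  obtain ⟨c₁, hc1, hr⟩ := hW.exists_le_nonneg hT hint hmean
  obtain ⟨z₀, hz1, -, hz3⟩ := hT.mul_neg_log_le hLN
  obtain ⟨C₄, hC4, hpoly⟩ := hT.poly 4
  obtain ⟨η, h0, h1, hb⟩ := h.bounds hT
  have hκ := h.nonneg
  set N : ℝ := n₀ + 1 with hN
  have hN1 : 1 ≤ N := by simp [hN]
  set A := 3 / 2 * -Real.log (H z₀) with hA
  have hA0 : 0 ≤ A := mul_nonneg (by norm_num) (hT.neg_log_nonneg z₀)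
  set L := Real.log ((κ + 1) ^ 2 * C₄) - 2 * Real.log c₁ with hL
  have hc01 : c₀ ≤ 1 := (hn0 n₀ le_rfl).trans measureReal_le_one
  have hl0 : 0 ≤ -Real.log c₀ := neg_nonneg.2 (Real.log_nonpos hc0.le hc01)
  refine ⟨17 * N * A + 34 * -Real.log c₀ + |L| + 1, by positivity, ?_⟩
  filter_upwards [hb 1 one_pos, h.n_le, h.tendsto_n.eventually_ge_atTop 1,
    h.tendsto_y.eventually_ge_atTop z₀] with z hup hny hn1 hy
  set n := z.1
  set y := z.2
  have hn : (1 : ℝ) ≤ n := by exact_mod_cast hn1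
  have hy1 : 1 ≤ y := hz1.trans hy
  have hQ0 := hT.neg_log_nonneg y
  have hsq : (0 : ℝ) ≤ y ^ 2 := by positivity
  -- If `n = O(y)`, the at most linear growth of `-log H` suffices. Otherwise `n` is large enough to
  -- be cut into about `y ^ 2 / n` blocks of length at least `n₀`.
  rcases le_or_gt ((n : ℝ) ^ 2) (17 * N * y ^ 2) with hsmall | hlarge
  · have h3 : -Real.log (H y) ≤ A * y := by
      have := hz3 z₀ le_rfl y hy
      nlinarith
    have h4 : (n : ℝ) ≤ 17 * N * y := by
      by_contra! hcon
      have : (17 * N * y) ^ 2 < n ^ 2 := pow_lt_pow_left₀ hcon (by positivity) two_ne_zero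
      have : 17 * N * y ^ 2 ≤ (17 * N * y) ^ 2 := by
        have h5 : 1 ≤ 17 * N := by linarith
        have : 17 * N * y ^ 2 * 1 ≤ 17 * N * y ^ 2 * (17 * N) := by gcongr
        linarith
      linarith
    calc (n : ℝ) * -Real.log (H y) ≤ (17 * N * y) * (A * y) := by gcongr
      _ = 17 * N * A * y ^ 2 := by ring
      _ ≤ _ := by
        refine mul_le_mul_of_nonneg_right ?_ hsq
        linarith [abs_nonneg L]
  · have hn' : (0 : ℝ) < n := by linarith
    -- Rounding loses at most half of the steps, so `k ^ 2 * b ≥ k * n / 2 ≥ 8 * y ^ 2`: if each of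
    -- the `k` blocks exceeds `√b`, the walk exceeds `y`. The incomplete last block is only required
    -- to be nonnegative.
    set k := ⌈16 * y ^ 2 / n⌉₊ with hk
    have hyn : 1 ≤ y ^ 2 / n := (one_le_div hn').2 hny
    have hk1 : 16 * y ^ 2 / n ≤ k := Nat.le_ceil _
    have hk2 : (k : ℝ) ≤ 17 * y ^ 2 / n := by
      have := (Nat.ceil_lt_add_one (show 0 ≤ 16 * y ^ 2 / n by positivity)).le
      rw [← hk, mul_div_assoc] at this
      rw [mul_div_assoc]
      linarith
    have hk0 : 0 < k := by
      have : (0 : ℝ) < k := lt_of_lt_of_le (by positivity) hk1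
      exact_mod_cast this
    have hk0' : (1 : ℝ) ≤ k := by exact_mod_cast hk0
    rw [div_le_iff₀ hn'] at hk1
    rw [le_div_iff₀ hn'] at hk2
    set b := n / k with hbdef
    have hNk : (n₀ + 1) * k ≤ n := by
      have : N * k * n ≤ n * n := by nlinarith
      have := le_of_mul_le_mul_right this hn'
      rw [hN] at this
      exact_mod_cast this
    have hb0 : n₀ + 1 ≤ b := (Nat.le_div_iff_mul_le hk0).2 hNk
    have hnb : b * k + n % k = n := Nat.div_add_mod' n k
    have hnb' : (n : ℝ) ≤ 2 * (b * k) := by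
      have h3 : n % k < k := Nat.mod_lt _ hk0
      have h4 : k ≤ b * k := Nat.le_mul_of_pos_left k (by omega)
      have : n ≤ 2 * (b * k) := by omega
      exact_mod_cast this
    have hgt : y < k * √(b : ℝ) := by
      refine lt_of_pow_lt_pow_left₀ 2 (by positivity) ?_
      rw [mul_pow, Real.sq_sqrt (Nat.cast_nonneg b)]
      have : (k : ℝ) * n ≤ k * (2 * (b * k)) := by gcongr
      nlinarith
    have hlow : c₀ ^ k * c₁ ≤ walkTail P W n y := by
      have h3 : c₀ ≤ P.real {ω | √(b : ℝ) ≤ partialSum W b ω} :=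
        (hn0 b (by omega)).trans (measureReal_mono fun ω hω =>
          show √(b : ℝ) ≤ _ from le_of_lt (show _ < partialSum W b ω from hω))
      have h4 := hW.pow_le_partialSum b k √(b : ℝ)
      have h5 := hW.real_mul_le_partialSum (b * k) (n % k) (k * √(b : ℝ)) 0
      rw [hnb, add_zero] at h5
      calc c₀ ^ k * c₁ ≤ _ := mul_le_mul ((pow_le_pow_left₀ hc0.le h3 k).trans h4)
            (hr (n % k)) hc1.le measureReal_nonneg
        _ ≤ _ := h5.trans (measureReal_mono fun ω hω => hgt.trans_le (by exact hω))
    have hHy := hT.pos y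
    have hupp : c₀ ^ k * c₁ ≤ (κ + 1) * (y ^ 2 * H y) := by
      refine (hlow.trans (hup y (by nlinarith)).1).trans ?_
      gcongr
    -- Squaring lets one factor `H y` absorb `y ^ 4`; the other remains, and taking logarithms
    -- bounds `-log (H y)` linearly in `k`, where `k * n ≤ 17 * y ^ 2`.
    have hsqq : (c₀ ^ k * c₁) ^ 2 ≤ (κ + 1) ^ 2 * C₄ * H y := by
      calc (c₀ ^ k * c₁) ^ 2 ≤ ((κ + 1) * (y ^ 2 * H y)) ^ 2 :=
            pow_le_pow_left₀ (by positivity) hupp 2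
        _ = (κ + 1) ^ 2 * (y ^ 4 * H y) * H y := by ring
        _ ≤ _ := by
          have := hpoly y (by linarith)
          gcongr
    have hlog := Real.log_le_log (by positivity) hsqq
    rw [Real.log_pow, Real.log_mul (by positivity) hc1.ne', Real.log_pow,
      Real.log_mul (by positivity) hHy.ne'] at hlog
    push_cast at hlog
    have hQ : -Real.log (H y) ≤ |L| + 2 * k * -Real.log c₀ := by
      have : L ≤ |L| := le_abs_self L
      linarith
    calc (n : ℝ) * -Real.log (H y) ≤ n * (|L| + 2 * k * -Real.log c₀) := by gcongr
      _ = n * |L| + 2 * -Real.log c₀ * (k * n) := by ring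
      _ ≤ y ^ 2 * |L| + 2 * -Real.log c₀ * (17 * y ^ 2) := by gcongr
      _ = (34 * -Real.log c₀ + |L|) * y ^ 2 := by ring
      _ ≤ _ := by
        have : 0 ≤ 17 * N * A := by positivity
        refine mul_le_mul_of_nonneg_right ?_ hsq
        linarith

/-- The walk can exceed `θ y` without a jump above `y` only with probability
at most a power of `H y`. -/
lemma trunc_le_exp (h : LDRegime P W H l κ) (hW : Noise P W H) (hT : HeavyTail H a)
    (hint : ∀ k, Integrable (W k) P) (hmean : ∀ k, ∫ ω, W k ω ∂P = 0)
    (hLN : ∀ c : ℝ, 0 < c → Tendsto (fun x => Real.log (H (c * x)) / Real.log (H x)) atTop (𝓝 1))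
    {θ : ℝ} (hθ : 0 < θ) : ∃ c : ℝ, 0 < c ∧ ∀ᶠ z in l, ∀ I : Finset ℤ, I.card ≤ z.1 →
      P.real {ω | θ * z.2 < ∑ i ∈ I, W i ω ∧ ∀ i ∈ I, W i ω ≤ z.2} ≤
        Real.exp (c * Real.log (H z.2)) := by
  obtain ⟨C, hC, hCl⟩ := h.mul_neg_log_le hW hT (hint 1) (hmean 1) hLN
  obtain ⟨M, hM, hMl⟩ := hW.exp_moment_le hT hLN
  -- The Chernoff parameter is `c * Q / y`. The bound `1 / 9` admits it in the moment estimate, and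
  -- the second bound makes the quadratic term at most half of the linear term `c * θ * Q`.
  set c := min (1 / 9) (θ / (2 * M * C)) with hc
  have hc0 : 0 < c := by positivity
  refine ⟨c * θ / 2, by positivity, ?_⟩
  filter_upwards [hCl, h.tendsto_y.eventually hMl, h.tendsto_y.eventually_gt_atTop 0]
    with z h1 h2 hy I hI
  set Q := -Real.log (H z.2) with hQ
  have hQ0 : 0 ≤ Q := hT.neg_log_nonneg z.2
  have hs0 : 0 ≤ c * Q / z.2 := by positivity
  have h3 := h2 (c * Q / z.2) hs0 (by
    have : c * 9 ≤ 1 := by linarith [min_le_left (1 / 9) (θ / (2 * M * C))]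
    calc c * Q / z.2 * (9 * z.2) = c * 9 * Q := by field_simp
      _ ≤ 1 * Q := by gcongr
      _ = Q := one_mul _)
  refine (hW.chernoff hint hmean hM.le hy.le hs0 h3 I (θ * z.2)).trans ?_
  refine Real.exp_le_exp.2 ?_
  have h4 : (I.card : ℝ) * Q ≤ C * z.2 ^ 2 :=
    le_trans (by gcongr) h1
  have h5 : c * (2 * M * C) ≤ θ := by
    rw [← le_div_iff₀ (by positivity)]
    exact min_le_right _ _
  have e1 : -(c * Q / z.2) * (θ * z.2) = -(c * θ * Q) := by field_simp
  have e2 : (I.card : ℝ) * ((c * Q / z.2) ^ 2 * M) = (I.card * Q) / z.2 ^ 2 * (c ^ 2 * M * Q) := by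
    field_simp
  have h6 : (I.card * Q) / z.2 ^ 2 ≤ C := (div_le_iff₀ (by positivity)).2 h4
  have h7 : (I.card * Q) / z.2 ^ 2 * (c ^ 2 * M * Q) ≤ C * (c ^ 2 * M * Q) := by gcongr
  have h8 : C * (c ^ 2 * M * Q) ≤ c * θ / 2 * Q := by
    have : c * (c * (2 * M * C)) * Q ≤ c * θ * Q := by gcongr
    nlinarith
  rw [e1, e2]
  have : Real.log (H z.2) = -Q := by rw [hQ, neg_neg]
  rw [this]
  nlinarith

end LDRegime

/-! ### Finite moving averages with weights of both signs. -/

namespace LDRegime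

variable {Ω : Type*} [MeasurableSpace Ω] {P : Measure Ω} [IsProbabilityMeasure P]
  {W : ℤ → Ω → ℝ} {H a : ℝ → ℝ} {l : Filter (ℕ × ℝ)} {κ : ℝ}

/-- Under a polynomial comparison of `H (c * y)` with `H y`, the tail is insensitive to shifts by
the square root. -/
lemma sub_sqrt_le (h : LDRegime P W H l κ) (hT : HeavyTail H a) {c : ℝ} (hc0 : 0 < c)
    (hc1 : c < 1) (hA : ∀ᶠ z in l, H (c * z.2) ≤ 1 * (z.1 * H z.2)) {ε : ℝ} (hε : 0 < ε) :
    ∀ᶠ z in l, H (z.2 - √z.2) ≤ (1 + ε) * H z.2 := by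
  have hs : 0 < Real.log (1 + ε) / 2 := by
    have := Real.log_pos (show 1 < 1 + ε by linarith)
    linarith
  set s := Real.log (1 + ε) / 2 with hsdef
  have hexp : Real.exp s < 1 + ε := by
    calc Real.exp s < Real.exp (Real.log (1 + ε)) := Real.exp_lt_exp.2 (by linarith)
      _ = 1 + ε := Real.exp_log (by linarith)
  filter_upwards [hA, h.n_le, h.tendsto_y.eventually (hT.a_large hc0 hc1 1 2),
    h.tendsto_y.eventually (hT.ratio_le hexp), h.tendsto_y.eventually_ge_atTop (1 / s ^ 4),
    h.tendsto_y.eventually_gt_atTop 0, h.tendsto_y.eventually hT.a_pos]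
    with z h1 h2 h3 h4 h5 h6 h7
  have hHy := hT.pos z.2
  -- As `n ≤ y ^ 2`, the comparison is polynomial in `y`, so `a y ≥ y ^ (3/4)`, and `√y` is
  -- eventually smaller than any fixed multiple of `a y`.
  have h8 := h3 (h1.trans (by
    rw [one_mul, one_mul]
    gcongr))
  refine (hT.anti ?_).trans h4
  have : √z.2 ≤ s * a z.2 := by
    refine le_of_pow_le_pow_left₀ (n := 4) (by norm_num) (by positivity) ?_
    rw [show (4 : ℕ) = 2 * 2 by norm_num, pow_mul, Real.sq_sqrt h6.le, mul_pow]
    rw [div_le_iff₀ (by positivity)] at h5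
    calc z.2 ^ 2 = z.2 ^ 2 * 1 := (mul_one _).symm
      _ ≤ z.2 ^ 2 * (z.2 * s ^ 4) := by gcongr
      _ = s ^ 4 * z.2 ^ 3 := by ring
      _ ≤ s ^ 4 * a z.2 ^ 4 := by gcongr
  linarith

/-- An additional large weighted summand together with the walk. -/
lemma real_add_large_le (h : LDRegime P W H l κ) (hW : Noise P W H) (hT : HeavyTail H a)
    (hint : ∀ k, Integrable (W k) P) (hmean : ∀ k, ∫ ω, W k ω ∂P = 0)
    (hLN : ∀ c : ℝ, 0 < c → Tendsto (fun x => Real.log (H (c * x)) / Real.log (H x)) atTop (𝓝 1))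
    (hH : ∀ η : ℝ, 0 < η → ∀ ε : ℝ, 0 < ε → ∀ᶠ z in l, H (η * z.2) ^ 2 ≤ ε * H z.2)
    {c D : ℝ} (hD : 0 ≤ D) (hDc : D * c < 1)
    (hA : ∀ ε : ℝ, 0 < ε → ∀ᶠ z in l, H (c * z.2) ≤ ε * (z.1 * H z.2)) (M : ℕ)
    {η : ℝ} (hη : 0 < η) {ε : ℝ} (hε : 0 < ε) :
    ∀ᶠ z in l, ∀ (I J : Finset ℤ) (d : ℤ → ℝ), Disjoint I J → I.card ≤ z.1 → J.card ≤ M →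
      (∀ j, |d j| ≤ D) →
      P.real {ω | z.2 < ∑ i ∈ I, W i ω + ∑ j ∈ J, d j * W j ω ∧
        η * z.2 < ∑ j ∈ J, d j * W j ω} ≤ ε * (z.1 * H z.2) := by
  -- If the walk and the remaining extra summands each contribute at most `θ * y`, the weighted
  -- variable must exceed `(1 - 2 * θ) * y = D * c * y`, hence its absolute value exceeds `c * y`.
  set θ := (1 - D * c) / 2 with hθ
  have hθ0 : 0 < θ := by rw [hθ]; linarith
  set τ := min η θ / ((D + 1) * (M + 1)) with hτ
  have hτ0 : 0 < τ := by positivity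
  have hτM : (D + 1) * ((M + 1) * τ) = min η θ := by rw [hτ]; field_simp
  obtain ⟨c₁, hc1, hexp⟩ := h.trunc_le_exp hW hT hint hmean hLN hθ0
  set ε' := ε / ((M + 1) * (M + 4)) with hε'
  have hε'0 : 0 < ε' := by positivity
  have hlog : Tendsto (fun z : ℕ × ℝ => Real.log (H z.2)) l atBot := by
    have := tendsto_neg_atTop_atBot.comp (hT.tendsto_neg_log.comp h.tendsto_y)
    simpa [Function.comp_def] using this
  have hlog2 : Tendsto (fun z : ℕ × ℝ => Real.exp (c₁ / 2 * Real.log (H z.2))) l (𝓝 0) :=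
    Real.tendsto_exp_atBot.comp (hlog.const_mul_atBot (by positivity))
  filter_upwards [hexp, hA ε' hε'0, hH τ hτ0 ε' hε'0,
    ((hT.tendsto_zero.comp (h.tendsto_y.const_mul_atTop hτ0)).eventually_lt_const hε'0),
    h.tendsto_y.eventually ((hLN τ hτ0).eventually_const_lt (u := 1 - c₁ / 2) (by linarith)),
    hlog2.eventually_lt_const hε'0, hlog.eventually_lt_atBot 0,
    h.tendsto_y.eventually_gt_atTop 0, h.tendsto_n.eventually_ge_atTop 1]
    with z h1 h2 h3 h4 h5 h6 h7 hy hn1 I J d hIJ hI hJ hd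
  simp only [Function.comp] at h4
  set y := z.2
  set v := τ * y with hv
  have hn : (1 : ℝ) ≤ z.1 := by exact_mod_cast hn1
  have hHy := hT.pos y
  have hHv := hT.pos v
  have hI' : (I.card : ℝ) ≤ z.1 := by exact_mod_cast hI
  have hJ' : (J.card : ℝ) ≤ M := by exact_mod_cast hJ
  have hv0 : 0 < v := by positivity
  have hm := hW.meas
  have hHle : H y ≤ z.1 * H y := le_mul_of_one_le_left hHy.le hn
  -- two large summands
  have hpair1 : ∀ j ∈ J, P.real {ω | ∃ i ∈ I, y < W i ω ∧ v < |W j ω|} ≤ ε' * (z.1 * H y) := by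
    intro j hj
    calc _ ≤ ∑ i ∈ I, P.real {ω | y < |W i ω| ∧ v < |W j ω|} := by
          refine real_le_sum I fun ω hω => ?_
          obtain ⟨i, hi, h8, h9⟩ := hω
          exact ⟨i, hi, h8.trans_le (le_abs_self _), h9⟩
      _ = ∑ i ∈ I, H y * H v := Finset.sum_congr rfl fun i hi =>
          hW.real_abs_inter (fun e : i = j => Finset.disjoint_left.1 hIJ hi (e ▸ hj)) _ _
      _ = I.card * (H y * H v) := by rw [Finset.sum_const, nsmul_eq_mul]
      _ ≤ z.1 * (H y * ε') := by gcongr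
      _ = _ := by ring
  have hpair2 : ∀ j ∈ J, P.real {ω | ∃ i ∈ J.erase j, v < |W i ω| ∧ v < |W j ω|} ≤
      M * (ε' * (z.1 * H y)) := by
    intro j hj
    calc _ ≤ ∑ i ∈ J.erase j, P.real {ω | v < |W i ω| ∧ v < |W j ω|} :=
          real_le_sum _ fun ω hω => hω
      _ = ∑ i ∈ J.erase j, H v * H v := Finset.sum_congr rfl fun i hi =>
          hW.real_abs_inter (Finset.ne_of_mem_erase hi) _ _
      _ = (J.erase j).card * (H v ^ 2) := by rw [Finset.sum_const, nsmul_eq_mul, sq]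
      _ ≤ M * (ε' * (z.1 * H y)) := by
          have : ((J.erase j).card : ℝ) ≤ M :=
            le_trans (by exact_mod_cast Finset.card_erase_le) hJ'
          have h8 : H v ^ 2 ≤ ε' * (z.1 * H y) := h3.trans (by gcongr)
          gcongr
  have hone : ∀ j ∈ J, P.real {ω | v < |W j ω| ∧ θ * y < ∑ i ∈ I, W i ω ∧ ∀ i ∈ I, W i ω ≤ y} ≤
      ε' * (z.1 * H y) := by
    intro j hj
    have hdj : Disjoint ({j} : Set ℤ) (I : Set ℤ) := by
      rw [Set.disjoint_singleton_left]
      exact fun hji => Finset.disjoint_left.1 hIJ hji hj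
    have hms : MeasurableSet[sigmaOf W (I : Set ℤ)]
        {ω | θ * y < ∑ i ∈ I, W i ω ∧ ∀ i ∈ I, W i ω ≤ y} := by
      have m1 : Measurable[sigmaOf W (I : Set ℤ)] fun ω => ∑ i ∈ I, W i ω :=
        measurable_sigmaOf_sum (f := fun _ z => z) (fun _ h => h) (fun _ => measurable_id)
      have : {ω | ∀ i ∈ I, W i ω ≤ y} = ⋂ i ∈ I, {ω | W i ω ≤ y} := by
        ext; simp
      refine MeasurableSet.inter (s₁ := {ω | θ * y < ∑ i ∈ I, W i ω})
        (m1 measurableSet_Ioi) (s₂ := {ω | ∀ i ∈ I, W i ω ≤ y}) ?_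
      rw [this]
      exact Finset.measurableSet_biInter _ fun i hi =>
        measurable_sigmaOf (W := W) (S := I) (by exact hi) measurableSet_Iic
    have hms1 : MeasurableSet[sigmaOf W ({j} : Set ℤ)] {ω | v < |W j ω|} := by
      have m1 : Measurable[sigmaOf W ({j} : Set ℤ)] (W j) := measurable_sigmaOf rfl
      have m2 : MeasurableSet {x : ℝ | v < |x|} :=
        measurableSet_lt measurable_const (by fun_prop)
      exact m1 m2
    have e := hW.real_inter hdj hms1 hms
    calc _ = H v * P.real {ω | θ * y < ∑ i ∈ I, W i ω ∧ ∀ i ∈ I, W i ω ≤ y} := by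
          rw [← hW.tail j v, ← e]
          rfl
      _ ≤ H v * Real.exp (c₁ * Real.log (H y)) := by
          have := h1 I hI
          gcongr
      -- Slow variation of `-log H` gives `H v ≤ H y ^ (1 - c₁ / 2)`; together with `H y ^ c₁` from
      -- the truncated walk this leaves `H y` times a vanishing factor.
      _ ≤ H y * Real.exp (c₁ / 2 * Real.log (H y)) := by
          have e1 : H v = Real.exp (Real.log (H v)) := (Real.exp_log hHv).symm
          have e2 : H y = Real.exp (Real.log (H y)) := (Real.exp_log hHy).symm
          rw [lt_div_iff_of_neg h7] at h5
          calc _ = Real.exp (Real.log (H v) + c₁ * Real.log (H y)) := by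
                rw [Real.exp_add, ← e1]
            _ ≤ Real.exp (Real.log (H y) + c₁ / 2 * Real.log (H y)) :=
                Real.exp_le_exp.2 (by linarith)
            _ = _ := by rw [Real.exp_add, ← e2]
      _ ≤ (z.1 * H y) * ε' := by gcongr
      _ = _ := by ring
  have hbigJ : ∀ j ∈ J, P.real {ω | c * y < |W j ω|} ≤ ε' * (z.1 * H y) := by
    intro j _
    rw [hW.tail]
    exact h2
  have hunion : P.real {ω | y < ∑ i ∈ I, W i ω + ∑ j ∈ J, d j * W j ω ∧
      η * y < ∑ j ∈ J, d j * W j ω} ≤ ∑ j ∈ J, P.real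
        (({ω | ∃ i ∈ I, y < W i ω ∧ v < |W j ω|} ∪ {ω | ∃ i ∈ J.erase j, v < |W i ω| ∧ v < |W j ω|})
        ∪ ({ω | v < |W j ω| ∧ θ * y < ∑ i ∈ I, W i ω ∧ ∀ i ∈ I, W i ω ≤ y} ∪
          {ω | c * y < |W j ω|})) := by
    -- Some `j ∈ J` is large. Then the walk has a jump above `y`, or a second variable of `J` is
    -- large, or the walk exceeds `θ * y` without such a jump, or `W j` alone exceeds `c * y` in
    -- absolute value.
    refine real_le_sum J fun ω hω => ?_
    obtain ⟨h8, h9⟩ : y < ∑ i ∈ I, W i ω + ∑ j ∈ J, d j * W j ω ∧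
      η * y < ∑ j ∈ J, d j * W j ω := hω
    have hmin1 : min η θ * y ≤ η * y := by gcongr; exact min_le_left _ _
    have hmin2 : min η θ * y ≤ θ * y := by gcongr; exact min_le_right _ _
    have hDv : ∀ s : Finset ℤ, s.card ≤ M → (∀ i ∈ s, |W i ω| ≤ v) →
        ∑ i ∈ s, d i * W i ω ≤ min η θ * y := by
      intro s hs h10
      calc ∑ i ∈ s, d i * W i ω ≤ ∑ i ∈ s, D * v := by
            refine Finset.sum_le_sum fun i hi => (le_abs_self _).trans ?_
            rw [abs_mul]
            exact mul_le_mul (hd i) (h10 i hi) (abs_nonneg _) hD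
        _ = s.card * (D * v) := by rw [Finset.sum_const, nsmul_eq_mul]
        _ ≤ (M + 1) * ((D + 1) * v) := by
            have : (s.card : ℝ) ≤ M := by exact_mod_cast hs
            gcongr <;> linarith
        _ = ((D + 1) * ((M + 1) * τ)) * y := by rw [hv]; ring
        _ = _ := by rw [hτM]
    obtain ⟨j, hj, hjv⟩ : ∃ j ∈ J, v < |W j ω| := by
      by_contra! hcon
      linarith [hDv J hJ hcon]
    refine ⟨j, hj, ?_⟩
    by_cases q1 : ∃ i ∈ I, y < W i ω
    · obtain ⟨i, hi, hiy⟩ := q1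
      exact Or.inl (Or.inl ⟨i, hi, hiy, hjv⟩)
    by_cases q2 : ∃ i ∈ J.erase j, v < |W i ω|
    · obtain ⟨i, hi, hiy⟩ := q2
      exact Or.inl (Or.inr ⟨i, hi, hiy, hjv⟩)
    push Not at q1 q2
    by_cases q3 : θ * y < ∑ i ∈ I, W i ω
    · exact Or.inr (Or.inl ⟨hjv, q3, q1⟩)
    · refine Or.inr (Or.inr ?_)
      push Not at q3
      have h10 := hDv (J.erase j) (Finset.card_erase_le.trans hJ) q2
      rw [← Finset.add_sum_erase _ _ hj] at h8
      have h11 : d j * W j ω ≤ D * |W j ω| := by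
        refine (le_abs_self _).trans ?_
        rw [abs_mul]
        gcongr
        exact hd j
      have h12 : D * (c * y) < D * |W j ω| := by
        have : D * c = 1 - 2 * θ := by rw [hθ]; ring
        have : D * (c * y) = y - 2 * (θ * y) := by rw [← mul_assoc, this]; ring
        linarith
      exact lt_of_mul_lt_mul_left h12 hD
  calc _ ≤ _ := hunion
    _ ≤ ∑ j ∈ J, (M + 3) * (ε' * (z.1 * H y)) := by
        refine Finset.sum_le_sum fun j hj => ?_
        refine (measureReal_union_le _ _).trans ?_
        have h8 := (measureReal_union_le {ω | ∃ i ∈ I, y < W i ω ∧ v < |W j ω|}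
          {ω | ∃ i ∈ J.erase j, v < |W i ω| ∧ v < |W j ω|} (μ := P)).trans
            (add_le_add (hpair1 j hj) (hpair2 j hj))
        have h9 := (measureReal_union_le
          {ω | v < |W j ω| ∧ θ * y < ∑ i ∈ I, W i ω ∧ ∀ i ∈ I, W i ω ≤ y}
          {ω | c * y < |W j ω|} (μ := P)).trans (add_le_add (hone j hj) (hbigJ j hj))
        refine (add_le_add h8 h9).trans_eq (by ring)
    _ = J.card * ((M + 3) * (ε' * (z.1 * H y))) := by rw [Finset.sum_const, nsmul_eq_mul]
    _ ≤ (M + 1) * ((M + 4) * (ε' * (z.1 * H y))) := by gcongr <;> linarith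
    _ = ε * (z.1 * H y) := by rw [hε']; field_simp

/-- Finite moving averages with weights of arbitrary sign. -/
lemma tendsto_add_of_LN (h : LDRegime P W H l κ) (hW : Noise P W H) (hT : HeavyTail H a)
    (hint : ∀ k, Integrable (W k) P) (hmean : ∀ k, ∫ ω, W k ω ∂P = 0)
    (hLN : ∀ c : ℝ, 0 < c → Tendsto (fun x => Real.log (H (c * x)) / Real.log (H x)) atTop (𝓝 1))
    (hH : ∀ η : ℝ, 0 < η → ∀ ε : ℝ, 0 < ε → ∀ᶠ z in l, H (η * z.2) ^ 2 ≤ ε * H z.2)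
    {c D : ℝ} (hc0 : 0 < c) (hc1 : c < 1) (hDc : D * c < 1)
    (hA : ∀ ε : ℝ, 0 < ε → ∀ᶠ z in l, H (c * z.2) ≤ ε * (z.1 * H z.2))
    {m : ℕ} (hm : 1 ≤ m) (J : ℕ → Finset ℤ) (d : ℕ → ℤ → ℝ) {M : ℕ}
    (hJ : ∀ n : ℕ, Disjoint (Finset.Icc (1 : ℤ) (n - m)) (J n)) (hJM : ∀ n, (J n).card ≤ M)
    (hd : ∀ n j, |d n j| ≤ D) :
    Tendsto (fun z => P.real {ω | z.2 < ∑ i ∈ Finset.Icc (1 : ℤ) (z.1 - m), W i ω +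
        ∑ j ∈ J z.1, d z.1 j * W j ω} / (z.1 * H z.2)) l (𝓝 κ) := by
  have hD : 0 ≤ D := (abs_nonneg _).trans (hd 0 0)
  refine h.tendsto_add hW hT hH hm J d (D := D) hJ hJM hd fun ε hε => ?_
  refine ⟨fun y => √y, h.sub_sqrt_le hT hc0 hc1 (hA 1 one_pos) hε, fun η hη => ?_, ?_⟩
  · filter_upwards [h.tendsto_y.eventually_ge_atTop (1 / η ^ 2),
      h.tendsto_y.eventually_gt_atTop 0] with z h1 h2
    rw [div_le_iff₀ (by positivity)] at h1
    refine Real.sqrt_le_iff.2 ⟨by positivity, ?_⟩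
    calc z.2 = z.2 * 1 := (mul_one _).symm
      _ ≤ z.2 * (z.2 * η ^ 2) := by gcongr
      _ = _ := by ring
  · obtain ⟨η₁, h0, h1, B, hB, hsum⟩ := h.sum_le hW hT m
    obtain ⟨C, hC, hCs⟩ := hW.real_abs_sum_le hT M
    set η := min η₁ (1 - c) with hη
    have hη0 : 0 < η := lt_min h0 (by linarith)
    have hD1 : 0 < D + 1 := by linarith
    have hlim : Tendsto (fun z : ℕ × ℝ => B * C * (D + 1) ^ 4 *
        ((√z.2 / (D + 1)) ^ 4 * H (√z.2 / (D + 1)))) l (𝓝 0) := by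
      have := (((hT.poly_tendsto 4).comp ((Real.tendsto_sqrt_atTop.comp h.tendsto_y).atTop_div_const
        hD1)).const_mul (B * C * (D + 1) ^ 4))
      simpa [Function.comp_def] using this
    filter_upwards [h.real_add_large_le hW hT hint hmean hLN hH hD hDc hA M hη0 (half_pos hε),
      hsum, h.n_le, hA 1 one_pos, hlim.eventually_lt_const (half_pos hε),
      h.tendsto_y.eventually_gt_atTop 0, h.tendsto_n.eventually_ge_atTop (m + 1)]
      with z h2 h3 h4 h5 h6 hy hn
    set I := Finset.Icc (1 : ℤ) (z.1 - m)
    have hHy := hT.pos z.2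
    have hIc : I.card ≤ z.1 ∧ z.1 ≤ I.card + m := by
      simp only [I, Int.card_Icc]
      omega
    -- Moderate contributions: the walk bound loses at most a second factor `n ≤ y ^ 2`, compensated
    -- by the independent event of exceeding `√y`, as `H` decays faster than any power.
    have hmod : P.real {ω | (1 - η) * z.2 < ∑ i ∈ I, W i ω ∧ √z.2 < ∑ j ∈ J z.1, d z.1 j * W j ω} ≤
        ε / 2 * (z.1 * H z.2) := by
      have hI := hW.indepFun_sum (hJ z.1) (f := fun _ z => z) (g := fun j x => d z.1 j * x)
        (fun _ => measurable_id) (fun _ => by fun_prop)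
      have e := IndepFun.real_inter hI (s := Set.Ioi ((1 - η) * z.2)) (t := Set.Ioi √z.2)
        measurableSet_Ioi measurableSet_Ioi
      simp only [Set.mem_Ioi] at e
      rw [e]
      have h7 : P.real {ω | (1 - η) * z.2 < ∑ i ∈ I, W i ω} ≤ B * (z.1 * (z.1 * H z.2)) := by
        refine (h3 _ ?_ I hIc.1 hIc.2).trans ?_
        · gcongr
          exact min_le_left _ _
        · gcongr
          rw [one_mul] at h5
          refine (hT.anti ?_).trans h5
          gcongr
          have := min_le_right η₁ (1 - c)
          linarith
      have h8 : P.real {ω | √z.2 < ∑ j ∈ J z.1, d z.1 j * W j ω} ≤ C * H (√z.2 / (D + 1)) := by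
        refine le_trans (measureReal_mono fun ω hω => ?_) (hCs (J z.1) (hJM _) _)
        have hω' : √z.2 < ∑ j ∈ J z.1, d z.1 j * W j ω := hω
        show √z.2 / (D + 1) < ∑ j ∈ J z.1, |W j ω|
        rw [div_lt_iff₀ hD1, Finset.sum_mul]
        refine hω'.trans_le (Finset.sum_le_sum fun j _ => (le_abs_self _).trans ?_)
        rw [abs_mul, mul_comm]
        gcongr
        linarith [hd z.1 j]
      have hHs := hT.pos (√z.2 / (D + 1))
      have e2 : (D + 1) ^ 4 * (√z.2 / (D + 1)) ^ 4 = z.2 ^ 2 := by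
        rw [div_pow, mul_div_cancel₀ _ (by positivity), show (4 : ℕ) = 2 * 2 by norm_num, pow_mul,
          Real.sq_sqrt hy.le]
      calc _ ≤ B * (z.1 * (z.1 * H z.2)) * (C * H (√z.2 / (D + 1))) :=
            mul_le_mul h7 h8 measureReal_nonneg (by positivity)
        _ = (B * C * H (√z.2 / (D + 1)) * z.1) * (z.1 * H z.2) := by ring
        _ ≤ (B * C * H (√z.2 / (D + 1)) * z.2 ^ 2) * (z.1 * H z.2) := by gcongr
        _ = (B * C * (D + 1) ^ 4 * ((√z.2 / (D + 1)) ^ 4 * H (√z.2 / (D + 1)))) *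
            (z.1 * H z.2) := by rw [← e2]; ring
        _ ≤ _ := by gcongr
    calc _ ≤ _ := real_le_add (P := P) (t := {ω | (1 - η) * z.2 < ∑ i ∈ I, W i ω ∧
            √z.2 < ∑ j ∈ J z.1, d z.1 j * W j ω})
          (u := {ω | z.2 < ∑ i ∈ I, W i ω + ∑ j ∈ J z.1, d z.1 j * W j ω ∧
            η * z.2 < ∑ j ∈ J z.1, d z.1 j * W j ω}) fun ω hω => by
            simp only [Set.mem_ofPred_eq] at hω ⊢
            by_cases q : η * z.2 < ∑ j ∈ J z.1, d z.1 j * W j ω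
            · exact Or.inr ⟨hω.1, q⟩
            · refine Or.inl ⟨?_, hω.2⟩
              linarith [hω.1]
      _ ≤ ε / 2 * (z.1 * H z.2) + ε / 2 * (z.1 * H z.2) :=
          add_le_add hmod (h2 I (J z.1) (d z.1) (hJ _) hIc.1 (hJM _) (hd _))
      _ = _ := by ring

end LDRegime

/-! ### Noise weights in the partial sums of a linear process. -/

/-- The weight of the `k`-th noise variable in the variable with index `t` of a causal linear
process with coefficients `f`. -/
def pastWeight (f : ℕ → ℝ) (t k : ℤ) : ℝ := if k ≤ t then f (t - k).toNat else 0

section Weights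

variable {f : ℕ → ℝ}

lemma hasSum_pastWeight_mul {t : ℤ} {x : ℤ → ℝ} {v : ℝ}
    (h : HasSum (fun j : ℕ => f j * x (t - j)) v) : HasSum (fun k => pastWeight f t k * x k) v := by
  have hinj : Function.Injective (fun j : ℕ => t - (j : ℤ)) := fun i j hij => by
    simp only [sub_right_inj] at hij
    exact_mod_cast hij
  refine (hinj.hasSum_iff fun k hk => ?_).1 ?_
  · have : ¬ k ≤ t := fun hle => hk ⟨(t - k).toNat, by
      simp only
      omega⟩
    rw [pastWeight, if_neg this, zero_mul]
  · convert h using 2 with j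
    simp [pastWeight]

lemma hasSum_pastWeight (hf : Summable f) (t : ℤ) : HasSum (pastWeight f t) (∑' j, f j) := by
  have := hasSum_pastWeight_mul (t := t) (x := fun _ => 1) (f := f) (v := ∑' j, f j)
    (by simpa using hf.hasSum)
  simpa using this

lemma hasSum_pastWeight_left (hf : Summable f) (k : ℤ) :
    HasSum (fun t => pastWeight f t k) (∑' j, f j) := by
  have hinj : Function.Injective (fun j : ℕ => k + (j : ℤ)) := fun i j hij => by
    simp only [add_right_inj] at hij
    exact_mod_cast hij
  refine (hinj.hasSum_iff fun t ht => ?_).1 ?_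
  · have : ¬ k ≤ t := fun hle => ht ⟨(t - k).toNat, by
      simp only
      omega⟩
    rw [pastWeight, if_neg this]
  · convert hf.hasSum using 1
    ext j
    simp [pastWeight]

lemma pastWeight_nonneg (hf : ∀ i, 0 ≤ f i) (t k : ℤ) : 0 ≤ pastWeight f t k := by
  rw [pastWeight]
  split_ifs
  exacts [hf _, le_rfl]

lemma sum_pastWeight_left_le (hf : Summable f) (h0 : ∀ i, 0 ≤ f i) (s : Finset ℤ) (k : ℤ) :
    ∑ t ∈ s, pastWeight f t k ≤ ∑' j, f j :=
  sum_le_hasSum s (fun t _ => pastWeight_nonneg h0 t k) (hasSum_pastWeight_left hf k)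

/-- The weight of the `k`-th noise variable in the sum of the first `n` variables of a causal
linear process. -/
def totalWeight (f : ℕ → ℝ) (n : ℕ) (k : ℤ) : ℝ := ∑ t ∈ Finset.Icc (1 : ℤ) n, pastWeight f t k

/-- The weights `b 0, b 1, …` laid out to the left of `0` and of `n`. -/
def twoSided (b : ℕ → ℝ) (n : ℕ) (k : ℤ) : ℝ :=
  if 1 ≤ k then pastWeight b n k else pastWeight b 0 k

lemma twoSided_nonneg (hf : ∀ i, 0 ≤ f i) (n : ℕ) (k : ℤ) : 0 ≤ twoSided f n k := by
  rw [twoSided]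
  split_ifs <;> exact pastWeight_nonneg hf _ _

/-- A nonzero entry comes from an index `i` that does not depend on the sequence laid out;
inequalities between two sequences thus transfer entry by entry. -/
lemma twoSided_eq (f : ℕ → ℝ) (n : ℕ) (k : ℤ) :
    twoSided f n k = 0 ∧ (n : ℤ) < k ∨ ∃ i, (∀ g : ℕ → ℝ, twoSided g n k = g i) := by
  by_cases h1 : 1 ≤ k
  · by_cases h2 : k ≤ n
    · exact Or.inr ⟨_, fun g => by rw [twoSided, if_pos h1, pastWeight, if_pos h2]⟩
    · exact Or.inl ⟨by rw [twoSided, if_pos h1, pastWeight, if_neg h2], by omega⟩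
  · exact Or.inr ⟨_, fun g => by rw [twoSided, if_neg h1, pastWeight, if_pos (by omega)]⟩

lemma twoSided_le_add (hf : ∀ i, 0 ≤ f i) (n : ℕ) (k : ℤ) :
    twoSided f n k ≤ pastWeight f n k + pastWeight f 0 k := by
  have h1 := pastWeight_nonneg hf n k
  have h2 := pastWeight_nonneg hf 0 k
  rw [twoSided]
  split_ifs <;> linarith

lemma summable_twoSided (hf : Summable f) (h0 : ∀ i, 0 ≤ f i) (n : ℕ) : Summable (twoSided f n) :=
  Summable.of_nonneg_of_le (twoSided_nonneg h0 n) (twoSided_le_add h0 n)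
    ((hasSum_pastWeight hf n).add (hasSum_pastWeight hf 0)).summable

lemma tsum_twoSided_le (hf : Summable f) (h0 : ∀ i, 0 ≤ f i) (n : ℕ) :
    ∑' k, twoSided f n k ≤ 2 * ∑' j, f j := by
  rw [two_mul]
  exact hasSum_le (twoSided_le_add h0 n) (summable_twoSided hf h0 n).hasSum
    ((hasSum_pastWeight hf n).add (hasSum_pastWeight hf 0))

end Weights

lemma partialSum_eq_sum_Icc {Ω : Type*} (Y : ℤ → Ω → ℝ) (n : ℕ) (ω : Ω) :
    partialSum Y n ω = ∑ t ∈ Finset.Icc (1 : ℤ) n, Y t ω := by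
  rw [partialSum]
  refine Finset.sum_bij (fun i _ => (i : ℤ) + 1) (fun i hi => ?_) (fun i _ j _ h => by simpa using h)
    (fun t ht => ⟨(t - 1).toNat, ?_, ?_⟩) (fun _ _ => rfl)
  · simp only [Finset.mem_range, Finset.mem_Icc] at hi ⊢
    omega
  · simp only [Finset.mem_range, Finset.mem_Icc] at ht ⊢
    omega
  · simp only [Finset.mem_Icc] at ht
    omega

lemma hasSum_totalWeight {Ω : Type*} {ψ : ℕ → ℝ} {W X : ℤ → Ω → ℝ} {ω : Ω} {n : ℕ}
    (h : ∀ t : ℤ, HasSum (fun j : ℕ => ψ j * W (t - (j : ℤ)) ω) (X t ω)) :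
    HasSum (fun k => totalWeight ψ n k * W k ω) (partialSum X n ω) := by
  rw [partialSum_eq_sum_Icc]
  simp_rw [totalWeight, Finset.sum_mul]
  exact hasSum_sum fun t _ => hasSum_pastWeight_mul (x := fun k => W k ω) (h t)

/-- The tails `∑_{j > i} |ψ j|`. -/
def tailSum (ψ : ℕ → ℝ) (i : ℕ) : ℝ := ∑' j : ℕ, |ψ (i + 1 + j)|

section TailSum

variable {ψ : ℕ → ℝ}

lemma tailSum_nonneg (ψ : ℕ → ℝ) (i : ℕ) : 0 ≤ tailSum ψ i := tsum_nonneg fun _ => abs_nonneg _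

lemma summable_shift (h : Summable fun j => |ψ j|) (i : ℕ) : Summable fun j => |ψ (i + 1 + j)| := by
  have := (summable_nat_add_iff (i + 1)).2 h
  simpa [add_comm] using this

/-- The weights of the noise in a linear process are close to those of a multiple of the noise. -/
lemma abs_totalWeight_sub_le (h : Summable fun j => |ψ j|) (n : ℕ) (k : ℤ) :
    |totalWeight ψ n k - if k ∈ Finset.Icc (1 : ℤ) n then m0 ψ else 0| ≤
      twoSided (tailSum ψ) n k := by
  have habs : ∀ t, |pastWeight ψ t k| = pastWeight (fun j => |ψ j|) t k := fun t => by
    rw [pastWeight, pastWeight]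
    split_ifs <;> simp
  by_cases hk1 : 1 ≤ k
  · by_cases hkn : k ≤ n
    · rw [if_pos (by simp [hk1, hkn]), twoSided, if_pos hk1, pastWeight, if_pos hkn, abs_sub_comm]
      -- Inside the block only the variables with index `t > n` are missing from the full sum `m0
      -- ψ`; they carry coefficients of index greater than `n - k`.
      set i := ((n : ℤ) - k).toNat with hi
      have h1 : HasSum (fun t => if t ∈ Finset.Icc (1 : ℤ) n then pastWeight ψ t k else 0)
          (totalWeight ψ n k) := by
        have := hasSum_sum_of_ne_finset_zero (s := Finset.Icc (1 : ℤ) n)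
          (f := fun t => if t ∈ Finset.Icc (1 : ℤ) n then pastWeight ψ t k else 0)
          (L := SummationFilter.unconditional ℤ) (fun t ht => if_neg ht)
        rwa [Finset.sum_congr rfl fun t ht => if_pos ht] at this
      have h2 := (hasSum_pastWeight_left h.of_abs k).sub h1
      refine h2.norm_le_of_bounded (hasSum_pastWeight_left (summable_shift h i) (n + 1)) fun t => ?_
      rw [Real.norm_eq_abs]
      by_cases ht : t ∈ Finset.Icc (1 : ℤ) n
      · rw [if_pos ht, sub_self, abs_zero]
        exact pastWeight_nonneg (fun _ => abs_nonneg _) _ _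
      · rw [if_neg ht, sub_zero, habs]
        simp only [Finset.mem_Icc, not_and] at ht
        rw [pastWeight, pastWeight]
        by_cases hkt : k ≤ t
        · have := ht (hk1.trans hkt)
          rw [if_pos hkt, if_pos (by omega)]
          refine (congrArg (fun j => |ψ j|) ?_).le
          omega
        · rw [if_neg hkt]
          split_ifs
          exacts [abs_nonneg _, le_rfl]
    · rw [if_neg (by simp [hkn]), twoSided, if_pos hk1, pastWeight, if_neg hkn, sub_zero,
        totalWeight, Finset.sum_eq_zero, abs_zero]
      intro t ht
      rw [Finset.mem_Icc] at ht
      rw [pastWeight, if_neg (by omega)]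
  · rw [if_neg (by simp [hk1]), twoSided, if_neg hk1, pastWeight, if_pos (by omega), sub_zero]
    -- Before the block no multiple of the noise is subtracted, and the coefficients that occur have
    -- index `t - k ≥ i + 1`.
    set i := (0 - k).toNat with hi
    refine (Finset.abs_sum_le_sum_abs _ _).trans ?_
    refine le_trans (Finset.sum_le_sum fun t ht => ?_)
      (sum_pastWeight_left_le (summable_shift h i) (fun _ => abs_nonneg _) (Finset.Icc (1 : ℤ) n) 1)
    rw [habs, pastWeight, pastWeight]
    rw [Finset.mem_Icc] at ht
    rw [if_pos (by omega), if_pos ht.1]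
    refine (congrArg (fun j => |ψ j|) ?_).le
    omega

/-- The partial sums of a linear process are close to those of a multiple of the noise. -/
lemma abs_partialSum_sub_le {Ω : Type*} {W X : ℤ → Ω → ℝ} {ω : Ω} {n : ℕ}
    (hψ : Summable fun j => |ψ j|)
    (h : ∀ t : ℤ, HasSum (fun j : ℕ => ψ j * W (t - (j : ℤ)) ω) (X t ω))
    (hs : Summable fun k => twoSided (tailSum ψ) n k * |W k ω|) :
    |partialSum X n ω - m0 ψ * ∑ i ∈ Finset.Icc (1 : ℤ) n, W i ω| ≤
      ∑' k, twoSided (tailSum ψ) n k * |W k ω| := by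
  have h1 : HasSum (fun k => (if k ∈ Finset.Icc (1 : ℤ) n then m0 ψ else 0) * W k ω)
      (m0 ψ * ∑ i ∈ Finset.Icc (1 : ℤ) n, W i ω) := by
    have := hasSum_sum_of_ne_finset_zero (s := Finset.Icc (1 : ℤ) n)
      (f := fun k => (if k ∈ Finset.Icc (1 : ℤ) n then m0 ψ else 0) * W k ω)
      (L := SummationFilter.unconditional ℤ) (fun t ht => by rw [if_neg ht, zero_mul])
    rwa [Finset.sum_congr rfl fun t ht => by rw [if_pos ht], ← Finset.mul_sum] at this
  refine ((hasSum_totalWeight h).sub h1).norm_le_of_bounded hs.hasSum fun k => ?_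
  rw [← sub_mul, Real.norm_eq_abs, abs_mul]
  exact mul_le_mul_of_nonneg_right (abs_totalWeight_sub_le hψ n k) (abs_nonneg _)

/-- A total weight is a sum of some of the coefficients, hence lies between minus the sum of the
negative parts and the sum of the positive parts. For `m0 ψ < m0' ψ` these bounds are strictly
inside `m0' ψ`, which leaves room for the walk. -/
lemma totalWeight_bounds (h : Summable fun j => |ψ j|) (n : ℕ) (k : ℤ) :
    -((m0' ψ - m0 ψ) / 2) ≤ totalWeight ψ n k ∧ totalWeight ψ n k ≤ (m0' ψ + m0 ψ) / 2 := by
  have key : ∀ φ : ℕ → ℝ, (Summable fun j => |φ j|) →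
      totalWeight φ n k ≤ (∑' j, |φ j| + ∑' j, φ j) / 2 := by
    intro φ hφ
    have h1 : Summable fun j => (|φ j| + φ j) / 2 := (hφ.add hφ.of_abs).div_const 2
    have h2 := sum_pastWeight_left_le h1 (fun j => by linarith [neg_abs_le (φ j)])
      (Finset.Icc (1 : ℤ) n) k
    rw [tsum_div_const, hφ.tsum_add hφ.of_abs] at h2
    refine le_trans (Finset.sum_le_sum fun t _ => ?_) h2
    rw [pastWeight, pastWeight]
    split_ifs
    · linarith [le_abs_self (φ (t - k).toNat)]
    · exact le_rfl
  refine ⟨?_, key ψ h⟩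
  have h1 := key (fun j => -ψ j) (by simpa using h)
  have h2 : totalWeight (fun j => -ψ j) n k = -totalWeight ψ n k := by
    rw [totalWeight, totalWeight, ← Finset.sum_neg_distrib]
    refine Finset.sum_congr rfl fun t _ => ?_
    rw [pastWeight, pastWeight]
    split_ifs <;> simp
  simp only [abs_neg, tsum_neg] at h1
  rw [h2] at h1
  have : m0' ψ = ∑' j, |ψ j| := rfl
  have : m0 ψ = ∑' j, ψ j := rfl
  linarith

end TailSum

/-! ### Splitting a threshold among infinitely many summands. -/

/-- A summable sequence of weights `b` together with a sequence of proportions `s`, in which a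
threshold is split among the summands. -/
structure SplitWeights (b s : ℕ → ℝ) : Prop where
  nonneg : ∀ i, 0 ≤ b i
  split_nonneg : ∀ i, 0 ≤ s i
  summable : Summable b
  split_summable : Summable s
  tsum_le : ∑' i, s i ≤ 1 / 2
  le_split : ∃ c : ℝ, 0 < c ∧ ∀ i, c * b i ≤ s i
  -- With a Potter bound of order `p`, this bounds the probability that a term exceeds its share by
  -- a multiple of the share, so that the union bound is summable.
  pow_le : ∃ (p : ℕ) (C : ℝ), 0 < C ∧ ∀ i, b i ^ p ≤ C * s i ^ (p + 1)

lemma SplitWeights.of_rpow {b : ℕ → ℝ} (hb : ∀ i, 0 ≤ b i) {δ : ℝ} (h0 : 0 < δ) (h1 : δ < 1)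
    (h : Summable fun i => b i ^ δ) : ∃ s, SplitWeights b s := by
  set T := ∑' i, b i ^ δ with hT
  have hu : ∀ i, 0 ≤ b i ^ δ := fun i => Real.rpow_nonneg (hb i) _
  have hT0 : 0 ≤ T := tsum_nonneg hu
  have huT : ∀ i, b i ^ δ ≤ T := fun i => h.le_tsum i fun j _ => hu j
  set c₀ := 2 * T + 1 with hc0
  have hc : 0 < c₀ := by positivity
  have key : ∀ x : ℝ, 1 ≤ x → ∀ y : ℝ, 0 < y → y ≤ x → ∀ i,
      (b i ^ δ) ^ x ≤ (T + 1) ^ (x - y) * (b i ^ δ) ^ y := by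
    intro x hx y hy hyx i
    rw [show (b i ^ δ) ^ x = (b i ^ δ) ^ (x - y) * (b i ^ δ) ^ y by
      rw [← Real.rpow_add_of_nonneg (hu i) (by linarith) hy.le]
      congr 1
      ring]
    refine mul_le_mul_of_nonneg_right ?_ (Real.rpow_nonneg (hu i) _)
    exact Real.rpow_le_rpow (hu i) (by linarith [huT i]) (by linarith)
  have hb1 : ∀ i, b i = (b i ^ δ) ^ (1 / δ) := fun i => by
    rw [← Real.rpow_mul (hb i), mul_one_div, div_self h0.ne', Real.rpow_one]
  have hδ1 : 1 ≤ 1 / δ := by rw [le_div_iff₀ h0]; linarith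
  have hle : ∀ i, b i ≤ (T + 1) ^ (1 / δ - 1) * b i ^ δ := fun i => by
    have := key (1 / δ) hδ1 1 one_pos hδ1 i
    rwa [← hb1, Real.rpow_one] at this
  have hK : 0 < (T + 1) ^ (1 / δ - 1) := by positivity
  -- The shares are proportional to `b i ^ δ`; the normalisation `c₀ = 2 * T + 1` keeps their sum
  -- below `1 / 2`, because two copies of the sequence are used.
  refine ⟨fun i => b i ^ δ / c₀, hb, fun i => by have := hu i; positivity, ?_, h.div_const _, ?_,
    ⟨1 / (c₀ * (T + 1) ^ (1 / δ - 1)), by positivity, fun i => ?_⟩, ?_⟩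
  · exact Summable.of_nonneg_of_le hb hle (h.mul_left _)
  · rw [tsum_div_const, div_le_iff₀ hc]
    linarith
  · rw [one_div_mul_eq_div, div_le_div_iff₀ (by positivity) hc]
    have := mul_le_mul_of_nonneg_right (hle i) hc.le
    linarith
  -- This choice gives `p / δ ≥ p + 1`, so `b ^ p` is dominated by `(b ^ δ) ^ (p + 1)`; it is
  -- available because `δ < 1`.
  · obtain ⟨p, hp⟩ := exists_nat_ge (δ / (1 - δ))
    rw [div_le_iff₀ (by linarith)] at hp
    have hp1 : ((p : ℝ) + 1) ≤ p / δ := by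
      rw [le_div_iff₀ h0]
      linarith
    refine ⟨p, (T + 1) ^ (p / δ - (p + 1)) * c₀ ^ (p + 1), by positivity, fun i => ?_⟩
    have := key (p / δ) (by have : (0 : ℝ) ≤ p := Nat.cast_nonneg p
                            linarith) (p + 1) (by positivity) hp1 i
    have e1 : (b i ^ δ) ^ ((p : ℝ) / δ) = b i ^ p := by
      rw [← Real.rpow_mul (hb i), mul_div_cancel₀ _ h0.ne', Real.rpow_natCast]
    have e2 : (b i ^ δ) ^ ((p : ℝ) + 1) = (b i ^ δ) ^ (p + 1) := by
      rw [← Real.rpow_natCast]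
      push_cast
      rfl
    rw [e1, e2] at this
    refine this.trans_eq ?_
    rw [div_pow]
    field_simp

section Countable

variable {Ω : Type*} [MeasurableSpace Ω] {P : Measure Ω} [IsProbabilityMeasure P]

lemma real_le_of_tsum {s : ℤ → ℝ} (hs : Summable s) (h0 : ∀ k, 0 ≤ s k) (h1 : ∑' k, s k ≤ 1) {A : ℝ}
    (hA : 0 ≤ A) {t : Set Ω} {u : ℤ → Set Ω} (ht : ∀ ω ∈ t, ∃ k, ω ∈ u k)
    (hu : ∀ k, P.real (u k) ≤ A * s k) : P.real t ≤ A := by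
  refine ENNReal.toReal_le_of_le_ofReal hA ?_
  calc P t ≤ P (⋃ k, u k) := measure_mono fun ω hω => Set.mem_iUnion.2 (ht ω hω)
    _ ≤ ∑' k, P (u k) := measure_iUnion_le u
    _ ≤ ∑' k, ENNReal.ofReal (A * s k) := ENNReal.tsum_le_tsum fun k => by
        rw [← ofReal_measureReal]
        exact ENNReal.ofReal_le_ofReal (hu k)
    _ = ENNReal.ofReal (A * ∑' k, s k) := by
        rw [← tsum_mul_left, ENNReal.ofReal_tsum_of_nonneg
          (fun k => mul_nonneg hA (h0 k)) (hs.mul_left A)]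
    _ ≤ ENNReal.ofReal A := ENNReal.ofReal_le_ofReal (mul_le_of_le_one_right hA h1)

end Countable

namespace SplitWeights

variable {Ω : Type*} [MeasurableSpace Ω] {P : Measure Ω} [IsProbabilityMeasure P]
  {W : ℤ → Ω → ℝ} {H a : ℝ → ℝ} {b s : ℕ → ℝ}

lemma tsum_twoSided_split_le (hb : SplitWeights b s) (n : ℕ) : ∑' k, twoSided s n k ≤ 1 := by
  have := tsum_twoSided_le hb.split_summable hb.split_nonneg n
  linarith [hb.tsum_le]

lemma sum_twoSided_le (hb : SplitWeights b s) (n : ℕ) :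
    ∑ k ∈ Finset.Icc (1 : ℤ) n, twoSided b n k ≤ 2 * ∑' i, b i :=
  (Summable.sum_le_tsum _ (fun k _ => twoSided_nonneg hb.nonneg n k)
    (summable_twoSided hb.summable hb.nonneg n)).trans (tsum_twoSided_le hb.summable hb.nonneg n)

/-- The probability that a weighted noise variable exceeds its share of the threshold. -/
lemma real_jump_le (hb : SplitWeights b s) (hW : Noise P W H) (hT : HeavyTail H a) :
    ∃ C c r₀ : ℝ, 0 < C ∧ 0 < c ∧ 0 < r₀ ∧ ∀ (n : ℕ) (k : ℤ) (h : ℝ), r₀ ≤ h →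
      P.real {ω | h * twoSided s n k < twoSided b n k * |W k ω|} ≤
        C * twoSided s n k * H (c * h) := by
  obtain ⟨c, hc, hcs⟩ := hb.le_split
  obtain ⟨p, C, hC, hp⟩ := hb.pow_le
  obtain ⟨r₁, hr1, hpot⟩ := hT.potter p
  refine ⟨2 ^ p * c ^ p * C, c, r₁ / c, by positivity, hc, by positivity, fun n k h hh => ?_⟩
  have hh0 : 0 < h := lt_of_lt_of_le (by positivity) hh
  have hbn := twoSided_nonneg hb.nonneg n k
  have hsn := twoSided_nonneg hb.split_nonneg n k
  have hHp := hT.pos (c * h)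
  have hcb : c * twoSided b n k ≤ twoSided s n k ∧
      (0 < twoSided b n k → twoSided b n k ^ p ≤ C * twoSided s n k ^ (p + 1)) := by
    rcases twoSided_eq b n k with ⟨h1, -⟩ | ⟨i, hi⟩
    · rw [h1, mul_zero]
      exact ⟨hsn, fun h => absurd h (lt_irrefl _)⟩
    · rw [hi, hi]
      exact ⟨hcs i, fun _ => hp i⟩
  set β := twoSided b n k
  set σ := twoSided s n k
  rcases hbn.eq_or_lt with h1 | h1
  · have : {ω | h * σ < β * |W k ω|} = ∅ := by
      ext ω
      simp only [Set.mem_ofPred_eq, Set.mem_empty_iff_false, iff_false, not_lt, ← h1, zero_mul]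
      positivity
    rw [this]
    simp only [measureReal_empty]
    positivity
  · have hσ : 0 < σ := lt_of_lt_of_le (by positivity) hcb.1
    have e : {ω | h * σ < β * |W k ω|} = {ω | h * σ / β < |W k ω|} := by
      ext ω
      simp only [Set.mem_ofPred_eq]
      rw [div_lt_iff₀ h1, mul_comm β]
    rw [e, hW.tail]
    rw [div_le_iff₀ hc] at hh
    -- The Potter factor is at least one because `c * β ≤ σ`; it turns the ratio of share to weight
    -- into `β ^ p / σ ^ p ≤ C * σ`.
    have h2 := hpot (c * h) (by linarith) (σ / (c * β)) ((one_le_div (by positivity)).2 hcb.1)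
    rw [show σ / (c * β) * (c * h) = h * σ / β by field_simp] at h2
    have hσp : 0 < (σ / (c * β)) ^ p := by positivity
    calc H (h * σ / β) = (σ / (c * β)) ^ p * H (h * σ / β) / (σ / (c * β)) ^ p := by field_simp
      _ ≤ 2 ^ p * H (c * h) / (σ / (c * β)) ^ p := by gcongr
      _ = 2 ^ p * c ^ p * H (c * h) * (β ^ p / σ ^ p) := by
          rw [div_pow, mul_pow]
          field_simp
      _ ≤ 2 ^ p * c ^ p * H (c * h) * (C * σ) := by
          gcongr
          rw [div_le_iff₀ (by positivity)]
          refine (hcb.2 h1).trans_eq ?_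
          rw [pow_succ]
          ring
      _ = _ := by ring

end SplitWeights

/-! ### Perturbations by infinitely many small weights. -/

/-- How a perturbation of a random walk can be large: the list of possible configurations. -/
lemma perturbation_cases {n : ℕ} {w s x : ℤ → ℝ} {y h η : ℝ} (hw : ∀ k, 0 ≤ w k)
    (hs : ∀ k, 0 ≤ s k) (hss : Summable s) (hs1 : ∑' k, s k ≤ 1) (hη : 0 < η) (hη1 : η ≤ 1)
    (hy : 0 < y) (hh : 0 ≤ h) (hR : Summable fun k => w k * |x k|)
    (h1 : y < ∑ i ∈ Finset.Icc (1 : ℤ) n, x i + ∑' k, w k * |x k|) (h2 : h < ∑' k, w k * |x k|)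
    (h3 : ∑' k, w k * |x k| ≤ η ^ 2 * y) :
    (∃ k, h * s k < w k * |x k| ∧ (1 - 2 * η) * y < ∑ i ∈ (Finset.Icc (1 : ℤ) n).erase k, x i) ∨
    (∃ k ∈ Finset.Icc (1 : ℤ) n, η * y < x k ∧ ∃ j, j ≠ k ∧ h / 2 * s j < w j * |x j|) ∨
    (∃ k ∈ Finset.Icc (1 : ℤ) n, y < x k ∧ h / 2 < w k * x k) ∨
    (∃ k ∈ Finset.Icc (1 : ℤ) n, ∃ j ∈ (Finset.Icc (1 : ℤ) n).erase k, η * y < x j ∧ η * y < x k) ∨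
    ∃ k ∈ Finset.Icc (1 : ℤ) n, (h / 2 < w k * y ∧ w k ≤ η) ∧
      y - 2 * w k * y < ∑ i ∈ Finset.Icc (1 : ℤ) n, x i ∧ η * y < x k ∧
        ∀ j ∈ Finset.Icc (1 : ℤ) n, j ≠ k → x j ≤ η * y := by
  set I := Finset.Icc (1 : ℤ) n
  set R := ∑' k, w k * |x k| with hRdef
  have hle : ∀ k, w k * |x k| ≤ R := fun k =>
    hR.le_tsum k fun j _ => mul_nonneg (hw j) (abs_nonneg _)
  have hηy : η ^ 2 * y ≤ η * y := by
    refine mul_le_mul_of_nonneg_right ?_ hy.le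
    rw [sq]
    exact mul_le_of_le_one_left hη.le hη1
  have hηy0 : 0 < η * y := by positivity
  obtain ⟨k, hk⟩ : ∃ k, h * s k < w k * |x k| := by
    by_contra! hcon
    have := hR.tsum_le_tsum hcon (hss.mul_left h)
    rw [tsum_mul_left] at this
    have := mul_le_of_le_one_right hh hs1
    linarith
  by_cases q1 : (1 - 2 * η) * y < ∑ i ∈ I.erase k, x i
  · exact Or.inl ⟨k, hk, q1⟩
  -- Outside the block, erasing `k` changes nothing, and the walk exceeds `y - η ^ 2 * y` anyway.
  have hkI : k ∈ I := by
    by_contra hkI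
    rw [Finset.erase_eq_of_notMem hkI] at q1
    push Not at q1
    linarith
  have hxk : η * y < x k := by
    rw [← Finset.add_sum_erase _ _ hkI] at h1
    push Not at q1
    linarith
  have hx0 : 0 < x k := hηy0.trans hxk
  refine Or.inr ?_
  by_cases q2 : ∃ j, j ≠ k ∧ h / 2 * s j < w j * |x j|
  · exact Or.inl ⟨k, hkI, hxk, q2⟩
  refine Or.inr ?_
  push Not at q2
  -- All other terms stay within half of their shares. Hence `w k * x k > h / 2`, and the
  -- perturbation is less than `2 * w k * x k`.
  have hrest : R ≤ w k * x k + h / 2 := by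
    rw [hRdef, hR.tsum_eq_add_tsum_ite k, abs_of_pos hx0]
    have h5 : ∑' j, (if j = k then 0 else w j * |x j|) ≤ ∑' j, h / 2 * s j := by
      refine Summable.tsum_le_tsum (fun j => ?_) ?_ (hss.mul_left _)
      · split_ifs with hj
        · exact mul_nonneg (by linarith) (hs j)
        · exact q2 j hj
      · refine Summable.of_nonneg_of_le (fun j => ?_) (fun j => ?_) hR
        · split_ifs
          exacts [le_rfl, mul_nonneg (hw j) (abs_nonneg _)]
        · split_ifs
          exacts [mul_nonneg (hw j) (abs_nonneg _), le_rfl]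
    rw [tsum_mul_left] at h5
    have := mul_le_of_le_one_right (show 0 ≤ h / 2 by linarith) hs1
    linarith
  have hwx : h / 2 < w k * x k := by linarith
  by_cases q3 : y < x k
  · exact Or.inl ⟨k, hkI, q3, hwx⟩
  refine Or.inr ?_
  push Not at q3
  by_cases q4 : ∃ j ∈ I.erase k, η * y < x j
  · obtain ⟨j, hj, hxj⟩ := q4
    exact Or.inl ⟨k, hkI, j, hj, hxj, hxk⟩
  refine Or.inr ?_
  push Not at q4
  have hwy : w k * x k ≤ w k * y := mul_le_mul_of_nonneg_left q3 (hw k)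
  refine ⟨k, hkI, ⟨by linarith, ?_⟩, by linarith, hxk, fun j hj hjk =>
    q4 j (Finset.mem_erase.2 ⟨hjk, hj⟩)⟩
  -- The bound `w k ≤ η` follows from `w k * x k ≤ η ^ 2 * y` and `x k > η * y`.
  have h6 := hle k
  rw [abs_of_pos hx0] at h6
  have h7 : w k * (η * y) ≤ w k * x k := mul_le_mul_of_nonneg_left hxk.le (hw k)
  have h8 : w k * (η * y) ≤ η * (η * y) := by nlinarith
  exact le_of_mul_le_mul_right h8 hηy0

namespace LDRegime

variable {Ω : Type*} [MeasurableSpace Ω] {P : Measure Ω} [IsProbabilityMeasure P]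
  {W : ℤ → Ω → ℝ} {H a : ℝ → ℝ} {l : Filter (ℕ × ℝ)} {κ : ℝ} {b s : ℕ → ℝ} {τ : ℕ × ℝ → ℝ}

/-- A large perturbation while the walk without the corresponding step is large. -/
lemma real_jump_drop_le (h : LDRegime P W H l κ) (hW : Noise P W H) (hT : HeavyTail H a)
    (hb : SplitWeights b s)
    (hA : ∀ c : ℝ, 0 < c → ∀ ε : ℝ, 0 < ε → ∀ᶠ z in l, H (c * z.2) ≤ ε * (z.1 * H z.2)) :
    ∃ η₁ : ℝ, 0 < η₁ ∧ ∀ η, η ≤ η₁ → ∀ τ : ℕ × ℝ → ℝ, Tendsto τ l atTop →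
      (∀ c : ℝ, 0 < c → Tendsto (fun z => z.1 * H (c * τ z)) l (𝓝 0)) →
      ∀ ε : ℝ, 0 < ε → ∀ᶠ z in l, P.real {ω | ∃ k, τ z * twoSided s z.1 k <
        twoSided b z.1 k * |W k ω| ∧
        (1 - 2 * η) * z.2 < ∑ i ∈ (Finset.Icc (1 : ℤ) z.1).erase k, W i ω} ≤
          ε * (z.1 * H z.2) := by
  obtain ⟨η₀, h0, h1, B, hB, hsum⟩ := h.sum_le hW hT 1
  obtain ⟨C, c, r₀, hC, hc, hr0, hjump⟩ := hb.real_jump_le hW hT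
  refine ⟨min (η₀ / 2) (1 / 4), by positivity, fun η hη τ hτ hτn ε hε => ?_⟩
  have hη0 := hη.trans (min_le_left _ _)
  have hη1 := hη.trans (min_le_right _ _)
  filter_upwards [hsum, hτ.eventually_ge_atTop r₀, hA (1 / 2) (by norm_num) 1 one_pos,
    ((hτn c hc).const_mul (C * B)).eventually_lt_const (u := ε) (by simpa using hε),
    h.tendsto_y.eventually_gt_atTop 0, h.tendsto_n.eventually_ge_atTop 1] with z h2 h3 h4 h5 hy hn
  have hHy := hT.pos z.2
  have hHτ := hT.pos (c * τ z)
  have hm := hW.meas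
  refine real_le_of_tsum (summable_twoSided hb.split_summable hb.split_nonneg z.1)
    (twoSided_nonneg hb.split_nonneg z.1) (hb.tsum_twoSided_split_le z.1) (by positivity)
    (fun ω hω => hω) fun k => ?_
  set I := (Finset.Icc (1 : ℤ) z.1).erase k with hI
  have hs0 := twoSided_nonneg hb.split_nonneg z.1 k
  have hind := hW.indepFun_sum (s := {k}) (t := I) (by simp [hI]) (f := fun _ z => z)
    (g := fun _ z => z) (fun _ => measurable_id) (fun _ => measurable_id)
  simp only [Finset.sum_singleton] at hind
  have hms : MeasurableSet {x : ℝ | τ z * twoSided s z.1 k < twoSided b z.1 k * |x|} :=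
    measurableSet_lt measurable_const (by fun_prop)
  have e := IndepFun.real_inter hind (t := Set.Ioi ((1 - 2 * η) * z.2)) hms measurableSet_Ioi
  have hcard : I.card ≤ z.1 ∧ z.1 ≤ I.card + 1 := by
    have h6 := Finset.card_erase_le (s := Finset.Icc (1 : ℤ) z.1) (a := k)
    have h7 := Finset.pred_card_le_card_erase (s := Finset.Icc (1 : ℤ) z.1) (a := k)
    rw [Int.card_Icc] at h6 h7
    rw [hI]
    omega
  -- Lowering the level costs a second factor `n`, which is absorbed by `n * H (c * τ) → 0` from the
  -- independent jump.
  have h6 : P.real {ω | (1 - 2 * η) * z.2 < ∑ i ∈ I, W i ω} ≤ B * (z.1 * (z.1 * H z.2)) := by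
    refine (h2 _ (by nlinarith) I hcard.1 hcard.2).trans ?_
    rw [one_mul] at h4
    gcongr
    refine (hT.anti ?_).trans h4
    nlinarith
  calc _ = _ := e
    _ ≤ (C * twoSided s z.1 k * H (c * τ z)) * (B * (z.1 * (z.1 * H z.2))) :=
        mul_le_mul (hjump z.1 k (τ z) h3) h6 measureReal_nonneg (by positivity)
    _ = (C * B * (z.1 * H (c * τ z))) * (z.1 * H z.2) * twoSided s z.1 k := by ring
    _ ≤ _ := by gcongr

/-- A large perturbation together with a large step of the walk. -/
lemma real_jump_step_le (hW : Noise P W H) (hT : HeavyTail H a)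
    (hb : SplitWeights b s)
    (hA : ∀ c : ℝ, 0 < c → ∀ ε : ℝ, 0 < ε → ∀ᶠ z in l, H (c * z.2) ≤ ε * (z.1 * H z.2))
    (hτ : Tendsto τ l atTop)
    (hτn : ∀ c : ℝ, 0 < c → Tendsto (fun z => z.1 * H (c * τ z)) l (𝓝 0))
    {η : ℝ} (hη : 0 < η) {ε : ℝ} (hε : 0 < ε) :
    ∀ᶠ z in l, P.real {ω | ∃ k ∈ Finset.Icc (1 : ℤ) z.1, η * z.2 < W k ω ∧
      ∃ j, j ≠ k ∧ τ z / 2 * twoSided s z.1 j < twoSided b z.1 j * |W j ω|} ≤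
        ε * (z.1 * H z.2) := by
  obtain ⟨C, c, r₀, hC, hc, hr0, hjump⟩ := hb.real_jump_le hW hT
  filter_upwards [hτ.eventually_ge_atTop (2 * r₀), hA η hη 1 one_pos,
    ((hτn (c / 2) (by positivity)).const_mul C).eventually_lt_const (u := ε) (by simpa using hε)]
    with z h3 h4 h5
  have hHy := hT.pos z.2
  have hHη := hT.pos (η * z.2)
  have hHτ := hT.pos (c / 2 * τ z)
  have hm := hW.meas
  have hk : ∀ k, P.real {ω | η * z.2 < W k ω ∧
      ∃ j, j ≠ k ∧ τ z / 2 * twoSided s z.1 j < twoSided b z.1 j * |W j ω|} ≤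
        C * H (c / 2 * τ z) * H (η * z.2) := by
    intro k
    refine real_le_of_tsum (summable_twoSided hb.split_summable hb.split_nonneg z.1)
      (twoSided_nonneg hb.split_nonneg z.1) (hb.tsum_twoSided_split_le z.1) (by positivity)
      (u := fun j => {ω | η * z.2 < W k ω ∧
        j ≠ k ∧ τ z / 2 * twoSided s z.1 j < twoSided b z.1 j * |W j ω|})
      (fun ω hω => ?_) fun j => ?_
    · obtain ⟨h6, j, h7, h8⟩ := hω
      exact ⟨j, h6, h7, h8⟩
    have hs0 := twoSided_nonneg hb.split_nonneg z.1 j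
    by_cases hjk : j = k
    · have : {ω | η * z.2 < W k ω ∧
          j ≠ k ∧ τ z / 2 * twoSided s z.1 j < twoSided b z.1 j * |W j ω|} = ∅ := by
        ext ω
        simp [hjk]
      rw [this]
      simp only [measureReal_empty]
      positivity
    · have hms : MeasurableSet {x : ℝ | τ z / 2 * twoSided s z.1 j < twoSided b z.1 j * |x|} :=
        measurableSet_lt measurable_const (by fun_prop)
      have e := IndepFun.real_inter (hW.indep.indepFun (Ne.symm hjk)) (s := Set.Ioi (η * z.2))
        measurableSet_Ioi hms
      have e2 : c * (τ z / 2) = c / 2 * τ z := by ring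
      have h6 := hjump z.1 j (τ z / 2) (by linarith)
      rw [e2] at h6
      calc _ = P.real {ω | W k ω ∈ Set.Ioi (η * z.2) ∧
            W j ω ∈ {x : ℝ | τ z / 2 * twoSided s z.1 j < twoSided b z.1 j * |x|}} := by
            simp only [ne_eq, hjk, not_false_eq_true, true_and]
            rfl
        _ = _ := e
        _ ≤ H (η * z.2) * (C * twoSided s z.1 j * H (c / 2 * τ z)) := by
            refine mul_le_mul ?_ h6 measureReal_nonneg hHη.le
            rw [← hW.tail k]
            exact measureReal_mono fun ω hω =>
              lt_of_lt_of_le (show η * z.2 < W k ω from hω) (le_abs_self _)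
        _ = _ := by ring
  calc _ ≤ ∑ k ∈ Finset.Icc (1 : ℤ) z.1, C * H (c / 2 * τ z) * H (η * z.2) :=
        (real_le_sum _ fun ω hω => hω).trans (Finset.sum_le_sum fun k _ => hk k)
    _ = z.1 * (C * H (c / 2 * τ z) * H (η * z.2)) := by
        rw [Finset.sum_const, nsmul_eq_mul]
        simp
    _ ≤ z.1 * (C * H (c / 2 * τ z) * (1 * (z.1 * H z.2))) := by gcongr
    _ = C * (z.1 * H (c / 2 * τ z)) * (z.1 * H z.2) := by ring
    _ ≤ _ := by gcongr

/-- A single step that is both a large value of the walk and a large perturbation. -/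
lemma real_step_jump_le (h : LDRegime P W H l κ) (hW : Noise P W H) (hT : HeavyTail H a)
    (hb : SplitWeights b s) (hτ : Tendsto τ l atTop)
    (hτy : ∀ ε : ℝ, 0 < ε → ∀ᶠ z in l, z.2 ≤ ε * z.1 * τ z) {ε : ℝ} (hε : 0 < ε) :
    ∀ᶠ z in l, P.real {ω | ∃ k ∈ Finset.Icc (1 : ℤ) z.1, z.2 < W k ω ∧
      τ z / 2 < twoSided b z.1 k * W k ω} ≤ ε * (z.1 * H z.2) := by
  obtain ⟨r₀, hr0, hpot⟩ := hT.potter 1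
  have hBb : 0 ≤ ∑' i, b i := tsum_nonneg hb.nonneg
  set A := 4 * (2 * ∑' i, b i) + 1 with hAdef
  have hA : 0 < A := by positivity
  filter_upwards [hτ.eventually_gt_atTop 0, hτy (ε / A) (by positivity),
    h.tendsto_y.eventually_ge_atTop r₀] with z h1 h2 hy
  have hy0 : 0 < z.2 := by linarith
  have hHy := hT.pos z.2
  have hk : ∀ k, P.real {ω | z.2 < W k ω ∧ τ z / 2 < twoSided b z.1 k * W k ω} ≤
      4 * (z.2 / τ z) * H z.2 * twoSided b z.1 k := by
    intro k
    have hw := twoSided_nonneg hb.nonneg z.1 k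
    set w := twoSided b z.1 k
    rcases hw.eq_or_lt with h3 | h3
    · have : {ω | z.2 < W k ω ∧ τ z / 2 < w * W k ω} = ∅ := by
        ext ω
        simp only [← h3, zero_mul, Set.mem_ofPred_eq, Set.mem_empty_iff_false, iff_false, not_and]
        intro _
        linarith
      rw [this]
      simp only [measureReal_empty]
      positivity
    -- The step exceeds `t * y`, and the Potter bound of order one yields a probability proportional
    -- to `w * (y / τ) * H y`; the weights are summable and `y / τ = o(n)`.
    · set t := max 1 (τ z / (2 * w * z.2)) with ht
      have ht1 : 1 ≤ t := le_max_left _ _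
      have h4 := hpot z.2 hy t ht1
      rw [pow_one, pow_one] at h4
      have h5 : P.real {ω | z.2 < W k ω ∧ τ z / 2 < w * W k ω} ≤ H (t * z.2) := by
        rw [← hW.tail k]
        refine measureReal_mono fun ω hω => ?_
        obtain ⟨h6, h7⟩ : z.2 < W k ω ∧ τ z / 2 < w * W k ω := hω
        refine lt_of_lt_of_le (b := W k ω) ?_ (le_abs_self _)
        rw [ht, max_mul_of_nonneg _ _ hy0.le, one_mul]
        refine max_lt h6 ?_
        have : τ z / (2 * w * z.2) * z.2 = τ z / 2 / w := by field_simp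
        rw [this, div_lt_iff₀ h3, mul_comm]
        exact h7
      have h6 : τ z / (2 * w * z.2) * H (t * z.2) ≤ 2 * H z.2 := by
        refine le_trans ?_ h4
        have := hT.pos (t * z.2)
        gcongr
        exact le_max_right _ _
      have h7 : H (t * z.2) = 2 * w * z.2 / τ z * (τ z / (2 * w * z.2) * H (t * z.2)) := by
        field_simp
      calc _ ≤ H (t * z.2) := h5
        _ = _ := h7
        _ ≤ 2 * w * z.2 / τ z * (2 * H z.2) := by gcongr
        _ = _ := by ring
  have h3 : z.2 / τ z ≤ ε / A * z.1 := (div_le_iff₀ h1).2 h2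
  calc _ ≤ ∑ k ∈ Finset.Icc (1 : ℤ) z.1, 4 * (z.2 / τ z) * H z.2 * twoSided b z.1 k :=
        (real_le_sum _ fun ω hω => hω).trans (Finset.sum_le_sum fun k _ => hk k)
    _ = 4 * (z.2 / τ z) * H z.2 * ∑ k ∈ Finset.Icc (1 : ℤ) z.1, twoSided b z.1 k := by
        rw [Finset.mul_sum]
    _ ≤ 4 * (z.2 / τ z) * H z.2 * (2 * ∑' i, b i) := by
        have := hb.sum_twoSided_le z.1
        gcongr
    _ = (4 * (2 * ∑' i, b i)) * ((z.2 / τ z) * H z.2) := by ring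
    _ ≤ A * ((ε / A * z.1) * H z.2) := by
        gcongr
        linarith
    _ = _ := by field_simp

/-- Two large steps. -/
lemma real_two_steps_le (h : LDRegime P W H l κ) (hW : Noise P W H) (hT : HeavyTail H a)
    (hA : ∀ c : ℝ, 0 < c → ∀ ε : ℝ, 0 < ε → ∀ᶠ z in l, H (c * z.2) ≤ ε * (z.1 * H z.2))
    {η : ℝ} (hη : 0 < η) {ε : ℝ} (hε : 0 < ε) :
    ∀ᶠ z in l, P.real {ω | ∃ k ∈ Finset.Icc (1 : ℤ) z.1, ∃ j ∈ (Finset.Icc (1 : ℤ) z.1).erase k,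
      η * z.2 < W j ω ∧ η * z.2 < W k ω} ≤ ε * (z.1 * H z.2) := by
  have hlim : Tendsto (fun z : ℕ × ℝ => (η ^ 4)⁻¹ * ((η * z.2) ^ 4 * H (η * z.2))) l (𝓝 0) := by
    have := ((hT.poly_tendsto 4).comp (h.tendsto_y.const_mul_atTop hη)).const_mul (η ^ 4)⁻¹
    simpa [Function.comp_def] using this
  filter_upwards [hA η hη 1 one_pos, h.n_le, hlim.eventually_lt_const hε] with z h1 h2 h3
  have hHy := hT.pos z.2
  have hHη := hT.pos (η * z.2)
  -- There are at most `n ^ 2 ≤ y ^ 4` pairs, which one factor `H (η * y)` absorbs; the other is at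
  -- most `n * H y`.
  have h4 : (z.1 : ℝ) ^ 2 * H (η * z.2) ≤ ε := by
    calc (z.1 : ℝ) ^ 2 * H (η * z.2) ≤ (z.2 ^ 2) ^ 2 * H (η * z.2) := by gcongr
      _ = (η ^ 4)⁻¹ * ((η * z.2) ^ 4 * H (η * z.2)) := by field_simp
      _ ≤ ε := h3.le
  calc _ ≤ ∑ k ∈ Finset.Icc (1 : ℤ) z.1, ∑ j ∈ (Finset.Icc (1 : ℤ) z.1).erase k,
        P.real {ω | η * z.2 < W j ω ∧ η * z.2 < W k ω} :=
        (real_le_sum _ fun ω hω => hω).trans (Finset.sum_le_sum fun k _ =>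
          real_le_sum _ fun ω hω => hω)
    _ ≤ ∑ k ∈ Finset.Icc (1 : ℤ) z.1, ∑ j ∈ (Finset.Icc (1 : ℤ) z.1).erase k,
          H (η * z.2) * H (η * z.2) := Finset.sum_le_sum fun k _ => Finset.sum_le_sum fun j hj =>
          hW.real_lt_inter_le (Finset.ne_of_mem_erase hj) _ _
    _ ≤ ∑ k ∈ Finset.Icc (1 : ℤ) z.1, ∑ j ∈ Finset.Icc (1 : ℤ) z.1, H (η * z.2) * H (η * z.2) :=
        Finset.sum_le_sum fun k _ => Finset.sum_le_sum_of_subset_of_nonneg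
          (Finset.erase_subset _ _) fun _ _ _ => by positivity
    _ = (z.1 : ℝ) ^ 2 * H (η * z.2) * H (η * z.2) := by
        simp only [Finset.sum_const, nsmul_eq_mul, Int.card_Icc, add_sub_cancel_right,
          Int.toNat_natCast]
        ring
    _ ≤ ε * (1 * (z.1 * H z.2)) := by gcongr
    _ = _ := by ring

/-- The walk is large because of a single step, which also causes a large perturbation. -/
lemma real_exchange_le (h : LDRegime P W H l κ) (hW : Noise P W H) (hT : HeavyTail H a)
    (hb : SplitWeights b s)
    (hA : ∀ c : ℝ, 0 < c → ∀ ε : ℝ, 0 < ε → ∀ᶠ z in l, H (c * z.2) ≤ ε * (z.1 * H z.2)) :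
    ∃ η₁ : ℝ, 0 < η₁ ∧ ∀ η, η ≤ η₁ → ∀ θ : ℝ, 0 < θ → ∀ ε : ℝ, 0 < ε → ∀ᶠ z in l,
      P.real {ω | ∃ k ∈ Finset.Icc (1 : ℤ) z.1,
        (θ * a z.2 / 2 < twoSided b z.1 k * z.2 ∧ twoSided b z.1 k ≤ η) ∧
        z.2 - 2 * twoSided b z.1 k * z.2 < ∑ i ∈ Finset.Icc (1 : ℤ) z.1, W i ω ∧ η * z.2 < W k ω ∧
        ∀ j ∈ Finset.Icc (1 : ℤ) z.1, j ≠ k → W j ω ≤ η * z.2} ≤ ε * (z.1 * H z.2) := by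
  obtain ⟨η₀, h0, h1, B, hB, hsum⟩ := h.sum_le hW hT 1
  obtain ⟨C, hC, hpow⟩ := hT.le_pow_mul (c := 1 / 2) (by norm_num) (by norm_num) one_ne_zero
  obtain ⟨y₀, hy0⟩ := eventually_atTop.1 hpow
  obtain ⟨y₁, hy1⟩ := hT.a_lip 1 one_pos
  refine ⟨min (η₀ / 2) (1 / 4), by positivity, fun η hη θ hθ ε hε => ?_⟩
  have hη0 := hη.trans (min_le_left _ _)
  have hη1 := hη.trans (min_le_right _ _)
  have hBb : 0 ≤ ∑' i, b i := tsum_nonneg hb.nonneg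
  set D := B * (C * (4 * (1 / θ + 1))) with hD
  have hD0 : 0 < D := by positivity
  set A := D * (2 * ∑' i, b i) + 1 with hAdef
  have hA0 : 0 < A := by positivity
  filter_upwards [hsum, h.tendsto_y.eventually_ge_atTop (2 * max y₀ y₁),
    hA (1 / 4) (by norm_num) (ε / A) (by positivity),
    h.tendsto_y.eventually_gt_atTop 0, h.tendsto_n.eventually_ge_atTop 1] with z h2 h3 h4 hy hn
  have hHy := hT.pos z.2
  have hH4 := hT.pos (1 / 4 * z.2)
  have hn0 : (0 : ℝ) < z.1 := by exact_mod_cast hn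
  set I := Finset.Icc (1 : ℤ) z.1 with hI
  have hcard : I.card = z.1 := by simp [hI]
  have hk : ∀ k ∈ I, P.real {ω | (θ * a z.2 / 2 < twoSided b z.1 k * z.2 ∧ twoSided b z.1 k ≤ η) ∧
        z.2 - 2 * twoSided b z.1 k * z.2 < ∑ i ∈ I, W i ω ∧ η * z.2 < W k ω ∧
        ∀ j ∈ I, j ≠ k → W j ω ≤ η * z.2} ≤ D * H (1 / 4 * z.2) * twoSided b z.1 k := by
    intro k hk
    have hw := twoSided_nonneg hb.nonneg z.1 k
    set w := twoSided b z.1 k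
    by_cases hc : θ * a z.2 / 2 < w * z.2 ∧ w ≤ η
    swap
    · simp only [hc, false_and, Set.ofPred_false, measureReal_empty]
      positivity
    obtain ⟨hc1, hc2⟩ := hc
    set u := z.2 - 2 * w * z.2 with hu
    have hu2 : z.2 / 2 ≤ u := by
      have : w * z.2 ≤ 1 / 4 * z.2 := mul_le_mul_of_nonneg_right (hc2.trans hη1) hy.le
      rw [hu]
      linarith
    have hu0 : 0 < u := by linarith
    have hsumu : P.real {ω | u < ∑ i ∈ I, W i ω} ≤ B * (z.1 * H u) := by
      refine h2 u ?_ I hcard.le (by rw [hcard]; omega)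
      have : w * z.2 ≤ η₀ / 2 * z.2 := mul_le_mul_of_nonneg_right (hc2.trans hη0) hy.le
      rw [hu]
      linarith
    -- For each fixed `k`, exchangeability removes the factor `n` from the walk bound at the lowered
    -- level `u`.
    have hex := hW.card_mul_real_le (s := I) (J := ∅) (by simp) (fun _ => 0) u 0 (η * z.2) hk
    simp only [Finset.sum_empty, add_zero, le_refl, true_and, and_true] at hex
    rw [hcard] at hex
    have hPk : P.real {ω | u < ∑ i ∈ I, W i ω ∧ η * z.2 < W k ω ∧
        ∀ j ∈ I, j ≠ k → W j ω ≤ η * z.2} ≤ B * H u := by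
      refine le_of_mul_le_mul_left ((hex.trans hsumu).trans_eq ?_) hn0
      ring
    have hmax1 := le_max_left y₀ y₁
    have hmax2 := le_max_right y₀ y₁
    have hau : a u ≤ a z.2 + 2 * w * z.2 := by
      have h5 := hy1 u z.2 (by linarith) (by linarith)
      have h6 : |u - z.2| = 2 * w * z.2 := by
        rw [hu, show z.2 - 2 * w * z.2 - z.2 = -(2 * w * z.2) by ring, abs_neg,
          abs_of_nonneg (by positivity)]
      rw [h6, one_mul] at h5
      linarith [(abs_le.1 h5).2]
    have haz : a z.2 ≤ 2 * w * z.2 / θ := by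
      rw [le_div_iff₀ hθ]
      linarith
    -- Since `θ * a y / 2 < w * y`, the auxiliary function at `u` is at most a multiple of `w * y`;
    -- the power bound then produces the factor `w` that makes the sum over `k` converge uniformly.
    have hHu : H u ≤ C * (4 * (1 / θ + 1) * w) * H (1 / 4 * z.2) := by
      have h5 := hy0 u (by linarith)
      rw [pow_one] at h5
      have h6 : a u / u ≤ 4 * (1 / θ + 1) * w := by
        rw [div_le_iff₀ hu0]
        have h7 : 4 * (1 / θ + 1) * w * (z.2 / 2) ≤ 4 * (1 / θ + 1) * w * u := by gcongr
        have h8 : 4 * (1 / θ + 1) * w * (z.2 / 2) = 2 * w * z.2 / θ + 2 * w * z.2 := by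
          field_simp
          ring
        linarith
      have h7 : H (1 / 2 * u) ≤ H (1 / 4 * z.2) := hT.anti (by linarith)
      have h8 := hT.pos (1 / 2 * u)
      refine h5.trans ?_
      calc C * (a u / u) * H (1 / 2 * u) ≤ C * (4 * (1 / θ + 1) * w) * H (1 / 2 * u) := by gcongr
        _ ≤ _ := by gcongr
    calc _ ≤ P.real {ω | u < ∑ i ∈ I, W i ω ∧ η * z.2 < W k ω ∧
            ∀ j ∈ I, j ≠ k → W j ω ≤ η * z.2} := measureReal_mono fun ω hω => hω.2
      _ ≤ B * (C * (4 * (1 / θ + 1) * w) * H (1 / 4 * z.2)) := hPk.trans (by gcongr)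
      _ = _ := by rw [hD]; ring
  calc _ ≤ ∑ k ∈ I, D * H (1 / 4 * z.2) * twoSided b z.1 k :=
        (real_le_sum _ fun ω hω => hω).trans (Finset.sum_le_sum fun k hkI => hk k hkI)
    _ = D * H (1 / 4 * z.2) * ∑ k ∈ I, twoSided b z.1 k := by rw [Finset.mul_sum]
    _ ≤ D * H (1 / 4 * z.2) * (2 * ∑' i, b i) := by
        have := hb.sum_twoSided_le z.1
        gcongr
    _ = D * (2 * ∑' i, b i) * H (1 / 4 * z.2) := by ring
    _ ≤ A * (ε / A * (z.1 * H z.2)) := by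
        gcongr
        linarith
    _ = _ := by field_simp

end LDRegime

namespace LDRegime

variable {Ω : Type*} [MeasurableSpace Ω] {P : Measure Ω} [IsProbabilityMeasure P]
  {W : ℤ → Ω → ℝ} {H a : ℝ → ℝ} {l : Filter (ℕ × ℝ)} {κ : ℝ} {b s : ℕ → ℝ}

/-- The perturbation only matters if it is of larger order than the auxiliary function,
and this happens with negligible probability. -/
lemma real_perturbation_le (h : LDRegime P W H l κ) (hW : Noise P W H) (hT : HeavyTail H a)
    (hb : SplitWeights b s)
    (hA : ∀ c : ℝ, 0 < c → ∀ ε : ℝ, 0 < ε → ∀ᶠ z in l, H (c * z.2) ≤ ε * (z.1 * H z.2)) :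
    ∃ ρ : ℝ, 0 < ρ ∧ ∀ θ : ℝ, 0 < θ → ∀ ε : ℝ, 0 < ε → ∀ᶠ z in l,
      P.real {ω | (Summable fun k => twoSided b z.1 k * |W k ω|) ∧
        z.2 < ∑ i ∈ Finset.Icc (1 : ℤ) z.1, W i ω + ∑' k, twoSided b z.1 k * |W k ω| ∧
        θ * a z.2 < ∑' k, twoSided b z.1 k * |W k ω| ∧
        ∑' k, twoSided b z.1 k * |W k ω| ≤ ρ * z.2} ≤ ε * (z.1 * H z.2) := by
  obtain ⟨η₁, h1, hdrop⟩ := h.real_jump_drop_le hW hT hb hA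
  obtain ⟨η₂, h2, hexch⟩ := h.real_exchange_le hW hT hb hA
  obtain ⟨C, hC, hpow⟩ := hT.le_pow_mul (c := 1 / 2) (by norm_num) (by norm_num) one_ne_zero
  set η := min 1 (min η₁ η₂) with hη
  have hη0 : 0 < η := by positivity
  have hη1 : η ≤ 1 := min_le_left _ _
  have hηa : η ≤ η₁ := (min_le_right _ _).trans (min_le_left _ _)
  have hηb : η ≤ η₂ := (min_le_right _ _).trans (min_le_right _ _)
  refine ⟨η ^ 2, by positivity, fun θ hθ ε hε => ?_⟩
  -- The auxiliary function is at least `y ^ (3/4)`. Hence `τ = θ * a y` is so large that `n * H (c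
  -- * τ)`, bounded by a multiple of `y ^ 2 / a y ^ 4`, tends to zero.
  have ha3 : ∀ᶠ z in l, z.2 ^ 3 ≤ a z.2 ^ 4 := by
    filter_upwards [hA (1 / 2) (by norm_num) 1 one_pos, h.n_le,
      h.tendsto_y.eventually (hT.a_large (c := 1 / 2) (by norm_num) (by norm_num) 1 2)]
      with z h3 h4 h5
    have := hT.pos z.2
    refine h5 (h3.trans ?_)
    rw [one_mul, one_mul]
    gcongr
  have hapos := h.tendsto_y.eventually hT.a_pos
  have hτ : Tendsto (fun z => θ * a z.2) l atTop := by
    refine Tendsto.const_mul_atTop hθ ?_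
    have h3 : Tendsto (fun z : ℕ × ℝ => √z.2) l atTop :=
      Real.tendsto_sqrt_atTop.comp h.tendsto_y
    refine tendsto_atTop_mono' l ?_ h3
    filter_upwards [ha3, hapos, h.tendsto_y.eventually_ge_atTop 1] with z h4 h5 h6
    refine le_of_pow_le_pow_left₀ (n := 4) (by norm_num) h5.le ?_
    rw [show (4 : ℕ) = 2 * 2 by norm_num, pow_mul, Real.sq_sqrt (by linarith)]
    refine le_trans ?_ h4
    exact pow_le_pow_right₀ h6 (by norm_num)
  have hτn : ∀ c : ℝ, 0 < c → Tendsto (fun z => z.1 * H (c * (θ * a z.2))) l (𝓝 0) := by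
    intro c hc
    obtain ⟨C₄, hC4, hpoly⟩ := hT.poly 4
    have hlim : Tendsto (fun z : ℕ × ℝ => C₄ / (c * θ) ^ 4 / z.2) l (𝓝 0) :=
      tendsto_const_nhds.div_atTop h.tendsto_y
    refine squeeze_zero' (Eventually.of_forall fun z =>
      mul_nonneg (Nat.cast_nonneg _) (hT.pos _).le) ?_ hlim
    filter_upwards [ha3, hapos, h.n_le, h.tendsto_y.eventually_gt_atTop 0] with z h3 h4 h5 h6
    have h7 := hpoly (c * (θ * a z.2)) (by positivity)
    have hH := hT.pos (c * (θ * a z.2))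
    rw [div_div, le_div_iff₀ (by positivity)]
    calc z.1 * H (c * (θ * a z.2)) * ((c * θ) ^ 4 * z.2)
        ≤ z.2 ^ 2 * H (c * (θ * a z.2)) * ((c * θ) ^ 4 * z.2) := by gcongr
      _ = (c * θ) ^ 4 * z.2 ^ 3 * H (c * (θ * a z.2)) := by ring
      _ ≤ (c * θ) ^ 4 * a z.2 ^ 4 * H (c * (θ * a z.2)) := by gcongr
      _ = (c * (θ * a z.2)) ^ 4 * H (c * (θ * a z.2)) := by ring
      _ ≤ C₄ := h7
  -- Combining `H y ≤ C * (a y / y) * H (y / 2)` with `H (y / 2) = o(n * H y)` and cancelling `H y`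
  -- gives `y = o(n * a y)`.
  have hτy : ∀ ε : ℝ, 0 < ε → ∀ᶠ z in l, z.2 ≤ ε * z.1 * (θ * a z.2) := by
    intro ε hε
    filter_upwards [hA (1 / 2) (by norm_num) (ε * θ / C) (by positivity), hapos,
      h.tendsto_y.eventually hpow, h.tendsto_y.eventually_gt_atTop 0] with z h3 h4 h5 h6
    have hHy := hT.pos z.2
    rw [pow_one] at h5
    have h7 : 1 * H z.2 ≤ (ε * z.1 * (θ * a z.2) / z.2) * H z.2 := by
      calc 1 * H z.2 ≤ C * (a z.2 / z.2) * H (1 / 2 * z.2) := by rw [one_mul]; exact h5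
        _ ≤ C * (a z.2 / z.2) * (ε * θ / C * (z.1 * H z.2)) := by gcongr
        _ = _ := by field_simp
    have h8 := le_of_mul_le_mul_right h7 hHy
    rwa [one_le_div h6] at h8
  have hε5 : 0 < ε / 5 := by positivity
  filter_upwards [hdrop η hηa _ hτ hτn _ hε5, real_jump_step_le hW hT hb hA hτ hτn hη0 hε5,
    h.real_step_jump_le hW hT hb hτ hτy hε5, h.real_two_steps_le hW hT hA hη0 hε5,
    hexch η hηb θ hθ _ hε5, hapos, h.tendsto_y.eventually_gt_atTop 0] with z e1 e2 e3 e4 e5 hz hy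
  refine (measureReal_mono (s₂ := _ ∪ (_ ∪ (_ ∪ (_ ∪ _)))) (fun ω hω => ?_)
    (measure_ne_top _ _)).trans ((measureReal_union_le _ _).trans (add_le_add e1
      ((measureReal_union_le _ _).trans (add_le_add e2 ((measureReal_union_le _ _).trans
        (add_le_add e3 ((measureReal_union_le _ _).trans (add_le_add e4 e5)))))))) |>.trans_eq ?_
  · exact perturbation_cases (x := fun k => W k ω) (twoSided_nonneg hb.nonneg z.1)
      (twoSided_nonneg hb.split_nonneg z.1) (summable_twoSided hb.split_summable hb.split_nonneg z.1)
      (hb.tsum_twoSided_split_le z.1) hη0 hη1 hy (by positivity) hω.1 hω.2.1 hω.2.2.1 hω.2.2.2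
  · ring

/-- A perturbation of the random walk that is dominated by a weighted sum of the absolute values of
the noise does not change the tail. -/
lemma tendsto_perturbation (h : LDRegime P W H l κ) (hW : Noise P W H) (hT : HeavyTail H a)
    (hb : SplitWeights b s)
    (hA : ∀ c : ℝ, 0 < c → ∀ ε : ℝ, 0 < ε → ∀ᶠ z in l, H (c * z.2) ≤ ε * (z.1 * H z.2))
    (Y : ℕ → Ω → ℝ) (hY : ∀ᵐ ω ∂P, ∀ n : ℕ, (Summable fun k => twoSided b n k * |W k ω|) →
      |Y n ω - ∑ i ∈ Finset.Icc (1 : ℤ) n, W i ω| ≤ ∑' k, twoSided b n k * |W k ω|) :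
    Tendsto (fun z => P.real {ω | z.2 < Y z.1 ω} / (z.1 * H z.2)) l (𝓝 κ) := by
  obtain ⟨ρ, hρ, hpert⟩ := h.real_perturbation_le hW hT hb hA
  obtain ⟨C, c, r₀, hC, hc, hr0, hjump⟩ := hb.real_jump_le hW hT
  obtain ⟨η, hη0, hη1, hbd⟩ := h.bounds hT
  have hκ := h.nonneg
  refine Metric.tendsto_nhds.2 fun ε₀ hε₀ => ?_
  obtain ⟨δ, hδ0, hδ1, hδε⟩ : ∃ δ : ℝ, 0 < δ ∧ δ < 1 ∧ (κ + 4) * δ < ε₀ := by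
    refine ⟨min (1 / 2) (ε₀ / (2 * (κ + 4))), by positivity,
      (min_le_left _ _).trans_lt (by norm_num), ?_⟩
    calc (κ + 4) * min (1 / 2) (ε₀ / (2 * (κ + 4))) ≤ (κ + 4) * (ε₀ / (2 * (κ + 4))) := by
          gcongr
          exact min_le_right _ _
      _ = ε₀ / 2 := by field_simp
      _ < ε₀ := by linarith
  -- Shifts by `θ * a y` change `H` at most by the factors `1 + δ` and `1 - δ`; halving the
  -- logarithm leaves room for the limit.
  set θ := Real.log (1 + δ) / 2 with hθ
  have hlog := Real.log_pos (show 1 < 1 + δ by linarith)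
  have hθ0 : 0 < θ := by positivity
  have hexp : Real.exp θ < 1 + δ := by
    calc Real.exp θ < Real.exp (Real.log (1 + δ)) := Real.exp_lt_exp.2 (by linarith)
      _ = 1 + δ := Real.exp_log (by linarith)
  have hexp2 : 1 - δ < Real.exp (-θ) := by
    rw [Real.exp_neg, lt_inv_comm₀ (by linarith) (Real.exp_pos _)]
    refine hexp.trans_le ?_
    rw [le_inv_comm₀ (by linarith) (by linarith), inv_eq_one_div, le_div_iff₀ (by linarith)]
    nlinarith
  have hN : P {ω | ¬ ∀ n : ℕ, (Summable fun k => twoSided b n k * |W k ω|) →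
      |Y n ω - ∑ i ∈ Finset.Icc (1 : ℤ) n, W i ω| ≤ ∑' k, twoSided b n k * |W k ω|} = 0 :=
    ae_iff.1 hY
  set N := {ω | ¬ ∀ n : ℕ, (Summable fun k => twoSided b n k * |W k ω|) →
      |Y n ω - ∑ i ∈ Finset.Icc (1 : ℤ) n, W i ω| ≤ ∑' k, twoSided b n k * |W k ω|} with hNdef
  have hN' : P.real N = 0 := by rw [measureReal_def, hN, ENNReal.toReal_zero]
  filter_upwards [hpert θ hθ0 δ hδ0, hbd δ hδ0, hA (c * ρ) (by positivity) (δ / C) (by positivity),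
    (h.tendsto_y.const_mul_atTop hρ).eventually_ge_atTop r₀,
    h.tendsto_y.eventually (hT.ratio_le hexp), h.tendsto_y.eventually (hT.le_ratio hexp2),
    h.tendsto_y.eventually (hT.a_small (ε := η / θ) (by positivity)),
    h.tendsto_y.eventually hT.a_pos, h.tendsto_y.eventually_gt_atTop 0,
    h.tendsto_n.eventually_ge_atTop 1] with z e1 e2 e3 e4 e5 e6 e7 e8 hy hn
  have hHy := hT.pos z.2
  have hn0 : (0 : ℝ) < z.1 := by exact_mod_cast hn
  have hnH : 0 < z.1 * H z.2 := by positivity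
  set S : Ω → ℝ := fun ω => ∑ i ∈ Finset.Icc (1 : ℤ) z.1, W i ω with hS
  set R : Ω → ℝ := fun ω => ∑' k, twoSided b z.1 k * |W k ω| with hR
  set A := {ω | ∃ k, ρ * z.2 * twoSided s z.1 k < twoSided b z.1 k * |W k ω|} with hAdef
  set T := {ω | (Summable fun k => twoSided b z.1 k * |W k ω|) ∧ z.2 < S ω + R ω ∧
    θ * a z.2 < R ω ∧ R ω ≤ ρ * z.2} with hTdef
  have hPA : P.real A ≤ δ * (z.1 * H z.2) := by
    have hH := hT.pos (c * (ρ * z.2))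
    calc P.real A ≤ C * H (c * (ρ * z.2)) := by
          refine real_le_of_tsum (summable_twoSided hb.split_summable hb.split_nonneg z.1)
            (twoSided_nonneg hb.split_nonneg z.1) (hb.tsum_twoSided_split_le z.1) (by positivity)
            (fun ω hω => hω) fun k => ?_
          refine (hjump z.1 k (ρ * z.2) e4).trans_eq (by ring)
      _ ≤ C * (δ / C * (z.1 * H z.2)) := by
          rw [← mul_assoc]
          gcongr
      _ = _ := by field_simp
  -- Off `A` every term stays within its share, so the series converges by comparison and is at most
  -- `ρ * y`; no prior convergence of the dominating series is needed.
  have hgood : ∀ ω, ω ∉ A → ω ∉ N → (Summable fun k => twoSided b z.1 k * |W k ω|) ∧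
      R ω ≤ ρ * z.2 ∧ |Y z.1 ω - S ω| ≤ R ω ∧ 0 ≤ R ω := by
    intro ω h1 h2
    have h1' : ∀ k, twoSided b z.1 k * |W k ω| ≤ ρ * z.2 * twoSided s z.1 k := by
      by_contra! hcon
      exact h1 hcon
    have h2' : ∀ n : ℕ, (Summable fun k => twoSided b n k * |W k ω|) →
      |Y n ω - ∑ i ∈ Finset.Icc (1 : ℤ) n, W i ω| ≤ ∑' k, twoSided b n k * |W k ω| := by
      by_contra hcon
      exact h2 hcon
    have hss := (summable_twoSided hb.split_summable hb.split_nonneg z.1).mul_left (ρ * z.2)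
    have h0 : ∀ k, 0 ≤ twoSided b z.1 k * |W k ω| := fun k =>
      mul_nonneg (twoSided_nonneg hb.nonneg z.1 k) (abs_nonneg _)
    have hsum := Summable.of_nonneg_of_le h0 h1' hss
    refine ⟨hsum, ?_, h2' z.1 hsum, tsum_nonneg h0⟩
    refine (hsum.tsum_le_tsum h1' hss).trans ?_
    rw [tsum_mul_left]
    exact mul_le_of_le_one_right (by positivity) (hb.tsum_twoSided_split_le z.1)
  have hwalk : ∀ u, P.real {ω | u < S ω} = walkTail P W z.1 u := fun u => by
    rw [walkTail, ← hW.sum_law (s := Finset.Icc 1 (z.1 : ℤ)) (by simp)]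
  have hθa : θ * a z.2 ≤ η * z.2 := by
    calc θ * a z.2 ≤ θ * (η / θ * z.2) := by gcongr
      _ = η * z.2 := by field_simp
  have hθa0 : 0 < θ * a z.2 := by positivity
  have hcover : ∀ {s t : Set Ω}, (∀ ω ∈ s, ω ∉ A → ω ∉ N → ω ∈ t ∨ ω ∈ T) →
      P.real s ≤ P.real t + 2 * (δ * (z.1 * H z.2)) := by
    intro s t hst
    have h1 : P.real s ≤ P.real (t ∪ T) + (P.real A + P.real N) := by
      refine real_le_add₃ fun ω hω => ?_
      by_cases q1 : ω ∈ A
      · exact Or.inr (Or.inl q1)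
      by_cases q2 : ω ∈ N
      · exact Or.inr (Or.inr q2)
      exact Or.inl (hst ω hω q1 q2)
    have h2 := measureReal_union_le (μ := P) t T
    have h3 : P.real T ≤ δ * (z.1 * H z.2) := e1
    linarith
  have hupper : P.real {ω | z.2 < Y z.1 ω} ≤ ((κ + δ) * (1 + δ) + 2 * δ) * (z.1 * H z.2) := by
    have h1 := hcover (s := {ω | z.2 < Y z.1 ω}) (t := {ω | z.2 - θ * a z.2 < S ω})
      fun ω hω hA' hN' => by
        obtain ⟨g1, g2, g3, g4⟩ := hgood ω hA' hN'
        have hω' : z.2 < Y z.1 ω := hω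
        have := (abs_le.1 g3).2
        by_cases q : θ * a z.2 < R ω
        · exact Or.inr ⟨g1, by linarith, q, g2⟩
        · refine Or.inl ?_
          show z.2 - θ * a z.2 < S ω
          linarith
    rw [hwalk] at h1
    have h2 := (e2 (z.2 - θ * a z.2) (by linarith)).1
    calc _ ≤ _ := h1
      _ ≤ (κ + δ) * (z.1 * ((1 + δ) * H z.2)) + 2 * (δ * (z.1 * H z.2)) := by
          gcongr
          refine h2.trans ?_
          gcongr
      _ = _ := by ring
  have hlower : (κ - δ) * (z.1 * H (z.2 + θ * a z.2)) - 2 * (δ * (z.1 * H z.2)) ≤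
      P.real {ω | z.2 < Y z.1 ω} := by
    have h1 := hcover (s := {ω | z.2 + θ * a z.2 < S ω}) (t := {ω | z.2 < Y z.1 ω})
      fun ω hω hA' hN' => by
        obtain ⟨g1, g2, g3, g4⟩ := hgood ω hA' hN'
        have hω' : z.2 + θ * a z.2 < S ω := hω
        have := (abs_le.1 g3).1
        by_cases q : θ * a z.2 < R ω
        · exact Or.inr ⟨g1, by linarith, q, g2⟩
        · refine Or.inl ?_
          show z.2 < Y z.1 ω
          linarith
    rw [hwalk] at h1
    have h2 := (e2 (z.2 + θ * a z.2) (by nlinarith)).2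
    linarith
  have e6' : (1 - δ) * H z.2 ≤ H (z.2 + θ * a z.2) := by
    rwa [neg_mul, sub_neg_eq_add] at e6
  rw [Real.dist_eq, abs_lt]
  constructor
  · have : κ - ε₀ < P.real {ω | z.2 < Y z.1 ω} / (z.1 * H z.2) := by
      rw [lt_div_iff₀ hnH]
      rcases le_or_gt (κ - δ) 0 with hκδ | hκδ
      · refine lt_of_lt_of_le (mul_neg_of_neg_of_pos ?_ hnH) measureReal_nonneg
        nlinarith
      · refine lt_of_lt_of_le ?_ hlower
        have h1 : (κ - δ) * (z.1 * ((1 - δ) * H z.2)) ≤ (κ - δ) * (z.1 * H (z.2 + θ * a z.2)) := by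
          gcongr
        have h2 : κ - ε₀ < (κ - δ) * (1 - δ) - 2 * δ := by nlinarith
        have h3 := mul_lt_mul_of_pos_right h2 hnH
        linarith
    linarith
  · have : P.real {ω | z.2 < Y z.1 ω} / (z.1 * H z.2) < κ + ε₀ := by
      rw [div_lt_iff₀ hnH]
      refine lt_of_le_of_lt hupper ?_
      refine mul_lt_mul_of_pos_right ?_ hnH
      nlinarith
    linarith

end LDRegime

/-! ### Linear processes in the large deviation regime. -/

namespace LDRegime

variable {Ω : Type*} [MeasurableSpace Ω] {P : Measure Ω} [IsProbabilityMeasure P]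
  {W X : ℤ → Ω → ℝ} {H a : ℝ → ℝ} {l : Filter (ℕ × ℝ)} {κ : ℝ} {ψ : ℕ → ℝ}

/-- Linear processes, if `H (c * y)` is negligible with respect to `n * H y` for all `c`. -/
lemma tendsto_linear (h : LDRegime P W H l κ) (hW : Noise P W H) (hT : HeavyTail H a)
    (hψ : Summable fun j => |ψ j|) (hm : 0 < m0 ψ)
    (hX : ∀ t : ℤ, ∀ᵐ ω ∂P, HasSum (fun j : ℕ => ψ j * W (t - (j : ℤ)) ω) (X t ω))
    {δ : ℝ} (hδ0 : 0 < δ) (hδ1 : δ < 1) (hδ : Summable fun i => tailSum ψ i ^ δ)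
    (hA : ∀ c : ℝ, 0 < c → ∀ ε : ℝ, 0 < ε → ∀ᶠ z in l, H (c * z.2) ≤ ε * (z.1 * H z.2)) :
    Tendsto (fun z => P.real {ω | m0 ψ * z.2 < partialSum X z.1 ω} / (z.1 * H z.2)) l (𝓝 κ) := by
  set b : ℕ → ℝ := fun i => tailSum ψ i / m0 ψ with hbdef
  have hb0 : ∀ i, 0 ≤ b i := fun i => div_nonneg (tailSum_nonneg ψ i) hm.le
  obtain ⟨s, hb⟩ := SplitWeights.of_rpow hb0 hδ0 hδ1 (by
    simp_rw [hbdef, Real.div_rpow (tailSum_nonneg ψ _) hm.le]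
    exact hδ.div_const _)
  have htw : ∀ (n : ℕ) k, twoSided (tailSum ψ) n k = m0 ψ * twoSided b n k := by
    intro n k
    simp only [twoSided, pastWeight, hbdef]
    split_ifs <;> field_simp <;> simp
  have := h.tendsto_perturbation hW hT hb hA (fun n ω => partialSum X n ω / m0 ψ) (by
    filter_upwards [ae_all_iff.2 hX] with ω hω n hn
    have h1 := abs_partialSum_sub_le (n := n) hψ hω (by
      simp_rw [htw, mul_assoc]
      exact hn.mul_left _)
    simp_rw [htw, mul_assoc] at h1
    rw [tsum_mul_left] at h1
    have e : partialSum X n ω / m0 ψ - ∑ i ∈ Finset.Icc (1 : ℤ) n, W i ω =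
        (partialSum X n ω - m0 ψ * ∑ i ∈ Finset.Icc (1 : ℤ) n, W i ω) / m0 ψ := by
      field_simp
    rw [e, abs_div, abs_of_pos hm, div_le_iff₀ hm, mul_comm _ (m0 ψ)]
    exact h1)
  refine this.congr fun z => ?_
  simp_rw [lt_div_iff₀ hm, mul_comm z.2]

/-- The degenerate linear process with a single nonzero coefficient. -/
lemma tendsto_scaled (h : LDRegime P W H l κ)
    (hψ : Summable fun j => |ψ j|) (hm : 0 < m0 ψ)
    (hX : ∀ t : ℤ, ∀ᵐ ω ∂P, HasSum (fun j : ℕ => ψ j * W (t - (j : ℤ)) ω) (X t ω))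
    (h0 : ∀ i, tailSum ψ i = 0) :
    Tendsto (fun z => P.real {ω | m0 ψ * z.2 < partialSum X z.1 ω} / (z.1 * H z.2)) l (𝓝 κ) := by
  have htw : ∀ (n : ℕ) k, twoSided (tailSum ψ) n k = 0 := by
    intro n k
    simp [twoSided, pastWeight, h0]
  have e : ∀ z : ℕ × ℝ, P.real {ω | m0 ψ * z.2 < partialSum X z.1 ω} = walkTail P W z.1 z.2 := by
    intro z
    rw [walkTail]
    refine measureReal_congr ?_
    filter_upwards [ae_all_iff.2 hX] with ω hω
    have h1 := abs_partialSum_sub_le (n := z.1) hψ hω (by simp [htw])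
    simp only [htw, zero_mul, tsum_zero, abs_nonpos_iff, sub_eq_zero] at h1
    refine propext ?_
    show m0 ψ * z.2 < partialSum X z.1 ω ↔ z.2 < partialSum W z.1 ω
    rw [h1, partialSum_eq_sum_Icc, mul_lt_mul_iff_right₀ hm]
  simp_rw [e]
  obtain ⟨η, h1, h2, h3⟩ := h.ld
  refine Metric.tendsto_nhds.2 fun ε hε => ?_
  filter_upwards [h3 (ε / 2) (half_pos hε), h.tendsto_y.eventually_ge_atTop 0] with z hz hy
  rw [Real.dist_eq]
  have := hz z.2 (by nlinarith)
  linarith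

/-- Finite moving averages. -/
lemma tendsto_moving_average (h : LDRegime P W H l κ) (hW : Noise P W H) (hT : HeavyTail H a)
    (hint : ∀ k, Integrable (W k) P) (hmean : ∀ k, ∫ ω, W k ω ∂P = 0)
    (hψ : Summable fun j => |ψ j|) (hm0 : 0 < m0 ψ)
    (hX : ∀ t : ℤ, ∀ᵐ ω ∂P, HasSum (fun j : ℕ => ψ j * W (t - (j : ℤ)) ω) (X t ω))
    {m : ℕ} (hm : 1 ≤ m) (hψm : ∀ j, m < j → ψ j = 0)
    (hLN : m0' ψ ≠ m0 ψ →
      ∀ c : ℝ, 0 < c → Tendsto (fun x => Real.log (H (c * x)) / Real.log (H x)) atTop (𝓝 1))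
    (hH : ∀ η : ℝ, 0 < η → ∀ ε : ℝ, 0 < ε → ∀ᶠ z in l, H (η * z.2) ^ 2 ≤ ε * H z.2)
    (hA : ∀ ε : ℝ, 0 < ε → ∀ᶠ z in l, H (m0 ψ / m0' ψ * z.2) ≤ ε * (z.1 * H z.2)) :
    Tendsto (fun z => P.real {ω | m0 ψ * z.2 < partialSum X z.1 ω} / (z.1 * H z.2)) l (𝓝 κ) := by
  have htail : ∀ i, m ≤ i → tailSum ψ i = 0 := fun i hi => by
    rw [tailSum]
    convert tsum_zero with j
    rw [hψm _ (by omega), abs_zero]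
  have hin : ∀ (n : ℕ) (k : ℤ), k ∈ Finset.Icc (1 : ℤ) (n - m) → totalWeight ψ n k = m0 ψ := by
    intro n k hk
    have h1 := abs_totalWeight_sub_le hψ n k
    rw [Finset.mem_Icc] at hk
    rw [if_pos (by rw [Finset.mem_Icc]; omega), twoSided, if_pos hk.1, pastWeight,
      if_pos (by omega), htail _ (by omega), abs_nonpos_iff, sub_eq_zero] at h1
    exact h1
  have hout : ∀ (n : ℕ) (k : ℤ), k ∉ Finset.Icc (1 - m : ℤ) n → totalWeight ψ n k = 0 := by
    intro n k hk
    have h1 := abs_totalWeight_sub_le hψ n k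
    rw [Finset.mem_Icc] at hk
    rw [if_neg (by rw [Finset.mem_Icc]; omega), sub_zero] at h1
    have h2 : twoSided (tailSum ψ) n k = 0 := by
      rw [twoSided, pastWeight, pastWeight]
      split_ifs
      · omega
      · rfl
      · exact htail _ (by omega)
      · rfl
    rw [h2] at h1
    exact abs_nonpos_iff.1 h1
  -- Away from the ends the weight is exactly `m0 ψ`, and beyond distance `m` it vanishes; the at
  -- most `2 * m` remaining boundary indices form `J`.
  set J : ℕ → Finset ℤ := fun n => Finset.Icc (1 - m : ℤ) n \ Finset.Icc (1 : ℤ) (n - m) with hJ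
  set d : ℕ → ℤ → ℝ := fun n k => totalWeight ψ n k / m0 ψ with hd
  have hsub : ∀ n : ℕ, Finset.Icc (1 : ℤ) (n - m) ⊆ Finset.Icc (1 - m : ℤ) n := fun n =>
    Finset.Icc_subset_Icc (by omega) (by omega)
  have hJd : ∀ n : ℕ, Disjoint (Finset.Icc (1 : ℤ) (n - m)) (J n) := fun n =>
    Finset.disjoint_sdiff
  have hJc : ∀ n, (J n).card ≤ 2 * m := by
    intro n
    rw [hJ, Finset.card_sdiff_of_subset (hsub n), Int.card_Icc, Int.card_Icc]
    omega
  have hrep : ∀ z : ℕ × ℝ, P.real {ω | m0 ψ * z.2 < partialSum X z.1 ω} =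
      P.real {ω | z.2 < ∑ i ∈ Finset.Icc (1 : ℤ) (z.1 - m), W i ω +
        ∑ j ∈ J z.1, d z.1 j * W j ω} := by
    intro z
    refine measureReal_congr ?_
    filter_upwards [ae_all_iff.2 hX] with ω hω
    have h1 := (hasSum_totalWeight (n := z.1) hω).unique
      (hasSum_sum_of_ne_finset_zero (s := Finset.Icc (1 - m : ℤ) z.1)
        (L := SummationFilter.unconditional ℤ) fun k hk => by rw [hout z.1 k hk, zero_mul])
    have h2 : partialSum X z.1 ω = m0 ψ * (∑ i ∈ Finset.Icc (1 : ℤ) (z.1 - m), W i ω +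
        ∑ j ∈ J z.1, d z.1 j * W j ω) := by
      rw [h1, ← Finset.sum_sdiff (hsub z.1), mul_add, Finset.mul_sum, Finset.mul_sum, add_comm]
      congr 1
      · exact Finset.sum_congr rfl fun k hk => by rw [hin z.1 k hk]
      · refine Finset.sum_congr rfl fun k _ => ?_
        rw [hd]
        field_simp
    refine propext ?_
    show m0 ψ * z.2 < partialSum X z.1 ω ↔ z.2 < ∑ i ∈ Finset.Icc (1 : ℤ) (z.1 - m), W i ω +
        ∑ j ∈ J z.1, d z.1 j * W j ω
    rw [h2, mul_lt_mul_iff_right₀ hm0]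
  simp_rw [hrep]
  have hbd := totalWeight_bounds hψ
  by_cases hsign : m0' ψ = m0 ψ
  · refine h.tendsto_add_of_nonneg hW hT hH hm J d hJd hJc (fun n k => ?_) (fun n k => ?_)
    · have := (hbd n k).1
      rw [hsign, sub_self, zero_div, neg_zero] at this
      exact div_nonneg this hm0.le
    · have := (hbd n k).2
      rw [hsign, add_self_div_two] at this
      exact (div_le_one hm0).2 this
  · have hle : m0 ψ ≤ m0' ψ := hψ.of_abs.tsum_le_tsum (fun j => le_abs_self _) hψ
    have hlt : m0 ψ < m0' ψ := lt_of_le_of_ne hle (Ne.symm hsign)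
    have hm0' : 0 < m0' ψ := hm0.trans hlt
    -- The relative weights are bounded by `D = (m0' + m0) / (2 * m0)`, and `D * (m0 / m0') < 1` as
    -- the mean of `m0` and `m0'` is smaller than `m0'`.
    refine h.tendsto_add_of_LN hW hT hint hmean (hLN hsign) hH (c := m0 ψ / m0' ψ)
      (D := (m0' ψ + m0 ψ) / 2 / m0 ψ) (by positivity) ((div_lt_one hm0').2 hlt) ?_ hA hm J d hJd
      hJc fun n k => ?_
    · rw [show (m0' ψ + m0 ψ) / 2 / m0 ψ * (m0 ψ / m0' ψ) = (m0' ψ + m0 ψ) / 2 / m0' ψ by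
        field_simp, div_lt_one hm0']
      linarith
    · rw [hd, abs_div, abs_of_pos hm0]
      have := hbd n k
      gcongr
      exact abs_le.2 ⟨by linarith, by linarith⟩

end LDRegime

/-! ### Transfer of the assumptions on the noise. -/

section Laws

variable {ν : Measure ℝ} [IsProbabilityMeasure ν] {p q : ℝ} {a : ℝ → ℝ}

lemma absTail_eq_div {c : ℝ} (hc : 0 < c) (x : ℝ) : absTail ν c x = absTail ν 1 (x / c) := by
  rw [absTail_one, absTail]
  congr 1
  ext z
  simp only [Set.mem_ofPred_eq]
  rw [div_lt_iff₀ hc, mul_comm]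

/-- The slow variation of `-log` of the right tail carries over to the two-sided tail. -/
lemma IsSubexp.tendsto_log_ratio (h : IsSubexp ν p q) (hLN : IsLN ν)
    (hT : HeavyTail (absTail ν 1) a) {c : ℝ} (hc : 0 < c) :
    Tendsto (fun x => Real.log (absTail ν 1 (c * x)) / Real.log (absTail ν 1 x)) atTop (𝓝 1) := by
  obtain ⟨S, hS, hSc, -⟩ := hLN
  set Q : ℝ → ℝ := fun x => -Real.log (absTail ν 1 x) with hQ
  have hQt : Tendsto Q atTop atTop := hT.tendsto_neg_log
  -- The two tails differ by a factor tending to `p > 0`, which is negligible on the logarithmic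
  -- scale.
  have h1 : Tendsto (fun x => S x / Q x) atTop (𝓝 1) := by
    have h2 : Tendsto (fun x => Real.log (rightTail ν x / absTail ν 1 x)) atTop
        (𝓝 (Real.log p)) := (Real.continuousAt_log h.p_pos.ne').tendsto.comp h.tendsto_right
    have h3 := (h2.div_atTop hQt).const_sub 1
    rw [sub_zero] at h3
    refine h3.congr' ?_
    filter_upwards [hS, hQt.eventually_gt_atTop 0] with x hx hx0
    have hr : rightTail ν x ≠ 0 := by
      rw [hx]
      exact (Real.exp_pos _).ne'
    rw [Real.log_div hr (hT.pos x).ne', hx, Real.log_exp, eq_div_iff hx0.ne', sub_mul,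
      div_mul_cancel₀ _ hx0.ne']
    simp only [hQ]
    ring
  have h2 : Tendsto (fun x => (S (c * x) / Q (c * x))⁻¹ * (S (c * x) / S x) * (S x / Q x)) atTop
      (𝓝 (1⁻¹ * 1 * 1)) :=
    (((h1.comp (tendsto_id.const_mul_atTop hc)).inv₀ one_ne_zero).mul (hSc c hc)).mul h1
  rw [inv_one, one_mul, one_mul] at h2
  refine h2.congr' ?_
  have hne := h1.eventually_ne one_ne_zero
  filter_upwards [hne, (tendsto_id.const_mul_atTop hc).eventually hne,
    hQt.eventually_gt_atTop 0] with x e1 e2 e3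
  have n1 := (div_ne_zero_iff.1 e1).1
  obtain ⟨n2, n3⟩ := div_ne_zero_iff.1 e2
  simp only [id] at n2 n3
  have e : Real.log (absTail ν 1 (c * x)) / Real.log (absTail ν 1 x) = Q (c * x) / Q x :=
    (neg_div_neg_eq _ _).symm
  rw [e]
  field_simp

lemma IsSubexp.rightTail_pos (h : IsSubexp ν p q) (x : ℝ) : 0 < ν.real (Set.Ioi x) := by
  have h1 := h.pos_part.rightTail_pos (max x 0)
  rw [rightTail_map_max (le_max_right _ _)] at h1
  exact h1.trans_le (measureReal_mono (Set.Ioi_subset_Ioi (le_max_left _ _)))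

lemma IsSubexp.leftTail_pos (h : IsSubexp ν p q) (hq : 0 < q) (x : ℝ) :
    0 < ν.real (Set.Iic (-x)) := by
  obtain ⟨y, h1, h2⟩ := ((h.left_balance.eventually_const_lt hq).and
    (eventually_ge_atTop x)).exists
  have h3 : 0 < ν.real {z | y < -z} := by
    refine lt_of_le_of_ne measureReal_nonneg fun h0 => ?_
    rw [← h0, zero_div] at h1
    exact lt_irrefl _ h1
  refine h3.trans_le (measureReal_mono fun z hz => ?_)
  have hz' : y < -z := hz
  show z ≤ -x
  linarith

/-- The shift by one absorbs the difference between a non-strict and a strict inequality. -/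
lemma leftTail_le_absTail (x : ℝ) : ν.real (Set.Iic (-x)) ≤ absTail ν 1 (x - 1) := by
  rw [absTail_one]
  refine measureReal_mono fun z hz => ?_
  have hz' : z ≤ -x := hz
  show x - 1 < |z|
  have := neg_le_abs z
  linarith

lemma IsSubexp.tendsto_left (h : IsSubexp ν p q) (hT : HeavyTail (absTail ν 1) a) :
    Tendsto (fun x => ν.real (Set.Iic (-x)) / absTail ν 1 x) atTop (𝓝 q) := by
  have h1 : Tendsto (fun x => ν.real {z | x < -z} / absTail ν 1 x) atTop (𝓝 q) :=
    h.left_balance.congr fun x => by rw [absTail_one]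
  have h2 := (h1.comp (tendsto_atTop_add_const_right atTop (-1) tendsto_id)).mul (hT.long 1)
  rw [mul_one] at h2
  refine tendsto_of_tendsto_of_tendsto_of_le_of_le h1 h2 (fun x => ?_) (fun x => ?_)
  · have := hT.pos x
    refine div_le_div_of_nonneg_right (measureReal_mono fun z hz => ?_) this.le
    have hz' : x < -z := hz
    show z ≤ -x
    linarith
  · have h3 := hT.pos x
    have h4 := hT.pos (x - 1)
    show _ ≤ ν.real {z | id x + -1 < -z} / absTail ν 1 (id x + -1) *
      (absTail ν 1 (x - 1) / absTail ν 1 x)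
    rw [id, ← sub_eq_add_neg, div_mul_div_cancel₀ h4.ne']
    refine div_le_div_of_nonneg_right (measureReal_mono fun z hz => ?_) h3.le
    have hz' : z ≤ -x := hz
    show x - 1 < -z
    linarith

end Laws

section LargeDeviations

variable {Ω : Type*} [MeasurableSpace Ω] {P : Measure Ω} [IsProbabilityMeasure P]
  {Z : ℤ → Ω → ℝ} {ν : Measure ℝ} [IsProbabilityMeasure ν] {p q : ℝ} {a : ℝ → ℝ}
  {t : ℕ → ℝ} {Λ : ℕ → Set ℝ} {δ₀ m : ℝ}

lemma noise_of_sign (hZmeas : ∀ t, Measurable (Z t)) (hZlaw : ∀ t, P.map (Z t) = ν)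
    (hZindep : iIndepFun Z P) {σ : ℝ} (hσ : |σ| = 1) :
    Noise P (fun k ω => σ * Z k ω) (absTail ν 1) where
  meas k := (hZmeas k).const_mul σ
  indep := hZindep.comp (fun _ z => σ * z) fun _ => by fun_prop
  ident i j := by
    have h : ∀ i, P.map (fun ω => σ * Z i ω) = ν.map (fun z => σ * z) := fun i => by
      rw [← hZlaw i, Measure.map_map (by fun_prop) (hZmeas i)]
      rfl
    rw [h, h]
  tail k x := by
    have hm : Measurable fun z : ℝ => |z| := by fun_prop
    rw [absTail_one, ← hZlaw k, map_measureReal_apply (hZmeas k)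
      (measurableSet_lt measurable_const hm)]
    simp only [abs_mul, hσ, one_mul]
    rfl

lemma tendsto_fst_unifFilter (Λ : ℕ → Set ℝ) : Tendsto Prod.fst (unifFilter Λ) atTop :=
  tendsto_comap.mono_left inf_le_left

/-- The large deviation regime of the noise, after normalising the sign. -/
lemma ldRegime_of_noiseLargeDev (hS : IsSubexp ν p q) (hT : HeavyTail (absTail ν 1) a)
    {σ : ℝ} (hσ : σ = if 0 < m then 1 else -1) (hm : m ≠ 0)
    (hW : Noise P (fun k ω => σ * Z k ω) (absTail ν 1))
    (hmean : ∫ ω, σ * Z 1 ω ∂P = 0) (hδ₀ : 0 < δ₀)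
    (hΛ : ∀ n, Λ n ⊆ Set.Ioi (|m| * t n * (1 + δ₀))) (hLD : NoiseLargeDev P Z ν q t m) :
    LDRegime P (fun k ω => σ * Z k ω) (absTail ν 1)
      (map (fun z : ℕ × ℝ => (z.1, z.2 / |m|)) (unifFilter Λ)) (if 0 < m then p else q) := by
  have hm' : 0 < |m| := abs_pos.2 hm
  have hn : Tendsto (fun z : ℕ × ℝ => z.1)
      (map (fun z : ℕ × ℝ => (z.1, z.2 / |m|)) (unifFilter Λ)) atTop :=
    tendsto_map'_iff.2 (tendsto_fst_unifFilter Λ)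
  -- Chosen so that `(1 - η) * (1 + δ₀) = 1 + δ₀ / 2`: levels lowered by the fraction `η` remain in
  -- the range of the assumption with `δ = δ₀ / 2`.
  set η := δ₀ / (2 * (1 + δ₀)) with hη
  have hη0 : 0 < η := by positivity
  have hη1 : η < 1 := by
    rw [hη, div_lt_one (by positivity)]
    linarith
  have hηδ : (1 - η) * (1 + δ₀) = 1 + δ₀ / 2 := by
    rw [hη]
    field_simp
    ring
  have hsum : ∀ n ω, partialSum (fun k ω => σ * Z k ω) n ω = σ * partialSum Z n ω := fun n ω => by
    simp only [partialSum, Finset.mul_sum]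
  have hld : ∀ {f : ℕ → ℝ → ℝ} {c : ℝ},
      UnifTendsto (fun n => Set.Ioi ((1 + δ₀ / 2) * t n)) f c → ∀ ε : ℝ, 0 < ε →
      ∀ᶠ z in map (fun z : ℕ × ℝ => (z.1, z.2 / |m|)) (unifFilter Λ), ∀ u, (1 - η) * z.2 ≤ u →
        |f z.1 u - c| ≤ ε := by
    intro f c hf ε hε
    rw [eventually_map, eventually_unifFilter]
    filter_upwards [hf ε hε] with n hn x hx u hu
    refine hn u ?_
    have h1 : |m| * t n * (1 + δ₀) < x := hΛ n hx
    have h2 : t n * (1 + δ₀) < x / |m| := by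
      rw [lt_div_iff₀ hm']
      linarith
    have h3 : (1 - η) * (t n * (1 + δ₀)) < (1 - η) * (x / |m|) :=
      mul_lt_mul_of_pos_left h2 (by linarith)
    show (1 + δ₀ / 2) * t n < u
    rw [← hηδ]
    calc (1 - η) * (1 + δ₀) * t n = (1 - η) * (t n * (1 + δ₀)) := by ring
      _ < _ := h3
      _ ≤ u := hu
  rcases hm.lt_or_gt with hneg | hpos
  · rw [if_neg (not_lt.2 hneg.le)] at hσ ⊢
    have hwt : ∀ n u, walkTail P (fun k ω => σ * Z k ω) n u =
        P.real {ω | u < -partialSum Z n ω} := fun n u => by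
      rw [walkTail]
      simp only [hsum]
      simp only [hσ, neg_one_mul]
    rcases hS.q_nonneg.eq_or_lt with hq | hq
    -- For `q = 0` the left tail may vanish, so the regime is normalised by the two-sided tail, with
    -- limit zero.
    · refine LDRegime.of_tendsto hW hT hmean hn hη0 hη1 (G := absTail ν 1) (c := 0) hS.q_nonneg
        zero_le_one hS.absTail_pos (fun u => absTail_anti (by linarith)) ?_ ?_
      · simp [← hq]
      · simp_rw [hwt]
        exact hld (hLD.left_negligible hneg hq.symm (δ₀ / 2) (by positivity))
    · refine LDRegime.of_tendsto hW hT hmean hn hη0 hη1 (G := fun u => ν.real (Set.Iic (-u)))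
        (c := 1) hS.q_nonneg le_rfl (hS.leftTail_pos hq) leftTail_le_absTail ?_ ?_
      · simpa using hS.tendsto_left hT
      · simp_rw [hwt]
        exact hld (hLD.left hneg hq (δ₀ / 2) (by positivity))
  · rw [if_pos hpos] at hσ ⊢
    have hwt : ∀ n u, walkTail P (fun k ω => σ * Z k ω) n u =
        P.real {ω | u < partialSum Z n ω} := fun n u => by
      rw [walkTail]
      simp only [hsum]
      simp only [hσ, one_mul]
    refine LDRegime.of_tendsto hW hT hmean hn hη0 hη1 (G := fun u => ν.real (Set.Ioi u)) (c := 1)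
      hS.p_pos.le le_rfl hS.rightTail_pos
      (fun u => (rightTail_le_absTail u).trans (absTail_anti (by linarith))) ?_ ?_
    · simp only [one_mul]
      exact hS.tendsto_right
    · simp_rw [hwt]
      exact hld (hLD.right hpos (δ₀ / 2) (by positivity))

end LargeDeviations

end LargeDev

end

/-! ### The proposition. -/

theorem proposition4p2 {Ω : Type*} [MeasurableSpace Ω] (P : Measure Ω) [IsProbabilityMeasure P]
    -- the iid noise, with mean zero and a law in S ∩ MDA(Gumbel)
    (Z : ℤ → Ω → ℝ) (ν : Measure ℝ) [IsProbabilityMeasure ν]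
    (hZmeas : ∀ t, Measurable (Z t)) (hZlaw : ∀ t, P.map (Z t) = ν) (hZindep : iIndepFun Z P)
    (hint : Integrable (fun z : ℝ => z) ν) (hmean : ∫ z, z ∂ν = 0)
    (p q : ℝ) (hS : LargeDev.IsSubexp ν p q) (hMDA : LargeDev.IsGumbelMDA ν)
    -- the weights and the causal linear process
    (ψ : ℕ → ℝ) (hψ : LargeDev.IsWeight ψ) (hm0 : LargeDev.m0 ψ ≠ 0)
    (X : ℤ → Ω → ℝ)
    (hX : ∀ t : ℤ, ∀ᵐ ω ∂P, HasSum (fun j : ℕ => ψ j * Z (t - (j : ℤ)) ω) (X t ω))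
    -- the auxiliary function and the function g
    (a : ℝ → ℝ) (ha : LargeDev.IsAuxiliary ν a) (g : ℝ → ℝ) (hg : g =o[atTop] a)
    -- the separating sequence, the sets, and the large deviations of the noise
    (t : ℕ → ℝ) (Λ : ℕ → Set ℝ) (δ₀ : ℝ) (hδ₀ : 0 < δ₀)
    (hΛ : ∀ n, Λ n ⊆ Set.Ioi (|LargeDev.m0 ψ| * t n * (1 + δ₀)))
    (hLD : LargeDev.NoiseLargeDev P Z ν q t (LargeDev.m0 ψ)) :
    -- the general case
    (LargeDev.UnifTendsto Λ
        (fun n x => LargeDev.absTail ν (LargeDev.m1 ψ) (g x) /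
          (n * LargeDev.absTail ν |LargeDev.m0 ψ| x)) 0 →
      LargeDev.UnifTendsto Λ
        (fun n x => P.real {ω | x < LargeDev.partialSum X n ω} /
          (n * LargeDev.absTail ν 1 (x / |LargeDev.m0 ψ|)))
        (if 0 < LargeDev.m0 ψ then p else q)) ∧
    -- the case of a finite moving average
    (∀ m : ℕ, 1 ≤ m → (∀ j, m < j → ψ j = 0) →
      (LargeDev.m0' ψ ≠ |LargeDev.m0 ψ| → LargeDev.IsLN ν) →
      LargeDev.UnifTendsto Λ
        (fun n x =>
          LargeDev.absTail ν (LargeDev.m0' ψ) x / (n * LargeDev.absTail ν |LargeDev.m0 ψ| x) +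
          (LargeDev.absTail ν (LargeDev.m0' ψ) (g x)) ^ 2 /
            LargeDev.absTail ν |LargeDev.m0 ψ| x) 0 →
      LargeDev.UnifTendsto Λ
        (fun n x => P.real {ω | x < LargeDev.partialSum X n ω} /
          (n * LargeDev.absTail ν 1 (x / |LargeDev.m0 ψ|)))
        (if 0 < LargeDev.m0 ψ then p else q)) := by
  -- Multiplying both coefficients and noise by the sign `σ` leaves `X` unchanged and makes the
  -- coefficient sum equal to `|m0 ψ|`.
  set σ : ℝ := if 0 < LargeDev.m0 ψ then 1 else -1 with hσ
  have hσ1 : |σ| = 1 := by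
    rw [hσ]
    split_ifs <;> simp
  have hσ2 : σ * σ = 1 := by rw [← abs_mul_abs_self, hσ1, one_mul]
  set φ : ℕ → ℝ := fun j => σ * ψ j with hφ
  set W : ℤ → Ω → ℝ := fun k ω => σ * Z k ω with hWdef
  have hφabs : ∀ j, |φ j| = |ψ j| := fun j => by rw [hφ, abs_mul, hσ1, one_mul]
  have hφm0 : LargeDev.m0 φ = |LargeDev.m0 ψ| := by
    rw [LargeDev.m0, hφ, tsum_mul_left]
    change σ * LargeDev.m0 ψ = _
    rw [hσ]
    split_ifs with h
    · rw [one_mul, abs_of_pos h]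
    · rw [neg_one_mul, abs_of_nonpos (not_lt.1 h)]
  have hφm0' : LargeDev.m0' φ = LargeDev.m0' ψ := by simp only [LargeDev.m0', hφabs]
  have hφt : ∀ i, LargeDev.tailSum φ i = LargeDev.tailSum ψ i := fun i => by
    simp only [LargeDev.tailSum, hφabs]
  have hφs : Summable fun j => |φ j| := by simpa only [hφabs] using hψ.summable_abs
  have hM : 0 < |LargeDev.m0 ψ| := abs_pos.2 hm0
  have hφpos : 0 < LargeDev.m0 φ := hφm0 ▸ hM
  have hXW : ∀ t : ℤ, ∀ᵐ ω ∂P, HasSum (fun j : ℕ => φ j * W (t - (j : ℤ)) ω) (X t ω) := by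
    intro t
    filter_upwards [hX t] with ω hω
    convert hω using 2 with j
    rw [hφ, hWdef]
    linear_combination (ψ j * Z (t - (j : ℤ)) ω) * hσ2
  have hT := hS.heavyTail ha
  have hW : LargeDev.Noise P W (LargeDev.absTail ν 1) :=
    LargeDev.noise_of_sign hZmeas hZlaw hZindep hσ1
  have hZint : ∀ k, Integrable (Z k) P := fun k => by
    have : Integrable (fun z : ℝ => z) (P.map (Z k)) := by rw [hZlaw]; exact hint
    exact this.comp_measurable (hZmeas k)
  have hWint : ∀ k, Integrable (W k) P := fun k => (hZint k).const_mul σ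
  have hWmean : ∀ k, ∫ ω, W k ω ∂P = 0 := fun k => by
    have h1 : ∫ ω, Z k ω ∂P = 0 := by
      rw [← hmean, ← hZlaw k, integral_map (hZmeas k).aemeasurable (by fun_prop)]
    rw [hWdef, integral_const_mul, h1, mul_zero]
  set κ := if 0 < LargeDev.m0 ψ then p else q
  set l := map (fun z : ℕ × ℝ => (z.1, z.2 / |LargeDev.m0 ψ|)) (LargeDev.unifFilter Λ) with hl
  have hR : LargeDev.LDRegime P W (LargeDev.absTail ν 1) l κ :=
    LargeDev.ldRegime_of_noiseLargeDev hS hT hσ hm0 hW (hWmean 1) hδ₀ hΛ hLD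
  have hx : Tendsto (fun z : ℕ × ℝ => z.2) (LargeDev.unifFilter Λ) atTop := by
    have h1 : Tendsto (fun z : ℕ × ℝ => z.2 / |LargeDev.m0 ψ|) (LargeDev.unifFilter Λ) atTop :=
      tendsto_map'_iff.1 hR.tendsto_y
    refine (h1.const_mul_atTop hM).congr fun z => ?_
    rw [mul_div_cancel₀ _ hM.ne']
  have hn : Tendsto (fun z : ℕ × ℝ => z.1) (LargeDev.unifFilter Λ) atTop :=
    LargeDev.tendsto_fst_unifFilter Λ
  -- Since `g = o(a)` and `a x = o(x)`, the function `g` is eventually below any positive multiple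
  -- of `x`; this turns tails at `g x` into tails at small multiples of `y`.
  have hgx : ∀ ε : ℝ, 0 < ε → ∀ᶠ z in LargeDev.unifFilter Λ, g z.2 ≤ ε * z.2 := by
    intro ε hε
    refine hx.eventually (p := fun x => g x ≤ ε * x) ?_
    filter_upwards [hg.bound one_pos, hT.a_small hε, hT.a_pos] with x h1 h2 h3
    rw [one_mul, Real.norm_eq_abs, Real.norm_eq_abs, abs_of_pos h3] at h1
    exact (le_abs_self _).trans (h1.trans h2)
  have habs : ∀ x, LargeDev.absTail ν |LargeDev.m0 ψ| x =
      LargeDev.absTail ν 1 (x / |LargeDev.m0 ψ|) := LargeDev.absTail_eq_div hM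
  have hconcl : Tendsto (fun z : ℕ × ℝ =>
      P.real {ω | LargeDev.m0 φ * z.2 < LargeDev.partialSum X z.1 ω} /
        (z.1 * LargeDev.absTail ν 1 z.2)) l (𝓝 κ) →
      LargeDev.UnifTendsto Λ (fun n x => P.real {ω | x < LargeDev.partialSum X n ω} /
          (n * LargeDev.absTail ν 1 (x / |LargeDev.m0 ψ|))) κ := by
    intro h
    rw [LargeDev.unifTendsto_iff]
    refine (tendsto_map'_iff.1 h).congr fun z => ?_
    simp only [Function.comp, hφm0, mul_div_cancel₀ _ hM.ne']
  have hcancel : ∀ {u n : ℝ} (ε : ℝ) (x : ℝ), 0 < n →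
      u / (n * LargeDev.absTail ν |LargeDev.m0 ψ| x) ≤ ε →
      u ≤ ε * (n * LargeDev.absTail ν 1 (x / |LargeDev.m0 ψ|)) := by
    intro u n ε x hn0 hle
    rw [habs] at hle
    have := hT.pos (x / |LargeDev.m0 ψ|)
    rwa [div_le_iff₀ (by positivity)] at hle
  have hn0 : ∀ᶠ z : ℕ × ℝ in LargeDev.unifFilter Λ, (0 : ℝ) < z.1 := by
    filter_upwards [hn.eventually_gt_atTop 0] with z hz
    exact_mod_cast hz
  constructor
  · intro hcond
    rw [LargeDev.unifTendsto_iff] at hcond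
    have hm1 : LargeDev.m1 ψ = LargeDev.tailSum φ 0 := by
      rw [hφt, LargeDev.m1, LargeDev.tailSum]
      simp only [zero_add, add_comm]
    rcases (LargeDev.tailSum_nonneg φ 0).eq_or_lt with h0 | h0
    -- If `m1 ψ = 0`, the hypothesis gives no control of `H (c * y)`, but only the coefficient of
    -- index zero is nonzero, so the sums are exact multiples of the walk.
    · refine hconcl (hR.tendsto_scaled hφs hφpos hXW fun i => ?_)
      have h1 : ∀ j, |φ (0 + 1 + j)| = 0 := fun j => by
        refine le_antisymm ?_ (abs_nonneg _)
        refine ((LargeDev.summable_shift hφs 0).le_tsum j fun _ _ => abs_nonneg _).trans ?_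
        exact h0.symm.le
      rw [LargeDev.tailSum]
      convert tsum_zero with j
      have := h1 (i + j)
      rwa [show 0 + 1 + (i + j) = i + 1 + j by ring] at this
    · rw [← hm1] at h0
      obtain ⟨δ, hδ0, hδ1, hδs⟩ := hψ.summable_tails
      refine hconcl (hR.tendsto_linear hW hT hφs hφpos hXW hδ0 hδ1 ?_ fun c hc ε hε => ?_)
      · simp only [hφt]
        exact hδs
      · rw [hl, eventually_map]
        filter_upwards [hcond.eventually_le_const hε, hn0,
          hgx (c * LargeDev.m1 ψ / |LargeDev.m0 ψ|) (by positivity)] with z h1 h2 h3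
        refine le_trans ?_ (hcancel ε z.2 h2 h1)
        rw [LargeDev.absTail_eq_div h0]
        refine LargeDev.absTail_anti ?_
        rw [div_le_iff₀ h0]
        refine h3.trans_eq ?_
        ring
  · intro m hm hψm hLN hcond
    rw [LargeDev.unifTendsto_iff] at hcond
    have hm0' : 0 < LargeDev.m0' ψ := by
      have h1 : |LargeDev.m0 ψ| ≤ LargeDev.m0' ψ := by
        have := norm_tsum_le_tsum_norm (f := ψ) hψ.summable_abs
        exact this
      exact hM.trans_le h1
    refine hconcl (hR.tendsto_moving_average hW hT hWint hWmean hφs hφpos hXW hm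
      (fun j hj => by rw [hφ]; simp only [hψm j hj, mul_zero]) ?_ (fun η hη ε hε => ?_)
      fun ε hε => ?_)
    · rw [hφm0, hφm0']
      exact fun hne c hc => hS.tendsto_log_ratio (hLN hne) hT hc
    · rw [hl, eventually_map]
      filter_upwards [hcond.eventually_le_const hε, hn0,
        hgx (η * LargeDev.m0' ψ / |LargeDev.m0 ψ|) (by positivity)] with z h1 h2 h3
      have hpos := hT.pos (z.2 / |LargeDev.m0 ψ|)
      have hpos2 := hT.pos (z.2 / LargeDev.m0' ψ)
      rw [habs, LargeDev.absTail_eq_div hm0', LargeDev.absTail_eq_div hm0'] at h1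
      have h4 : LargeDev.absTail ν 1 (g z.2 / LargeDev.m0' ψ) ^ 2 /
          LargeDev.absTail ν 1 (z.2 / |LargeDev.m0 ψ|) ≤ ε :=
        le_trans (le_add_of_nonneg_left (by positivity)) h1
      rw [div_le_iff₀ hpos] at h4
      -- The second summand of the hypothesis supplies `H (η * y) ^ 2 = o(H y)`, as `g x / m0' ψ ≤ η
      -- * y`; the first one supplies `H (m0 / m0' * y) = o(n * H y)`.
      refine le_trans (pow_le_pow_left₀ (hT.pos _).le (LargeDev.absTail_anti ?_) 2) h4
      rw [div_le_iff₀ hm0']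
      refine h3.trans_eq ?_
      ring
    · rw [hl, eventually_map]
      filter_upwards [hcond.eventually_le_const hε, hn0] with z h1 h2
      have hpos : 0 < LargeDev.absTail ν |LargeDev.m0 ψ| z.2 := by
        rw [habs]
        exact hT.pos _
      refine le_trans ?_ (hcancel ε z.2 h2
        (le_trans (le_add_of_nonneg_right (by positivity)) h1))
      rw [LargeDev.absTail_eq_div hm0']
      refine LargeDev.absTail_anti ?_
      rw [hφm0, hφm0']
      refine le_of_eq ?_
      field_simp
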